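/- Let $B^4\subset\mathbb R^4$ be the open unit ball, $S^3=\partial B^4$, and let $\Sigma\subset S^3$ be a smooth embedded closed (compact, connected, without boundary) surface of genus $g\ge 0$. Let $A$ and $A^*$ be the two connected components of $S^3\setminus\Sigma$, and let $N$ be the unit normal to $\Sigma$ in $S^3$ pointing into $A^*$. For $r>0$ put $D^2_+(r)=\{s=(s_1,s_2)\in\mathbb R^2: |s|<r,\ s_1\ge 0\}$, and let $$\Lambda(p,s)=(1-s_1)\big(\cos(s_2)\,p+\sin(s_2)\,N(p)\big),\qquad \Omega_r=\Lambda(\Sigma\times D^2_+(r)).$$ Fix $\varepsilon>0$ such that $\Lambda:\Sigma\times D^2_+(3\varepsilon)\to\overline B^4$ is a diffeomorphism onto a neighbourhood of $\Sigma$ in $\overline B^4$ (this holds for all sufficiently small $\varepsilon$). Let $\phi:[0,3\varepsilon]\to\mathbb R$ be smooth, zero on $[0,\varepsilon]$, strictly increasing on $[\varepsilon,2\varepsilon]$ and one on $[2\varepsilon,3\varepsilon]$, and let $T:\overline B^4\to\overline B^4$ be the identity outside $\Omega_{3\varepsilon}$ and $T(\Lambda(p,s))=\Lambda(p,\phi(|s|)s)$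 on $\Omega_{3\varepsilon}$. For $p\in\Sigma$ and $k\in[-\infty,+\infty]$ let $$\overline Q_{p,k}=-\frac{k}{\sqrt{1+k^2}}\,p-\frac{1}{\sqrt{1+k^2}}\,N(p)\in S^3,\qquad \overline Q_{p,\pm\infty}=\mp p.$$ The extended Gauss map $\overline Q:S^3\cup\overline\Omega_\varepsilon\to S^3$ is defined by $$\overline Q(v)=\begin{cases}-T(v)& v\in A^*\setminus\overline\Omega_\varepsilon,\\ T(v)& v\in A\setminus\overline\Omega_\varepsilon,\\ \overline Q_{p,k},\ \ k=\dfrac{s_2}{\sqrt{\varepsilon^2-s_2^2}}& v=\Lambda(p,s)\in\overline\Omega_\varepsilon,\end{cases}$$ where $k=\pm\infty$ if $s_2=\pm\varepsilon$. Then $\overline Q$ takes values in $S^3$ and is continuous on $S^3\cup\overline\Omega_\varepsilon$, and the continuous map $\overline Q|_{S^3}:S^3\to S^3$ has degree $g$. -/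

import Mathlib

open Set Filter Topology MeasureTheory
open scoped ContDiff Manifold

/-- The ambient space `ℝ⁴`. -/
abbrev E4 : Type := EuclideanSpace ℝ (Fin 4)

/-- The parameter plane `ℝ²`; the coordinates `(s₁, s₂)` are `s 0` and `s 1`. -/
abbrev E2 : Type := EuclideanSpace ℝ (Fin 2)

/-- The unit sphere `S³ ⊂ ℝ⁴`, as a set. -/
abbrev S3 : Set E4 := Metric.sphere (0 : E4) 1

instance factFinrankE4 : Fact (Module.finrank ℝ E4 = 3 + 1) := ⟨by simp⟩

noncomputable section

/-! ### Closed embedded surfaces in `S³` and their genus -/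

/-- `S ⊂ S³` is a smooth embedded closed (compact, without boundary) connected surface:
near each of its points it is the zero set in `S³` of a smooth function whose differential
does not vanish on the tangent space of `S³`. -/
structure IsClosedSurface (S : Set E4) : Prop where
  subset_sphere : S ⊆ S3
  isCompact : IsCompact S
  isConnected : IsConnected S
  locally_regular_level : ∀ p ∈ S, ∃ (U : Set E4) (f : E4 → ℝ), IsOpen U ∧ p ∈ U ∧
    ContDiffOn ℝ ∞ f U ∧ S ∩ U = {x ∈ S3 ∩ U | f x = 0} ∧
    ∃ w : E4, inner ℝ p w = 0 ∧ fderiv ℝ f p w ≠ 0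

/-- A smooth triangulation of `S`: a finite geometric simplicial complex `K` together with a
homeomorphism of its (compact) underlying space onto `S`, which is smooth with injective
differential on each closed simplex. -/
structure SmoothTriangulation (S : Set E4) where
  dim : ℕ
  K : Geometry.SimplicialComplex ℝ (EuclideanSpace ℝ (Fin dim))
  finite_faces : K.faces.Finite
  toFun : EuclideanSpace ℝ (Fin dim) → E4
  continuousOn : ContinuousOn toFun K.space
  bijOn : BijOn toFun K.space S
  contDiffOn : ∀ s ∈ K.faces, ContDiffOn ℝ ∞ toFun (convexHull ℝ (s : Set _))
  injective_differential : ∀ s ∈ K.faces, ∀ x ∈ convexHull ℝ (s : Set _),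
    ∀ w ∈ vectorSpan ℝ (s : Set (EuclideanSpace ℝ (Fin dim))),
      fderivWithin ℝ toFun (convexHull ℝ (s : Set _)) x w = 0 → w = 0

/-- The Euler characteristic of a triangulation: the alternating sum of the numbers of
simplices (a simplex with `k` vertices has dimension `k - 1`, hence sign `(-1)^(k+1)`). -/
def SmoothTriangulation.eulerChar {S : Set E4} (τ : SmoothTriangulation S) : ℤ :=
  ∑ s ∈ τ.finite_faces.toFinset, (-1 : ℤ) ^ (s.card + 1)

/-- A closed connected (orientable) surface has genus `g` if its Euler characteristic, computed
from a smooth triangulation, is `2 - 2g`. -/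
def HasGenus (S : Set E4) (g : ℕ) : Prop :=
  ∃ τ : SmoothTriangulation S, τ.eulerChar = 2 - 2 * (g : ℤ)

/-! ### The two sides of the surface and the unit normal -/

/-- `A` and `A'` are the two distinct connected components of `S³ \ S`. -/
def AreComplementComponents (S A A' : Set E4) : Prop :=
  A ≠ A' ∧ {C : Set E4 | ∃ x ∈ S3 \ S, C = connectedComponentIn (S3 \ S) x} = {A, A'}

/-- On `S`, the map `N` is the unit normal to `S` in `S³` that points into `A'`. -/
def IsUnitNormalInto (S A' : Set E4) (N : E4 → E4) : Prop :=
  ∀ p ∈ S, ‖N p‖ = 1 ∧ inner ℝ p (N p) = 0 ∧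
    (∀ w ∈ tangentConeAt ℝ S p, inner ℝ w (N p) = 0) ∧
    ∀ᶠ t in 𝓝[>] (0 : ℝ), Real.cos t • p + Real.sin t • N p ∈ A'

/-! ### The tubular neighbourhood -/

/-- The half disc `D²₊(r)`. -/
def halfDisc (r : ℝ) : Set E2 := {s | ‖s‖ < r ∧ 0 ≤ s 0}

/-- `Λ(p, s) = (1 - s₁)(cos(s₂) p + sin(s₂) N(p))`. -/
def tubeMap (N : E4 → E4) (x : E4 × E2) : E4 :=
  (1 - x.2 0) • (Real.cos (x.2 1) • x.1 + Real.sin (x.2 1) • N x.1)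

/-- `Ω_r = Λ(S × D²₊(r))`. -/
def tube (S : Set E4) (N : E4 → E4) (r : ℝ) : Set E4 := tubeMap N '' (S ×ˢ halfDisc r)

/-- The inverse of `Λ : S × D²₊(r) → Ω_r` (when `Λ` is injective there). -/
def tubeInv (S : Set E4) (N : E4 → E4) (r : ℝ) : E4 → E4 × E2 :=
  Function.invFunOn (tubeMap N) (S ×ˢ halfDisc r)

/-- `Λ : S × D²₊(r) → B̄⁴` is a diffeomorphism onto a (relatively open) neighbourhood of `S` in
the closed unit ball. -/
structure IsTubularDiffeo (S : Set E4) (N : E4 → E4) (r : ℝ) : Prop where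
  contDiffOn : ContDiffOn ℝ ∞ (tubeMap N) (S ×ˢ halfDisc r)
  injOn : InjOn (tubeMap N) (S ×ˢ halfDisc r)
  contDiffOn_inv : ContDiffOn ℝ ∞ (tubeInv S N r) (tube S N r)
  isOpen_image : ∃ O : Set E4, IsOpen O ∧ S ⊆ O ∧ tube S N r = O ∩ Metric.closedBall 0 1

/-- A cutoff `φ` on `[0, 3ε]`: smooth, zero on `[0, ε]`, strictly increasing on `[ε, 2ε]`, one on
`[2ε, 3ε]`. -/
structure IsCutoff (ε : ℝ) (φ : ℝ → ℝ) : Prop where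
  contDiffOn : ContDiffOn ℝ ∞ φ (Icc 0 (3 * ε))
  eq_zero : ∀ t ∈ Icc 0 ε, φ t = 0
  strictMonoOn : StrictMonoOn φ (Icc ε (2 * ε))
  eq_one : ∀ t ∈ Icc (2 * ε) (3 * ε), φ t = 1

open Classical in
/-- The map `T` collapsing `Ω_ε` onto `S`: it is the identity outside `Ω_{3ε}`, and
`T(Λ(p, s)) = Λ(p, φ(|s|) s)` on `Ω_{3ε}`. -/
def collapse (S : Set E4) (N : E4 → E4) (ε : ℝ) (φ : ℝ → ℝ) (v : E4) : E4 :=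
  if v ∈ tube S N (3 * ε) then
    let x := tubeInv S N (3 * ε) v
    tubeMap N (x.1, φ ‖x.2‖ • x.2)
  else v

/-! ### The extended Gauss map -/

/-- `Q̄_{p,k} = -(k/√(1+k²)) p - (1/√(1+k²)) N(p)` for `k ∈ [-∞, ∞]`, with the limiting values
`Q̄_{p,∞} = -p` and `Q̄_{p,-∞} = p`. -/
def gaussPt (N : E4 → E4) (p : E4) : EReal → E4
  | ⊤ => -p
  | ⊥ => p
  | (k : ℝ) => -(k / √(1 + k ^ 2)) • p - (1 / √(1 + k ^ 2)) • N p

/-- The parameter `k = s₂ / √(ε² - s₂²) ∈ [-∞, ∞]`, for `s₂ ∈ [-ε, ε]`. -/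
def gaussSlope (ε s₂ : ℝ) : EReal :=
  if ε ≤ s₂ then ⊤ else if s₂ ≤ -ε then ⊥ else ((s₂ / √(ε ^ 2 - s₂ ^ 2) : ℝ) : EReal)

open Classical in
/-- The extended Gauss map `Q̄`, defined on `S³ ∪ closure Ω_ε` (and given the irrelevant value
`0` elsewhere). -/
def extGauss (S A A' : Set E4) (N : E4 → E4) (ε : ℝ) (φ : ℝ → ℝ) (v : E4) : E4 :=
  if v ∈ closure (tube S N ε) then
    let x := tubeInv S N (3 * ε) v
    gaussPt N x.1 (gaussSlope ε (x.2 1))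
  else if v ∈ A' then -collapse S N ε φ v
  else if v ∈ A then collapse S N ε φ v
  else 0

/-! ### The degree of a continuous map `S³ → S³` -/

/-- The extension of `h : S³ → S³` to `ℝ⁴` that is homogeneous of degree one:
`y ↦ |y| h(y/|y|)`. -/
def radialExt (h : S3 → S3) (y : E4) : E4 :=
  if hy : y = 0 then 0
  else ‖y‖ • (h ⟨‖y‖⁻¹ • y, by
    simp [norm_smul, inv_mul_cancel₀ (norm_ne_zero_iff.2 hy)]⟩ : E4)

/-- The function `J` with `h^* dV = J dV`, where `dV_x(u₁, u₂, u₃) = det(u₁, u₂, u₃, x)` is the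
volume form of `S³`: if `e₁, e₂, e₃` is a positive orthonormal basis of `T_x S³` then
`J(x) = det(Dh e₁, Dh e₂, Dh e₃, h(x))`. The differential at `x` of the radial extension of `h`
sends `e₁, e₂, e₃, x` to `Dh e₁, Dh e₂, Dh e₃, h(x)`, so this is its determinant. -/
def sphereJacobian (h : S3 → S3) (x : S3) : ℝ :=
  (fderiv ℝ (radialExt h) (x : E4)).det

/-- A continuous map `f : S³ → S³` has degree `d` if some (equivalently, every) smooth map
`h : S³ → S³` homotopic to `f` satisfies `∫ h^* dV = d ∫ dV`. -/
def HasDegree (f : C(S3, S3)) (d : ℤ) : Prop :=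
  ∃ h : C(S3, S3), ContMDiff (𝓡 3) (𝓡 3) ∞ h ∧ f.Homotopic h ∧
    ∫ x, sphereJacobian h x ∂(volume : Measure E4).toSphere =
      d * (volume : Measure E4).toSphere.real univ

end

/-! On `S3` the extended Gauss map moves points along the great circles normal to the surface. In
the collar it sends the point at signed distance t from q ∈ S to the point at signed distance ψ(t)
on the same circle; beyond the collar it is id on the side A and -id on the side A'. Here ψ(t) =
φ(|t|)t - π/2 - arcsin(t/ε), which equals t at the inner end and t - π at the outer end
(`extGauss_eq_twist`). Only the behaviour at the ends matters up to homotopy: interpolating linearly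
between two such profiles connects the maps (`twistMap_homotopic`). So ψ may be replaced by a smooth
profile, and the degree becomes the integral of a Jacobian.

Extend the smooth map to ℝ⁴, homogeneous of degree one. Its Jacobian is the determinant of the
derivative, constant along rays, and its integral over the sphere is four times that over the unit
ball. Where the map is ±id the determinant is 1, the dimension being even. In the cone over the
collar, with parameters (p, t, ρ), the volume density is ρ³P(t), where P(t) = a cos² t + b cos t sin
t + c sin² t is the area density of the parallel surface, and the map turns it into ρ³ψ'(t)P(ψ(t)).
Since ψ shifts one end by -π and fixes the other, the t-integral of the difference is -(π/2)(a + c)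
(`integral_parallelDet`). By the Gauss equation, a + c is Gauss curvature times area. Hence the
integral of det - 1 over the ball is -(π/8)·2π(2 - 2g) = (π²/2)(g - 1); adding the volume π²/2 of
the ball and multiplying by 4 gives g·vol(S³).

The genus is read off a smooth triangulation, so Gauss–Bonnet is proved there. On one triangle it is
Green's theorem for the connection form of a moving frame, with corner angles coming from the change
of frame along the sides (`curl_connection`, `OrthoPair.hasDerivAt_angle`,
`TrianglePatch.gaussBonnet`). To sum over triangles one needs that the angles at a vertex add up to
2π (`sum_cornerAngle`) and that each oriented edge bounds exactly one positive triangle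
(`existsUnique_posTri`). Both express that the triangles at a point tile the tangent plane. This
rests on the smooth retraction `coneFoot` onto S: it turns a tangent vector into a curve in S, which
finitely many closed triangles must catch (`exists_direction`), while connectedness of short arcs
forbids two triangles to share an interior direction (`direction_unique`). -/

noncomputable section

/-! ### Determinants and tangent vectors in `ℝ⁴` -/

/-- The determinant of four vectors of `ℝ⁴`. -/
def det4 (a b c d : E4) : ℝ := Matrix.det (Matrix.of fun i j : Fin 4 => (![a, b, c, d] i) j)

lemma det4_eq (a b c d : E4) : det4 a b c d =
    (a 0 * b 1 - a 1 * b 0) * (c 2 * d 3 - c 3 * d 2)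
    - (a 0 * b 2 - a 2 * b 0) * (c 1 * d 3 - c 3 * d 1)
    + (a 0 * b 3 - a 3 * b 0) * (c 1 * d 2 - c 2 * d 1)
    + (a 1 * b 2 - a 2 * b 1) * (c 0 * d 3 - c 3 * d 0)
    - (a 1 * b 3 - a 3 * b 1) * (c 0 * d 2 - c 2 * d 0)
    + (a 2 * b 3 - a 3 * b 2) * (c 0 * d 1 - c 1 * d 0) := by
  simp [det4, Matrix.det_succ_row_zero, Fin.sum_univ_succ, Fin.succAbove]
  ring

/-- Multiply one matrix of rows by the transpose of the other: the entries are the mutual inner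
products. -/
lemma det4_mul_det4 (a b c d a' b' c' d' : E4) : det4 a b c d * det4 a' b' c' d' =
    Matrix.det (Matrix.of fun i j : Fin 4 => inner ℝ (![a, b, c, d] i) (![a', b', c', d'] j)) := by
  unfold det4
  rw [← Matrix.det_transpose (Matrix.of fun i j : Fin 4 => (![a', b', c', d'] i) j),
    ← Matrix.det_mul]
  congr 1
  ext i j
  simp [Matrix.mul_apply, PiLp.inner_apply, mul_comm]

lemma det4_add_left (a a' b c d : E4) : det4 (a + a') b c d = det4 a b c d + det4 a' b c d := by
  simp only [det4_eq, PiLp.add_apply]; ring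

lemma det4_smul_left (r : ℝ) (a b c d : E4) : det4 (r • a) b c d = r * det4 a b c d := by
  simp only [det4_eq, PiLp.smul_apply, smul_eq_mul]; ring

lemma det4_add_right (a b b' c d : E4) : det4 a (b + b') c d = det4 a b c d + det4 a b' c d := by
  simp only [det4_eq, PiLp.add_apply]; ring

lemma det4_smul_right (r : ℝ) (a b c d : E4) : det4 a (r • b) c d = r * det4 a b c d := by
  simp only [det4_eq, PiLp.smul_apply, smul_eq_mul]; ring

lemma det4_swap (a b c d : E4) : det4 b a c d = - det4 a b c d := by
  simp only [det4_eq]; ring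

lemma det4_self (a c d : E4) : det4 a a c d = 0 := by
  simp only [det4_eq]; ring

lemma det4_smul_third (r : ℝ) (a b c d : E4) : det4 a b (r • c) d = r * det4 a b c d := by
  simp only [det4_eq, PiLp.smul_apply, smul_eq_mul]; ring

/-- The last two vectors are turned by a plane rotation. This is how position and normal change
together when passing to a parallel surface. -/
lemma det4_rotate (a b n g : E4) (s c : ℝ) (h : c ^ 2 + s ^ 2 = 1) :
    det4 a b (c • n - s • g) (c • g + s • n) = det4 a b n g := by
  have : det4 a b (c • n - s • g) (c • g + s • n) = (c ^ 2 + s ^ 2) * det4 a b n g := by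
    simp only [det4_eq, PiLp.smul_apply, PiLp.add_apply, PiLp.sub_apply, smul_eq_mul]; ring
  rw [this, h, one_mul]

lemma ContinuousOn.det4 {X : Type*} [TopologicalSpace X] {a b c d : X → E4} {s : Set X}
    (ha : ContinuousOn a s) (hb : ContinuousOn b s) (hc : ContinuousOn c s)
    (hd : ContinuousOn d s) : ContinuousOn (fun x => det4 (a x) (b x) (c x) (d x)) s := by
  have co : ∀ {f : X → E4}, ContinuousOn f s → ∀ i, ContinuousOn (fun x => f x i) s :=
    fun hf i => (EuclideanSpace.proj (𝕜 := ℝ) i).continuous.comp_continuousOn hf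
  have P : ∀ i j k l, ContinuousOn (fun x =>
      (a x i * b x j - a x j * b x i) * (c x k * d x l - c x l * d x k)) s := fun i j k l =>
    (((co ha i).mul (co hb j)).sub ((co ha j).mul (co hb i))).mul
      (((co hc k).mul (co hd l)).sub ((co hc l).mul (co hd k)))
  simp only [det4_eq]
  exact (((((P 0 1 2 3).sub (P 0 2 1 3)).add (P 0 3 1 2)).add (P 1 2 0 3)).sub (P 1 3 0 2)).add
    (P 2 3 0 1)

/-- `n` and `x` are orthonormal, as the unit normal at a point of a surface in `S³`. -/
structure OrthoPair (n x : E4) : Prop where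
  norm_left : ‖n‖ = 1
  norm_right : ‖x‖ = 1
  inner_eq : inner ℝ n x = 0

/-- `w` is orthogonal to `n` and to `x`. -/
def Tang (n x w : E4) : Prop := inner ℝ w n = 0 ∧ inner ℝ w x = 0

lemma Tang.add {n x w w' : E4} (h : Tang n x w) (h' : Tang n x w') : Tang n x (w + w') := by
  simp [Tang, inner_add_left, h.1, h.2, h'.1, h'.2]

lemma Tang.smul {n x w : E4} (h : Tang n x w) (r : ℝ) : Tang n x (r • w) := by
  simp [Tang, inner_smul_left, h.1, h.2]

lemma Tang.sub {n x w w' : E4} (h : Tang n x w) (h' : Tang n x w') : Tang n x (w - w') := by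
  simp [Tang, inner_sub_left, h.1, h.2, h'.1, h'.2]

/-- The Gram matrix is block triangular, because `a'` and `b'` are orthogonal to the orthonormal
pair; only the tangential 2×2 block counts. Tangency of `a` and `b` is not needed, which matters
when they are derivatives of tangent fields. -/
lemma OrthoPair.gram {n x : E4} (h : OrthoPair n x) (a b a' b' : E4) (ha : Tang n x a')
    (hb : Tang n x b') : det4 a b n x * det4 a' b' n x =
      inner ℝ a a' * inner ℝ b b' - inner ℝ a b' * inner ℝ b a' := by
  rw [det4_mul_det4]
  have h1 : inner ℝ n n = (1 : ℝ) := by simp [h.norm_left]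
  have h2 : inner ℝ x x = (1 : ℝ) := by simp [h.norm_right]
  have h3 : inner ℝ x n = (0 : ℝ) := by rw [real_inner_comm]; exact h.inner_eq
  have e1 : inner ℝ n a' = (0 : ℝ) := by rw [real_inner_comm]; exact ha.1
  have e2 : inner ℝ x a' = (0 : ℝ) := by rw [real_inner_comm]; exact ha.2
  have e3 : inner ℝ n b' = (0 : ℝ) := by rw [real_inner_comm]; exact hb.1
  have e4 : inner ℝ x b' = (0 : ℝ) := by rw [real_inner_comm]; exact hb.2
  simp only [Matrix.det_succ_row_zero, Fin.sum_univ_succ]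
  simp [Fin.succAbove, h3, h.inner_eq, e1, e2, e3, e4, h.norm_left, h.norm_right]
  ring

lemma OrthoPair.inner_eq_of_tang {n x : E4} (h : OrthoPair n x) (a b w : E4) (ha : Tang n x a)
    (hb : Tang n x b) : ‖a‖ ^ 2 * inner ℝ w b =
      inner ℝ a w * inner ℝ a b + det4 a w n x * det4 a b n x := by
  rw [h.gram a w a b ha hb, real_inner_self_eq_norm_sq, real_inner_comm w a]
  ring

lemma OrthoPair.det4_sq {n x : E4} (h : OrthoPair n x) {a b : E4} (ha : Tang n x a)
    (hb : Tang n x b) : det4 a b n x ^ 2 = ‖a‖ ^ 2 * ‖b‖ ^ 2 - inner ℝ a b ^ 2 := by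
  rw [sq, h.gram a b a b ha hb, real_inner_self_eq_norm_sq, real_inner_self_eq_norm_sq,
    real_inner_comm b a]
  ring

lemma ne_zero_of_det4_pos {a b n x : E4} (h : 0 < det4 a b n x) : a ≠ 0 ∧ b ≠ 0 := by
  constructor
  · rintro rfl; simp [det4_eq] at h
  · rintro rfl; simp [det4_eq] at h

lemma OrthoPair.det4_ne_zero {n x a b : E4} (h : OrthoPair n x) (ha : Tang n x a)
    (hb : Tang n x b) (hi : ∀ r s : ℝ, r • a + s • b = 0 → r = 0 ∧ s = 0) :
    det4 a b n x ≠ 0 := by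
  intro h0
  have h1 := h.det4_sq ha hb
  rw [h0] at h1
  -- The equality case of Cauchy–Schwarz: this combination has squared norm ‖a‖² times the squared
  -- determinant.
  have h2 : ‖(inner ℝ a b : ℝ) • a + (-‖a‖ ^ 2) • b‖ ^ 2 = 0 := by
    rw [← real_inner_self_eq_norm_sq]
    simp only [inner_add_left, inner_add_right, inner_smul_left, inner_smul_right,
      real_inner_self_eq_norm_sq, real_inner_comm a b, conj_trivial]
    linear_combination -‖a‖ ^ 2 * h1
  have h3 := hi (inner ℝ a b) (-‖a‖ ^ 2) (by simpa using h2)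
  have h4 : a = 0 := by simpa using h3.2
  have := hi 1 0 (by simp [h4])
  exact one_ne_zero this.1

/-- The derivative of the angle between two tangent fields along a curve. -/
lemma OrthoPair.hasDerivAt_angle {n x : E4} (h : OrthoPair n x) {R E : ℝ → E4} {R' E' : E4} {t : ℝ}
    (hR : HasDerivAt R R' t) (hE : HasDerivAt E E' t) (hRt : Tang n x (R t)) (hEt : Tang n x (E t))
    (hpos : 0 < det4 (R t) (E t) n x) :
    HasDerivAt (fun s => InnerProductGeometry.angle (R s) (E s))
      (det4 (E t) E' n x / ‖E t‖ ^ 2 - det4 (R t) R' n x / ‖R t‖ ^ 2) t := by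
  obtain ⟨hR0, hE0⟩ := ne_zero_of_det4_pos hpos
  have nR : 0 < ‖R t‖ := norm_pos_iff.2 hR0
  have nE : 0 < ‖E t‖ := norm_pos_iff.2 hE0
  have dR : HasDerivAt (fun s => ‖R s‖) (inner ℝ (R t) R' / ‖R t‖) t := by
    have := (hR.norm_sq).sqrt (by positivity)
    simp only [Real.sqrt_sq (norm_nonneg _)] at this
    convert this using 1
    field_simp
  have dE : HasDerivAt (fun s => ‖E s‖) (inner ℝ (E t) E' / ‖E t‖) t := by
    have := (hE.norm_sq).sqrt (by positivity)
    simp only [Real.sqrt_sq (norm_nonneg _)] at this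
    convert this using 1
    field_simp
  set d := det4 (R t) (E t) n x with hd
  have hsq : d ^ 2 = ‖R t‖ ^ 2 * ‖E t‖ ^ 2 - inner ℝ (R t) (E t) ^ 2 := h.det4_sq hRt hEt
  have hc := ((hR.inner ℝ hE).div (dR.mul dE) (mul_pos nR nE).ne')
  -- The positive determinant keeps the cosine away from ±1, where arccos is not differentiable.
  have hlt : (inner ℝ (R t) (E t) / (‖R t‖ * ‖E t‖)) ^ 2 < 1 := by
    rw [div_pow, div_lt_one (by positivity)]
    nlinarith [sq_pos_of_pos hpos]
  have habs := (sq_lt_one_iff_abs_lt_one _).1 hlt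
  rw [abs_lt] at habs
  have hs := (Real.hasDerivAt_arccos (ne_of_gt habs.1) (ne_of_lt habs.2)).comp t hc
  -- The sine of the angle is the normalized determinant, with the right sign because the frame is
  -- positive.
  have hsqrt : √(1 - (inner ℝ (R t) (E t) / (‖R t‖ * ‖E t‖)) ^ 2) = d / (‖R t‖ * ‖E t‖) := by
    rw [Real.sqrt_eq_iff_mul_self_eq (by linarith) (by positivity)]
    field_simp
    linear_combination -hsq
  have i1 := h.inner_eq_of_tang (R t) (E t) R' hRt hEt
  have i2 := h.inner_eq_of_tang (E t) (R t) E' hEt hRt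
  rw [det4_swap (R t) (E t), ← hd, real_inner_comm (R t) (E t)] at i2
  rw [← hd] at i1
  refine HasDerivAt.congr_deriv
    (show HasDerivAt (fun s => InnerProductGeometry.angle (R s) (E s)) _ t from hs) ?_
  rw [hsqrt]
  change -(1 / (d / (‖R t‖ * ‖E t‖))) * (_ / (‖R t‖ * ‖E t‖) ^ 2) = _
  simp only [Pi.mul_apply]
  rw [real_inner_comm (R t) E'] at i2
  field_simp
  linear_combination -(‖E t‖ ^ 2) * i1 - (‖R t‖ ^ 2) * i2

lemma orthonormal_expand {e₁ e₂ n x : E4} (h : OrthoPair n x) (h1 : ‖e₁‖ = 1) (h2 : ‖e₂‖ = 1)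
    (h12 : inner ℝ e₁ e₂ = 0) (t1 : Tang n x e₁) (t2 : Tang n x e₂) (a b : E4) :
    inner ℝ a b = inner ℝ a e₁ * inner ℝ b e₁ + inner ℝ a e₂ * inner ℝ b e₂ +
      inner ℝ a n * inner ℝ b n + inner ℝ a x * inner ℝ b x := by
  have ho : Orthonormal ℝ ![e₁, e₂, n, x] := by
    have g1 := h.inner_eq
    have g2 : inner ℝ x n = (0:ℝ) := by rw [real_inner_comm]; exact g1
    have g3 : inner ℝ e₂ e₁ = (0:ℝ) := by rw [real_inner_comm]; exact h12
    have g4 : inner ℝ n e₁ = (0:ℝ) := by rw [real_inner_comm]; exact t1.1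
    have g5 : inner ℝ x e₁ = (0:ℝ) := by rw [real_inner_comm]; exact t1.2
    have g6 : inner ℝ n e₂ = (0:ℝ) := by rw [real_inner_comm]; exact t2.1
    have g7 : inner ℝ x e₂ = (0:ℝ) := by rw [real_inner_comm]; exact t2.2
    rw [orthonormal_iff_ite]
    intro i j
    fin_cases i <;> fin_cases j <;>
      simp [h1, h2, h12, t1.1, t1.2, t2.1, t2.2, h.norm_left, h.norm_right, g1, g2, g3, g4, g5,
        g6, g7]
  have hb := basisOfOrthonormalOfCardEqFinrank ho (by simp)
  let B : OrthonormalBasis (Fin 4) ℝ E4 :=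
    (basisOfOrthonormalOfCardEqFinrank ho (by simp)).toOrthonormalBasis (by simpa using ho)
  have hB : ∀ i, B i = ![e₁, e₂, n, x] i := by
    intro i; simp [B]
  rw [← B.sum_inner_mul_inner a b, Fin.sum_univ_four]
  simp only [hB]
  simp [real_inner_comm b]

/-! ### Moving frames and the curvature form -/

/-- Differentiating the connection form `⟨d e₁, e₂⟩` of a moving frame. -/
lemma curl_connection {G n e₁ e₂ : ℝ × ℝ → E4} {p : ℝ × ℝ}
    (hG : DifferentiableAt ℝ G p) (hn : DifferentiableAt ℝ n p) (h1 : ContDiffAt ℝ 2 e₁ p)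
    (h2 : DifferentiableAt ℝ e₂ p) (ho : ∀ᶠ q in 𝓝 p, OrthoPair (n q) (G q))
    (n1 : ∀ᶠ q in 𝓝 p, ‖e₁ q‖ = 1) (n2 : ∀ᶠ q in 𝓝 p, ‖e₂ q‖ = 1)
    (h12 : ∀ᶠ q in 𝓝 p, inner ℝ (e₁ q) (e₂ q) = 0)
    (t1 : ∀ᶠ q in 𝓝 p, Tang (n q) (G q) (e₁ q)) (t2 : ∀ᶠ q in 𝓝 p, Tang (n q) (G q) (e₂ q))
    (hd : det4 (e₁ p) (e₂ p) (n p) (G p) = 1) (hGt : ∀ w, inner ℝ (fderiv ℝ G p w) (n p) = 0)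
    (v w : ℝ × ℝ) :
    ∃ f' g' : ℝ × ℝ →L[ℝ] ℝ,
      HasFDerivAt (fun q => inner ℝ (fderiv ℝ e₁ q w) (e₂ q)) f' p ∧
      HasFDerivAt (fun q => - inner ℝ (fderiv ℝ e₁ q v) (e₂ q)) g' p ∧
      f' v + g' w = -(det4 (fderiv ℝ G p v) (fderiv ℝ G p w) (n p) (G p) +
        det4 (fderiv ℝ n p v) (fderiv ℝ n p w) (n p) (G p)) := by
  have hdd : DifferentiableAt ℝ (fderiv ℝ e₁) p :=
    (h1.fderiv_right (m := 1) (by norm_num)).differentiableAt (by norm_num)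
  have h1d : DifferentiableAt ℝ e₁ p := h1.differentiableAt (by norm_num)
  have hsymm : IsSymmSndFDerivAt ℝ e₁ p := h1.isSymmSndFDerivAt (by simp)
  have hw : ∀ w, HasFDerivAt (fun q => fderiv ℝ e₁ q w)
      ((ContinuousLinearMap.apply ℝ E4 w).comp (fderiv ℝ (fderiv ℝ e₁) p)) p := fun w =>
    (ContinuousLinearMap.apply ℝ E4 w).hasFDerivAt.comp p hdd.hasFDerivAt
  refine ⟨_, _, (hw w).inner ℝ h2.hasFDerivAt, ((hw v).inner ℝ h2.hasFDerivAt).neg, ?_⟩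
  -- derivatives of the orthogonality relations
  have key : ∀ {a b : ℝ × ℝ → E4} {c : ℝ}, DifferentiableAt ℝ a p → DifferentiableAt ℝ b p →
      (∀ᶠ q in 𝓝 p, inner ℝ (a q) (b q) = c) → ∀ w,
      inner ℝ (fderiv ℝ a p w) (b p) + inner ℝ (fderiv ℝ b p w) (a p) = 0 := by
    intro a b c ha hb hab w
    have e1 := (ha.hasFDerivAt.inner ℝ hb.hasFDerivAt)
    have e2 : HasFDerivAt (fun q => inner ℝ (a q) (b q)) (0 : ℝ × ℝ →L[ℝ] ℝ) p :=
      (hasFDerivAt_const c p).congr_of_eventuallyEq hab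
    have e3 := congrArg (fun L => L w) (e1.unique e2)
    simp only [ContinuousLinearMap.comp_apply, ContinuousLinearMap.prod_apply,
      fderivInnerCLM_apply, zero_apply] at e3
    rw [real_inner_comm] at e3
    linarith
  have sq1 : ∀ {a : ℝ × ℝ → E4}, (∀ᶠ q in 𝓝 p, ‖a q‖ = 1) →
      ∀ᶠ q in 𝓝 p, inner ℝ (a q) (a q) = (1:ℝ) := fun h => h.mono fun q hq => by simp [hq]
  have d11 := key h1d h1d (sq1 n1)
  have d22 := key h2 h2 (sq1 n2)
  have d1n := key h1d hn (t1.mono fun q h => h.1)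
  have d1G := key h1d hG (t1.mono fun q h => h.2)
  have d2n := key h2 hn (t2.mono fun q h => h.1)
  have d2G := key h2 hG (t2.mono fun q h => h.2)
  have dnn := key hn hn (sq1 (ho.mono fun q h => h.norm_left))
  have dnG := key hn hG (ho.mono fun q h => h.inner_eq)
  have dGG := key hG hG (sq1 (ho.mono fun q h => h.norm_right))
  have tG : ∀ w, Tang (n p) (G p) (fderiv ℝ G p w) := fun w => ⟨hGt w, by have := dGG w; linarith⟩
  have tn : ∀ w, Tang (n p) (G p) (fderiv ℝ n p w) := fun w =>
    ⟨by have := dnn w; linarith, by have := dnG w; have := hGt w; linarith⟩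
  have ho := ho.self_of_nhds
  have n1 := n1.self_of_nhds
  have n2 := n2.self_of_nhds
  have h12 := h12.self_of_nhds
  have t1 := t1.self_of_nhds
  have t2 := t2.self_of_nhds
  have gr : ∀ a b : E4, det4 a b (n p) (G p) =
      inner ℝ a (e₁ p) * inner ℝ b (e₂ p) - inner ℝ a (e₂ p) * inner ℝ b (e₁ p) := fun a b => by
    rw [← ho.gram a b _ _ t1 t2, hd, mul_one]
  have ex := orthonormal_expand ho n1 n2 h12 t1 t2 (fderiv ℝ e₁ p w) (fderiv ℝ e₂ p v)
  have ex' := orthonormal_expand ho n1 n2 h12 t1 t2 (fderiv ℝ e₁ p v) (fderiv ℝ e₂ p w)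
  simp only [ContinuousLinearMap.comp_apply, ContinuousLinearMap.prod_apply,
      fderivInnerCLM_apply, neg_apply, ContinuousLinearMap.apply_apply]
  -- The second derivatives of `e₁` cancel by symmetry, leaving ⟨d_w e₁, d_v e₂⟩ - ⟨d_v e₁, d_w e₂⟩.
  -- The components along `e₁` and `e₂` vanish by unit length; the `n` components give the
  -- determinant of `dn` and the `G` components that of `dG`.
  rw [gr, gr, hsymm v w, ex, ex']
  have a1 := d11 v; have a2 := d11 w; have a3 := d22 v; have a4 := d22 w
  have b1 : inner ℝ (fderiv ℝ e₁ p v) (e₁ p) = (0:ℝ) := by linarith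
  have b2 : inner ℝ (fderiv ℝ e₁ p w) (e₁ p) = (0:ℝ) := by linarith
  have b3 : inner ℝ (fderiv ℝ e₂ p v) (e₂ p) = (0:ℝ) := by linarith
  have b4 : inner ℝ (fderiv ℝ e₂ p w) (e₂ p) = (0:ℝ) := by linarith
  have c := fun w => eq_neg_of_add_eq_zero_left (d1n w)
  have c' := fun w => eq_neg_of_add_eq_zero_left (d1G w)
  have c2 := fun w => eq_neg_of_add_eq_zero_left (d2n w)
  have c2' := fun w => eq_neg_of_add_eq_zero_left (d2G w)
  rw [b1, b2, b3, b4, c, c, c', c', c2, c2, c2', c2']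
  ring

/-- The unit square. -/
abbrev unitSq : Set (ℝ × ℝ) := Icc 0 1 ×ˢ Icc 0 1

lemma interior_unitSq : interior unitSq = Ioo (0:ℝ) 1 ×ˢ Ioo (0:ℝ) 1 := by
  rw [interior_prod_eq, interior_Icc]

lemma uniqueDiffOn_unitSq : UniqueDiffOn ℝ unitSq :=
  (uniqueDiffOn_Icc zero_lt_one).prod (uniqueDiffOn_Icc zero_lt_one)

lemma openSq_ae_eq : (Ioo (0:ℝ) 1 ×ˢ Ioo (0:ℝ) 1 : Set (ℝ × ℝ)) =ᵐ[volume] unitSq :=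
  Measure.set_prod_ae_eq Ioo_ae_eq_Icc Ioo_ae_eq_Icc

lemma integral_congr_Ioo {f g : ℝ → ℝ} (hfg : ∀ x ∈ Ioo (0:ℝ) 1, f x = g x) :
    ∫ x in (0:ℝ)..1, f x = ∫ x in (0:ℝ)..1, g x := by
  rw [intervalIntegral.integral_of_le zero_le_one, intervalIntegral.integral_of_le zero_le_one,
    integral_Ioc_eq_integral_Ioo, integral_Ioc_eq_integral_Ioo]
  exact setIntegral_congr_fun measurableSet_Ioo hfg

/-- A square patch of a surface in `S³`, parametrized by `G`, with unit normal `n`, and with a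
positive frame `R`, `E` of tangent fields; `E` may differ from `∂G/∂y` by a factor which
vanishes on the side `x = 0`. -/
structure SquarePatch (G n R E : ℝ × ℝ → E4) : Prop where
  contG : ContDiffOn ℝ ∞ G unitSq
  contn : ContDiffOn ℝ ∞ n unitSq
  contR : ContDiffOn ℝ ∞ R unitSq
  contE : ContDiffOn ℝ ∞ E unitSq
  ortho : ∀ p ∈ unitSq, OrthoPair (n p) (G p)
  tangR : ∀ p ∈ unitSq, Tang (n p) (G p) (R p)
  tangE : ∀ p ∈ unitSq, Tang (n p) (G p) (E p)
  pos : ∀ p ∈ unitSq, 0 < det4 (R p) (E p) (n p) (G p)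
  derivG : ∀ p ∈ unitSq, HasFDerivWithinAt G ((ContinuousLinearMap.fst ℝ ℝ ℝ).smulRight (R p) +
    (ContinuousLinearMap.snd ℝ ℝ ℝ).smulRight (p.1 • E p)) unitSq p

/-- The connection form of the frame whose first vector is `R / |R|`. -/
def SquarePatch.conn (G n R : ℝ × ℝ → E4) (p w : ℝ × ℝ) : ℝ :=
  det4 (R p) (fderivWithin ℝ R unitSq p w) (n p) (G p) / ‖R p‖ ^ 2

/-- The curvature form. -/
def curvForm (G n : ℝ × ℝ → E4) (p : ℝ × ℝ) : ℝ :=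
  det4 (fderiv ℝ G p (1, 0)) (fderiv ℝ G p (0, 1)) (n p) (G p) +
    det4 (fderiv ℝ n p (1, 0)) (fderiv ℝ n p (0, 1)) (n p) (G p)

lemma ContDiffOn.continuousOn_fderivWithin_apply' {G : ℝ × ℝ → E4}
    (h : ContDiffOn ℝ ∞ G unitSq) (w : ℝ × ℝ) :
    ContinuousOn (fun p => fderivWithin ℝ G unitSq p w) unitSq :=
  (h.continuousOn_fderivWithin uniqueDiffOn_unitSq (by simp)).clm_apply continuousOn_const

lemma fderivWithin_unitSq {F : Type*} [NormedAddCommGroup F] [NormedSpace ℝ F] {G : ℝ × ℝ → F}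
    {p : ℝ × ℝ} (hp : p ∈ Ioo (0:ℝ) 1 ×ˢ Ioo (0:ℝ) 1) :
    fderivWithin ℝ G unitSq p = fderiv ℝ G p := by
  rw [← interior_unitSq] at hp
  exact fderivWithin_of_mem_nhds (mem_interior_iff_mem_nhds.1 hp)

lemma continuousOn_curvForm_within {G n : ℝ × ℝ → E4} (hG : ContDiffOn ℝ ∞ G unitSq)
    (hn : ContDiffOn ℝ ∞ n unitSq) : ContinuousOn (fun p =>
      det4 (fderivWithin ℝ G unitSq p (1, 0)) (fderivWithin ℝ G unitSq p (0, 1)) (n p) (G p) +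
      det4 (fderivWithin ℝ n unitSq p (1, 0)) (fderivWithin ℝ n unitSq p (0, 1)) (n p) (G p))
      unitSq :=
  ((hG.continuousOn_fderivWithin_apply' _).det4 (hG.continuousOn_fderivWithin_apply' _)
    hn.continuousOn hG.continuousOn).add ((hn.continuousOn_fderivWithin_apply' _).det4
      (hn.continuousOn_fderivWithin_apply' _) hn.continuousOn hG.continuousOn)

lemma integrableOn_curvForm {G n : ℝ × ℝ → E4} (hG : ContDiffOn ℝ ∞ G unitSq)
    (hn : ContDiffOn ℝ ∞ n unitSq) : IntegrableOn (curvForm G n) unitSq := by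
  have h1 := (continuousOn_curvForm_within hG hn).integrableOn_compact (μ := volume)
    (isCompact_Icc.prod isCompact_Icc)
  rw [← integrableOn_congr_set_ae openSq_ae_eq] at h1 ⊢
  refine h1.congr_fun (fun p hp => ?_) (measurableSet_Ioo.prod measurableSet_Ioo)
  simp only [curvForm, fderivWithin_unitSq hp]

/-- Green's theorem for the connection form of the Gram–Schmidt frame built from `R` and `E`, whose
exterior derivative is minus the curvature form by `curl_connection`. Since `R` and `E` stay
independent on the whole closed square, the form is continuous up to the boundary even if `G`
collapses the side x = 0. -/
theorem SquarePatch.integral_curvForm {G n R E : ℝ × ℝ → E4} (h : SquarePatch G n R E) :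
    ∫ x in (0:ℝ)..1, ∫ y in (0:ℝ)..1, curvForm G n (x, y) =
      -((((∫ x in (0:ℝ)..1, -SquarePatch.conn G n R (x, 1) (1, 0)) -
          ∫ x in (0:ℝ)..1, -SquarePatch.conn G n R (x, 0) (1, 0)) +
        ∫ y in (0:ℝ)..1, SquarePatch.conn G n R (1, y) (0, 1)) -
        ∫ y in (0:ℝ)..1, SquarePatch.conn G n R (0, y) (0, 1)) := by
  set om := SquarePatch.conn G n R with hom
  have hR0 : ∀ p ∈ unitSq, R p ≠ 0 := fun p hp => (ne_zero_of_det4_pos (h.pos p hp)).1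
  have hc : ∀ w, ContinuousOn (fun p => om p w) unitSq := fun w =>
    (h.contR.continuousOn.det4 (h.contR.continuousOn_fderivWithin_apply' w) h.contn.continuousOn
      h.contG.continuousOn).div (h.contR.continuousOn.norm.pow 2)
      (fun p hp => pow_ne_zero 2 (norm_ne_zero_iff.2 (hR0 p hp)))
  -- the moving frame
  let e₁ : ℝ × ℝ → E4 := fun p => ‖R p‖⁻¹ • R p
  let b : ℝ × ℝ → E4 := fun p => ‖R p‖ ^ 2 • E p - (inner ℝ (R p) (E p) : ℝ) • R p
  let e₂ : ℝ × ℝ → E4 := fun p => (‖R p‖ * det4 (R p) (E p) (n p) (G p))⁻¹ • b p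
  have he1 : ∀ p ∈ unitSq, ‖e₁ p‖ = 1 := fun p hp => by
    have := norm_ne_zero_iff.2 (hR0 p hp)
    simp [e₁, norm_smul, this]
  -- The length of `b`, which is the normalizing factor chosen in `e₂`.
  have hbn : ∀ p ∈ unitSq, ‖b p‖ ^ 2 = (‖R p‖ * det4 (R p) (E p) (n p) (G p)) ^ 2 := fun p hp => by
    have := (h.ortho p hp).det4_sq (h.tangR p hp) (h.tangE p hp)
    rw [mul_pow, this, ← real_inner_self_eq_norm_sq (b p)]
    simp only [b, inner_sub_left, inner_sub_right, inner_smul_left, inner_smul_right,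
      real_inner_self_eq_norm_sq, real_inner_comm (R p) (E p), conj_trivial]
    ring
  have hpos : ∀ p ∈ unitSq, 0 < ‖R p‖ * det4 (R p) (E p) (n p) (G p) := fun p hp =>
    mul_pos (norm_pos_iff.2 (hR0 p hp)) (h.pos p hp)
  have he2 : ∀ p ∈ unitSq, ‖e₂ p‖ = 1 := fun p hp => by
    have h1 : ‖b p‖ = ‖R p‖ * det4 (R p) (E p) (n p) (G p) :=
      (sq_eq_sq₀ (norm_nonneg _) (hpos p hp).le).1 (hbn p hp)
    have h2 := hpos p hp
    simp only [e₂]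
    rw [norm_smul, h1, norm_inv, Real.norm_of_nonneg h2.le, inv_mul_cancel₀ h2.ne']
  have he12 : ∀ p ∈ unitSq, inner ℝ (e₁ p) (e₂ p) = 0 := fun p hp => by
    simp only [e₁, e₂, b, inner_sub_right, inner_smul_left, inner_smul_right,
      real_inner_self_eq_norm_sq, conj_trivial]
    ring
  have ht1 : ∀ p ∈ unitSq, Tang (n p) (G p) (e₁ p) := fun p hp => (h.tangR p hp).smul _
  have ht2 : ∀ p ∈ unitSq, Tang (n p) (G p) (e₂ p) := fun p hp =>
    (((h.tangE p hp).smul _).sub ((h.tangR p hp).smul _)).smul _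
  have hdet : ∀ p ∈ unitSq, det4 (e₁ p) (e₂ p) (n p) (G p) = 1 := fun p hp => by
    have h1 := (h.pos p hp).ne'
    have h2 := norm_ne_zero_iff.2 (hR0 p hp)
    simp only [e₁, e₂, b, sub_eq_add_neg, ← neg_smul]
    rw [det4_smul_left, det4_smul_right, det4_add_right, det4_smul_right, det4_smul_right,
      det4_self]
    field_simp
    ring
  have hU : ∀ p ∈ Ioo (0:ℝ) 1 ×ˢ Ioo (0:ℝ) 1, unitSq ∈ 𝓝 p := fun p hp => by
    rw [← interior_unitSq] at hp; exact mem_interior_iff_mem_nhds.1 hp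
  have cd : ∀ {f : ℝ × ℝ → E4}, ContDiffOn ℝ ∞ f unitSq → ∀ p ∈ Ioo (0:ℝ) 1 ×ˢ Ioo (0:ℝ) 1,
      ContDiffAt ℝ ∞ f p := fun hf p hp => hf.contDiffAt (hU p hp)
  have hsub : Ioo (0:ℝ) 1 ×ˢ Ioo (0:ℝ) 1 ⊆ unitSq := prod_mono Ioo_subset_Icc_self Ioo_subset_Icc_self
  have cdn : ∀ p ∈ Ioo (0:ℝ) 1 ×ˢ Ioo (0:ℝ) 1, ContDiffAt ℝ ∞ (fun q => ‖R q‖) p := fun p hp =>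
    (cd h.contR p hp).norm ℝ (hR0 p (hsub hp))
  have cd1 : ∀ p ∈ Ioo (0:ℝ) 1 ×ˢ Ioo (0:ℝ) 1, ContDiffAt ℝ ∞ e₁ p := fun p hp =>
    ((cdn p hp).inv (norm_ne_zero_iff.2 (hR0 p (hsub hp)))).smul (cd h.contR p hp)
  have cdet : ∀ p ∈ Ioo (0:ℝ) 1 ×ˢ Ioo (0:ℝ) 1,
      ContDiffAt ℝ ∞ (fun p => det4 (R p) (E p) (n p) (G p)) p := fun p hp => by
    have co : ∀ {f : ℝ × ℝ → E4}, ContDiffOn ℝ ∞ f unitSq → ∀ i, ContDiffAt ℝ ∞ (fun q => f q i) p :=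
      fun hf i => (EuclideanSpace.proj (𝕜 := ℝ) i).contDiff.contDiffAt.comp p (cd hf p hp)
    have P : ∀ i j k l, ContDiffAt ℝ ∞ (fun x =>
      (R x i * E x j - R x j * E x i) * (n x k * G x l - n x l * G x k)) p := fun i j k l =>
      (((co h.contR i).mul (co h.contE j)).sub ((co h.contR j).mul (co h.contE i))).mul
      (((co h.contn k).mul (co h.contG l)).sub ((co h.contn l).mul (co h.contG k)))
    simp only [det4_eq]
    exact (((((P 0 1 2 3).sub (P 0 2 1 3)).add (P 0 3 1 2)).add (P 1 2 0 3)).sub (P 1 3 0 2)).add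
      (P 2 3 0 1)
  have cd2 : ∀ p ∈ Ioo (0:ℝ) 1 ×ˢ Ioo (0:ℝ) 1, ContDiffAt ℝ ∞ e₂ p := fun p hp =>
    (((cdn p hp).mul (cdet p hp)).inv (hpos p (hsub hp)).ne').smul
      ((((cdn p hp).pow 2).smul (cd h.contE p hp)).sub
        (((cd h.contR p hp).inner ℝ (cd h.contE p hp)).smul (cd h.contR p hp)))
  -- Normalizing `R` adds to its derivative a multiple of `R`, which the determinant ignores; so the
  -- connection form of the unit frame is expressed by `R` alone.
  have home : ∀ p ∈ Ioo (0:ℝ) 1 ×ˢ Ioo (0:ℝ) 1, ∀ w,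
      om p w = inner ℝ (fderiv ℝ e₁ p w) (e₂ p) := fun p hp w => by
    have hp' := hsub hp
    have hx := (h.ortho p hp').inner_eq_of_tang (e₁ p) (e₂ p) (fderiv ℝ e₁ p w) (ht1 p hp')
      (ht2 p hp')
    rw [he1 p hp', he12 p hp', hdet p hp'] at hx
    have hd : fderiv ℝ e₁ p w = ‖R p‖⁻¹ • fderiv ℝ R p w +
        (fderiv ℝ (fun q => ‖R q‖⁻¹) p w) • R p := by
      have := (((cdn p hp).inv (norm_ne_zero_iff.2 (hR0 p hp'))).differentiableAt
        (by simp)).hasFDerivAt.smul ((cd h.contR p hp).differentiableAt (by simp)).hasFDerivAt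
      have h3 : fderiv ℝ e₁ p = _ := this.fderiv
      rw [h3]
      rfl
    have h2 := norm_ne_zero_iff.2 (hR0 p hp')
    have hx' : inner ℝ (fderiv ℝ e₁ p w) (e₂ p) = det4 (e₁ p) (fderiv ℝ e₁ p w) (n p) (G p) := by
      linarith
    rw [hx', hd]
    simp only [e₁, hom, SquarePatch.conn, fderivWithin_unitSq hp]
    rw [det4_smul_left, det4_add_right, det4_smul_right, det4_smul_right, det4_self]
    field_simp
    ring
  have hcurl : ∀ p ∈ Ioo (0:ℝ) 1 ×ˢ Ioo (0:ℝ) 1, ∃ f' g' : ℝ × ℝ →L[ℝ] ℝ,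
      HasFDerivAt (fun q => om q (0, 1)) f' p ∧ HasFDerivAt (fun q => - om q (1, 0)) g' p ∧
      f' (1, 0) + g' (0, 1) = - curvForm G n p := fun p hp => by
    have ev : ∀ {P : ℝ × ℝ → Prop}, (∀ q ∈ unitSq, P q) → ∀ᶠ q in 𝓝 p, P q := fun hP =>
      Filter.mem_of_superset (hU p hp) hP
    have hp' := hsub hp
    obtain ⟨f', g', hf, hg, hfg⟩ := curl_connection ((cd h.contG p hp).differentiableAt (by simp))
      ((cd h.contn p hp).differentiableAt (by simp)) ((cd1 p hp).of_le (by norm_cast))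
      ((cd2 p hp).differentiableAt (by simp)) (ev h.ortho) (ev he1) (ev he2) (ev he12) (ev ht1)
      (ev ht2) (hdet p hp') (fun w => by
        have := (h.derivG p hp').hasFDerivAt (hU p hp)
        rw [this.fderiv]
        exact (((h.tangR p hp').smul w.1).add (((h.tangE p hp').smul p.1).smul w.2)).1)
        (1, 0) (0, 1)
    have hnear : ∀ᶠ q in 𝓝 p, q ∈ Ioo (0:ℝ) 1 ×ˢ Ioo (0:ℝ) 1 :=
      (isOpen_Ioo.prod isOpen_Ioo).mem_nhds hp
    exact ⟨f', g', hf.congr_of_eventuallyEq (hnear.mono fun q hq => home q hq _),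
      hg.congr_of_eventuallyEq (hnear.mono fun q hq => by simp only [home q hq]), hfg⟩
  -- The field with components ω(∂y), -ω(∂x) has the exterior derivative of ω as divergence.
  have hdiv := integral2_divergence_prod_of_hasFDerivAt_off_countable (fun q => om q (0, 1))
    (fun q => - om q (1, 0)) (fderiv ℝ fun q => om q (0, 1)) (fderiv ℝ fun q => - om q (1, 0))
    0 0 1 1 ∅ countable_empty
    (by simpa [uIcc_of_le] using hc (0, 1)) (by rw [uIcc_of_le zero_le_one]; exact (hc (1, 0)).neg)
    (fun p hp => by
      obtain ⟨f', g', hf, hg, -⟩ := hcurl p (by simpa using hp)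
      exact hf.differentiableAt.hasFDerivAt)
    (fun p hp => by
      obtain ⟨f', g', hf, hg, -⟩ := hcurl p (by simpa using hp)
      exact hg.differentiableAt.hasFDerivAt)
    (by
      have h1 := (integrableOn_curvForm h.contG h.contn).neg
      rw [uIcc_of_le zero_le_one]
      rw [← integrableOn_congr_set_ae openSq_ae_eq] at h1 ⊢
      refine h1.congr_fun (fun p hp => ?_) (measurableSet_Ioo.prod measurableSet_Ioo)
      obtain ⟨f', g', hf, hg, hfg⟩ := hcurl p hp
      rw [hf.fderiv, hg.fderiv, hfg]; rfl)
  rw [← hdiv, ← intervalIntegral.integral_neg]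
  refine integral_congr_Ioo fun x hx => ?_
  rw [← intervalIntegral.integral_neg]
  refine integral_congr_Ioo fun y hy => ?_
  obtain ⟨f', g', hf, hg, hfg⟩ := hcurl (x, y) ⟨hx, hy⟩
  rw [hf.fderiv, hg.fderiv, hfg, neg_neg]

/-! ### Geodesic curvature and Gauss–Bonnet on a triangle -/

/-- The total geodesic curvature of a curve `γ` on a surface in `S³` with unit normal `n`. -/
def totalGeodCurv (γ n : ℝ → E4) : ℝ :=
  ∫ s in (0:ℝ)..1, det4 (deriv γ s) (deriv (deriv γ) s) (n s) (γ s) / ‖deriv γ s‖ ^ 2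

/-- Reversal negates the velocity and keeps the acceleration, so the integrand, linear in each in
its numerator, changes sign. -/
lemma totalGeodCurv_reverse (γ n : ℝ → E4) :
    totalGeodCurv (fun s => γ (1 - s)) (fun s => n (1 - s)) = - totalGeodCurv γ n := by
  unfold totalGeodCurv
  have h1 : deriv (fun s => γ (1 - s)) = fun s => - deriv γ (1 - s) := by
    ext1 s; rw [deriv_comp_const_sub]
  have h2 : deriv (deriv (fun s => γ (1 - s))) = fun s => deriv (deriv γ) (1 - s) := by
    ext1 s
    rw [h1, deriv.fun_neg, deriv_comp_const_sub, neg_neg]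
  rw [h2, h1]
  have := intervalIntegral.integral_comp_sub_left (a := 0) (b := 1)
    (fun s => det4 (deriv γ s) (deriv (deriv γ) s) (n s) (γ s) / ‖deriv γ s‖ ^ 2) 1
  rw [sub_self, sub_zero] at this
  rw [← this, ← intervalIntegral.integral_neg]
  congr 1
  ext s
  simp only [norm_neg]
  rw [← neg_one_smul ℝ (deriv γ (1 - s)), det4_smul_left]
  ring

/-- The standard closed triangle. -/
def stdTri : Set (ℝ × ℝ) := {u | 0 ≤ u.1 ∧ 0 ≤ u.2 ∧ u.1 + u.2 ≤ 1}

/-- The standard open triangle. -/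
def openTri : Set (ℝ × ℝ) := {u | 0 < u.1 ∧ 0 < u.2 ∧ u.1 + u.2 < 1}

lemma openTri_subset : openTri ⊆ stdTri := fun _ h => ⟨h.1.le, h.2.1.le, h.2.2.le⟩

lemma isOpen_openTri : IsOpen openTri :=
  (isOpen_lt continuous_const continuous_fst).inter
    ((isOpen_lt continuous_const continuous_snd).inter
      (isOpen_lt (continuous_fst.add continuous_snd) continuous_const))

lemma convex_stdTri : Convex ℝ stdTri := by
  intro u hu v hv a b ha hb hab
  simp only [stdTri, mem_ofPred_eq, Prod.fst_add, Prod.snd_add, Prod.smul_fst, Prod.smul_snd,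
    smul_eq_mul] at *
  obtain ⟨h1, h2, h3⟩ := hu
  obtain ⟨k1, k2, k3⟩ := hv
  refine ⟨by positivity, by positivity, ?_⟩
  have := mul_le_mul_of_nonneg_left h3 ha
  have := mul_le_mul_of_nonneg_left k3 hb
  linarith

lemma isClosed_stdTri : IsClosed stdTri :=
  (isClosed_le continuous_const continuous_fst).inter
    ((isClosed_le continuous_const continuous_snd).inter
      (isClosed_le (continuous_fst.add continuous_snd) continuous_const))

lemma isCompact_stdTri : IsCompact stdTri := by
  refine IsCompact.of_isClosed_subset (isCompact_Icc.prod isCompact_Icc :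
    IsCompact (Icc (0:ℝ) 1 ×ˢ Icc (0:ℝ) 1)) isClosed_stdTri ?_
  rintro u ⟨h1, h2, h3⟩
  exact ⟨⟨h1, by linarith⟩, ⟨h2, by linarith⟩⟩

lemma uniqueDiffOn_stdTri : UniqueDiffOn ℝ stdTri := by
  refine uniqueDiffOn_convex convex_stdTri
    ⟨(1 / 4, 1 / 4), interior_maximal openTri_subset isOpen_openTri ?_⟩
  norm_num [openTri]

/-- The map collapsing the side `x = 0` of the unit square to a vertex of the triangle. -/
def duffy (p : ℝ × ℝ) : ℝ × ℝ := (p.1 * (1 - p.2), p.1 * p.2)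

lemma contDiff_duffy : ContDiff ℝ ∞ duffy := by unfold duffy; fun_prop

lemma hasFDerivAt_duffy (p : ℝ × ℝ) : HasFDerivAt duffy
    ((ContinuousLinearMap.fst ℝ ℝ ℝ).smulRight (1 - p.2, p.2) +
      (ContinuousLinearMap.snd ℝ ℝ ℝ).smulRight (p.1 • ((-1, 1) : ℝ × ℝ))) p := by
  have h1 : HasFDerivAt (fun p : ℝ × ℝ => p.1) (ContinuousLinearMap.fst ℝ ℝ ℝ) p := hasFDerivAt_fst
  have h2 : HasFDerivAt (fun p : ℝ × ℝ => p.2) (ContinuousLinearMap.snd ℝ ℝ ℝ) p := hasFDerivAt_snd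
  refine ((h1.mul (h2.const_sub 1)).prodMk (h1.mul h2)).congr_fderiv ?_
  ext <;> simp

lemma mapsTo_duffy : MapsTo duffy unitSq stdTri := by
  rintro ⟨x, y⟩ ⟨⟨h1, h2⟩, ⟨h3, h4⟩⟩
  simp only at h1 h2 h3 h4
  refine ⟨mul_nonneg h1 (by simpa using h4), mul_nonneg h1 h3, ?_⟩
  simp only [duffy]
  nlinarith

/-- A triangular patch of a surface in `S³`, positively oriented by its unit normal. -/
structure TrianglePatch (F n : ℝ × ℝ → E4) : Prop where
  contF : ContDiffOn ℝ ∞ F stdTri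
  contn : ContDiffOn ℝ ∞ n stdTri
  ortho : ∀ u ∈ stdTri, OrthoPair (n u) (F u)
  tang : ∀ u ∈ stdTri, ∀ w, Tang (n u) (F u) (fderivWithin ℝ F stdTri u w)
  pos : ∀ u ∈ stdTri, 0 < det4 (fderivWithin ℝ F stdTri u (1, 0)) (fderivWithin ℝ F stdTri u (0, 1))
    (n u) (F u)

namespace TrianglePatch

variable {F n : ℝ × ℝ → E4} (h : TrianglePatch F n)

include h

/-- The y-derivative of `F ∘ duffy` is x times `dF(-1, 1)`. Taking `E` without this factor keeps the
frame independent on the collapsed side; the matrix with columns (1 - y, y) and (-1, 1) has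
determinant 1, so positivity is inherited from `F`. -/
lemma squarePatch : SquarePatch (F ∘ duffy) (n ∘ duffy)
    (fun p => fderivWithin ℝ F stdTri (duffy p) (1 - p.2, p.2))
    (fun p => fderivWithin ℝ F stdTri (duffy p) (-1, 1)) where
  contG := h.contF.comp contDiff_duffy.contDiffOn mapsTo_duffy
  contn := h.contn.comp contDiff_duffy.contDiffOn mapsTo_duffy
  contR := ((h.contF.fderivWithin uniqueDiffOn_stdTri (m := ∞) (by simp)).comp
    contDiff_duffy.contDiffOn mapsTo_duffy).clm_apply (ContDiff.contDiffOn (by fun_prop))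
  contE := ((h.contF.fderivWithin uniqueDiffOn_stdTri (m := ∞) (by simp)).comp
    contDiff_duffy.contDiffOn mapsTo_duffy).clm_apply contDiffOn_const
  ortho p hp := h.ortho _ (mapsTo_duffy hp)
  tangR p hp := h.tang _ (mapsTo_duffy hp) _
  tangE p hp := h.tang _ (mapsTo_duffy hp) _
  pos p hp := by
    have h1 : ((1 - p.2, p.2) : ℝ × ℝ) = (1 - p.2) • (1, 0) + p.2 • (0, 1) := by simp
    have h2 : ((-1, 1) : ℝ × ℝ) = (-1 : ℝ) • (1, 0) + (1 : ℝ) • (0, 1) := by simp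
    convert h.pos _ (mapsTo_duffy hp) using 1
    rw [h1, h2]
    simp only [map_add, map_smul, det4_add_left, det4_add_right, det4_smul_left, det4_smul_right,
      det4_self]
    rw [det4_swap (fderivWithin ℝ F stdTri (duffy p) (1, 0))]
    simp only [Function.comp]
    ring
  derivG p hp := by
    have h1 := ((h.contF.differentiableOn (by simp)) _ (mapsTo_duffy hp)).hasFDerivWithinAt
    refine (h1.comp p (hasFDerivAt_duffy p).hasFDerivWithinAt mapsTo_duffy).congr_fderiv ?_
    ext <;> simp [-Prod.smul_mk]

end TrianglePatch

lemma hasDerivAt_comp_line {H : ℝ × ℝ → E4} {H' : ℝ × ℝ →L[ℝ] E4} {p w : ℝ × ℝ}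
    (hm : ∀ s ∈ Icc (0:ℝ) 1, p + s • w ∈ unitSq) {s : ℝ} (hs : s ∈ Ioo (0:ℝ) 1)
    (hH : HasFDerivWithinAt H H' unitSq (p + s • w)) :
    HasDerivAt (fun s => H (p + s • w)) (H' w) s := by
  have h1 : HasDerivAt (fun s : ℝ => p + s • w) w s := by
    simpa using ((hasDerivAt_id s).smul_const w).const_add p
  have h2 := hH.comp_hasDerivWithinAt s h1.hasDerivWithinAt hm
  exact h2.hasDerivAt (Icc_mem_nhds hs.1 hs.2)

lemma hasDerivAt_comp_line' {H : ℝ × ℝ → E4} (hH : ContDiffOn ℝ ∞ H unitSq) {p w : ℝ × ℝ}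
    (hm : ∀ s ∈ Icc (0:ℝ) 1, p + s • w ∈ unitSq) {s : ℝ} (hs : s ∈ Ioo (0:ℝ) 1) :
    HasDerivAt (fun s => H (p + s • w)) (fderivWithin ℝ H unitSq (p + s • w) w) s :=
  hasDerivAt_comp_line hm hs ((hH.differentiableOn (by simp)) _
    (hm s (Ioo_subset_Icc_self hs))).hasFDerivWithinAt

/-- The total geodesic curvature of a side along which the tangent field `V` is the velocity. -/
lemma totalGeodCurv_eq {G n V : ℝ × ℝ → E4} (hV : ContDiffOn ℝ ∞ V unitSq) {p w : ℝ × ℝ}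
    (hm : ∀ s ∈ Icc (0:ℝ) 1, p + s • w ∈ unitSq)
    (hG : ∀ s ∈ Ioo (0:ℝ) 1, HasDerivAt (fun s => G (p + s • w)) (V (p + s • w)) s) :
    totalGeodCurv (fun s => G (p + s • w)) (fun s => n (p + s • w)) =
      ∫ s in (0:ℝ)..1, SquarePatch.conn G n V (p + s • w) w := by
  unfold totalGeodCurv SquarePatch.conn
  refine integral_congr_Ioo fun s hs => ?_
  have h1 : deriv (fun s => G (p + s • w)) =ᶠ[𝓝 s] fun s => V (p + s • w) := by
    filter_upwards [isOpen_Ioo.mem_nhds hs] with t ht using (hG t ht).deriv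
  rw [h1.deriv_eq, (hasDerivAt_comp_line' hV hm hs).deriv, (hG s hs).deriv]

namespace SquarePatch

variable {G n R E : ℝ × ℝ → E4} (h : SquarePatch G n R E)

include h

lemma continuousOn_conn {V : ℝ × ℝ → E4} (hV : ContDiffOn ℝ ∞ V unitSq)
    (hV0 : ∀ p ∈ unitSq, V p ≠ 0) (w : ℝ × ℝ) :
    ContinuousOn (fun p => conn G n V p w) unitSq :=
  (hV.continuousOn.det4 (hV.continuousOn_fderivWithin_apply' w) h.contn.continuousOn
      h.contG.continuousOn).div (hV.continuousOn.norm.pow 2)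
      (fun p hp => pow_ne_zero 2 (norm_ne_zero_iff.2 (hV0 p hp)))

/-- Along a side, the connection forms of the frames starting with `R` and `E` differ by the
derivative of the angle from `R` to `E`. -/
lemma integral_conn_sub {p w : ℝ × ℝ} (hm : ∀ s ∈ Icc (0:ℝ) 1, p + s • w ∈ unitSq) :
    ∫ s in (0:ℝ)..1, conn G n R (p + s • w) w =
      (∫ s in (0:ℝ)..1, conn G n E (p + s • w) w) -
        (InnerProductGeometry.angle (R (p + w)) (E (p + w)) -
          InnerProductGeometry.angle (R p) (E p)) := by
  have hR0 : ∀ p ∈ unitSq, R p ≠ 0 := fun p hp => (ne_zero_of_det4_pos (h.pos p hp)).1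
  have hE0 : ∀ p ∈ unitSq, E p ≠ 0 := fun p hp => (ne_zero_of_det4_pos (h.pos p hp)).2
  have hl : ContinuousOn (fun s : ℝ => p + s • w) (Icc 0 1) := by fun_prop
  have i1 : IntervalIntegrable (fun s => conn G n R (p + s • w) w) volume 0 1 :=
    ContinuousOn.intervalIntegrable (by
      rw [uIcc_of_le zero_le_one]
      exact (h.continuousOn_conn h.contR hR0 w).comp hl hm)
  have i2 : IntervalIntegrable (fun s => conn G n E (p + s • w) w) volume 0 1 :=
    ContinuousOn.intervalIntegrable (by
      rw [uIcc_of_le zero_le_one]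
      exact (h.continuousOn_conn h.contE hE0 w).comp hl hm)
  have ftc := intervalIntegral.integral_eq_sub_of_hasDerivAt_of_le (zero_le_one' ℝ)
    (f := fun s => InnerProductGeometry.angle (R (p + s • w)) (E (p + s • w)))
    (f' := fun s => conn G n E (p + s • w) w - conn G n R (p + s • w) w) (fun s hs => by
      have hq := hm s hs
      have := (InnerProductGeometry.continuousAt_angle (x := (R (p + s • w), E (p + s • w)))
        (hR0 _ hq) (hE0 _ hq)).comp_continuousWithinAt (s := Icc 0 1)
        (f := fun s : ℝ => (R (p + s • w), E (p + s • w)))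
        (((h.contR.continuousOn.comp hl hm).prodMk (h.contE.continuousOn.comp hl hm)) s hs)
      exact this)
    (fun s hs => by
      have hq := hm s (Ioo_subset_Icc_self hs)
      exact (h.ortho _ hq).hasDerivAt_angle (hasDerivAt_comp_line' h.contR hm hs)
        (hasDerivAt_comp_line' h.contE hm hs) (h.tangR _ hq) (h.tangE _ hq) (h.pos _ hq))
    (i2.sub i1)
  rw [intervalIntegral.integral_sub i2 i1] at ftc
  simp only [one_smul, zero_smul, add_zero] at ftc
  linarith

end SquarePatch

/-- The angle sum of the triangle 0, P, Q: an exterior angle minus one opposite interior angle is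
the other. It recovers the corner angle at the vertex which `duffy` blows up to a side. -/
lemma angle_diff_eq_angle {P Q : E4} (hQ : Q ≠ 0) :
    InnerProductGeometry.angle P (Q - P) - InnerProductGeometry.angle Q (Q - P) =
      InnerProductGeometry.angle P Q := by
  have := InnerProductGeometry.angle_add_angle_sub_add_angle_sub_eq_pi P hQ
  rw [← neg_sub Q P, InnerProductGeometry.angle_neg_right] at this
  linarith

/-- The **Gauss–Bonnet formula** for a triangle. -/
theorem TrianglePatch.gaussBonnet {F n : ℝ × ℝ → E4} (h : TrianglePatch F n) :
    ∫ x in (0:ℝ)..1, ∫ y in (0:ℝ)..1, curvForm (F ∘ duffy) (n ∘ duffy) (x, y) =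
      InnerProductGeometry.angle (fderivWithin ℝ F stdTri (0, 0) (1, 0))
        (fderivWithin ℝ F stdTri (0, 0) (0, 1)) +
      InnerProductGeometry.angle (fderivWithin ℝ F stdTri (1, 0) (-1, 1))
        (fderivWithin ℝ F stdTri (1, 0) (-1, 0)) +
      InnerProductGeometry.angle (fderivWithin ℝ F stdTri (0, 1) (0, -1))
        (fderivWithin ℝ F stdTri (0, 1) (1, -1)) - Real.pi -
      (totalGeodCurv (fun s => F (s, 0)) (fun s => n (s, 0)) +
        totalGeodCurv (fun s => F (1 - s, s)) (fun s => n (1 - s, s)) +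
        totalGeodCurv (fun s => F (0, 1 - s)) (fun s => n (0, 1 - s))) := by
  have hs := h.squarePatch
  set R := fun p : ℝ × ℝ => fderivWithin ℝ F stdTri (duffy p) (1 - p.2, p.2) with hR
  set E := fun p : ℝ × ℝ => fderivWithin ℝ F stdTri (duffy p) (-1, 1) with hE
  have hI : ∀ {s : ℝ}, s ∈ Icc (0:ℝ) 1 → s ∈ Icc (0:ℝ) 1 := id
  have z0 : (0:ℝ) ∈ Icc (0:ℝ) 1 := ⟨le_rfl, zero_le_one⟩
  have z1 : (1:ℝ) ∈ Icc (0:ℝ) 1 := ⟨zero_le_one, le_rfl⟩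
  have m1 : ∀ s ∈ Icc (0:ℝ) 1, ((0, 0) : ℝ × ℝ) + s • ((1, 0) : ℝ × ℝ) ∈ unitSq := fun s hs => by
    simpa using And.intro hs z0
  have m2 : ∀ s ∈ Icc (0:ℝ) 1, ((0, 1) : ℝ × ℝ) + s • ((1, 0) : ℝ × ℝ) ∈ unitSq := fun s hs => by
    simpa using And.intro hs z1
  have m3 : ∀ s ∈ Icc (0:ℝ) 1, ((1, 0) : ℝ × ℝ) + s • ((0, 1) : ℝ × ℝ) ∈ unitSq := fun s hs => by
    simpa using And.intro z1 hs
  have m4 : ∀ s ∈ Icc (0:ℝ) 1, ((0, 0) : ℝ × ℝ) + s • ((0, 1) : ℝ × ℝ) ∈ unitSq := fun s hs => by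
    simpa using And.intro z0 hs
  have k1 := totalGeodCurv_eq (G := F ∘ duffy) (n := n ∘ duffy) hs.contR m1 (fun s hs' => by
    have := hasDerivAt_comp_line m1 hs' (hs.derivG _ (m1 s (Ioo_subset_Icc_self hs')))
    simpa using this)
  have k2 := totalGeodCurv_eq (G := F ∘ duffy) (n := n ∘ duffy) hs.contR m2 (fun s hs' => by
    have := hasDerivAt_comp_line m2 hs' (hs.derivG _ (m2 s (Ioo_subset_Icc_self hs')))
    simpa using this)
  -- `R` is the velocity of the sides y = 0 and y = 1, but `E` is the velocity of the side x = 1. On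
  -- the vertical sides `R` is therefore exchanged for `E`, at the cost of a change of angle.
  have k3 := totalGeodCurv_eq (G := F ∘ duffy) (n := n ∘ duffy) hs.contE m3 (fun s hs' => by
    have := hasDerivAt_comp_line m3 hs' (hs.derivG _ (m3 s (Ioo_subset_Icc_self hs')))
    simpa using this)
  have c3 := hs.integral_conn_sub m3
  have c4 := hs.integral_conn_sub m4
  rw [← k3] at c3
  have hE0 : ∀ s : ℝ, E (0, s) = E (0, 0) := fun s => by simp [E, duffy]
  -- On the collapsed side `E` is constant, so only the change of angle remains there.
  have k4 : ∫ s in (0:ℝ)..1, SquarePatch.conn (F ∘ duffy) (n ∘ duffy) E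
      ((0, 0) + s • (0, 1)) (0, 1) = 0 := by
    rw [integral_congr_Ioo (g := fun _ => 0), intervalIntegral.integral_zero]
    intro s hs'
    have h1 := hasDerivAt_comp_line' hs.contE m4 hs'
    have h2 : HasDerivAt (fun s : ℝ => E ((0, 0) + s • (0, 1))) 0 s := by
      have : (fun s : ℝ => E ((0, 0) + s • (0, 1))) = fun _ => E (0, 0) := by
        ext1 s; simpa using hE0 s
      rw [this]; exact hasDerivAt_const _ _
    unfold SquarePatch.conn
    rw [h1.unique h2]
    simp [det4_eq]
  rw [k4] at c4
  rw [hs.integral_curvForm]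
  simp only [intervalIntegral.integral_neg]
  have r2 := totalGeodCurv_reverse (fun s => F (0, s)) (fun s => n (0, s))
  simp only [Function.comp_apply, duffy, Prod.smul_mk, Prod.mk_add_mk, smul_eq_mul, mul_one,
    mul_zero, zero_add, add_zero, sub_zero, sub_self, one_mul, E, R] at k1 k2 k3 c3 c4 ⊢
  have d4 : fderivWithin ℝ F stdTri (0, 0) (-1, 1) = fderivWithin ℝ F stdTri (0, 0) (0, 1) -
      fderivWithin ℝ F stdTri (0, 0) (1, 0) := by rw [← map_sub]; simp
  have z : ((0 : ℝ), (0 : ℝ)) ∈ unitSq := ⟨z0, z0⟩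
  have hp0 := ne_zero_of_det4_pos (h.pos (0, 0) ⟨le_rfl, le_rfl, by norm_num⟩)
  have aa := angle_diff_eq_angle
    (P := fderivWithin ℝ F stdTri (0, 0) (1, 0)) hp0.2
  rw [← d4] at aa
  have a1 : InnerProductGeometry.angle (fderivWithin ℝ F stdTri (1, 0) (-1, 1))
        (fderivWithin ℝ F stdTri (1, 0) (-1, 0)) = Real.pi -
        InnerProductGeometry.angle (fderivWithin ℝ F stdTri (1, 0) (1, 0))
        (fderivWithin ℝ F stdTri (1, 0) (-1, 1)) := by
    have : ((-1, 0) : ℝ × ℝ) = -(1, 0) := by simp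
    rw [this, map_neg, InnerProductGeometry.angle_neg_right, InnerProductGeometry.angle_comm]
  have a2 : InnerProductGeometry.angle (fderivWithin ℝ F stdTri (0, 1) (0, -1))
        (fderivWithin ℝ F stdTri (0, 1) (1, -1)) =
        InnerProductGeometry.angle (fderivWithin ℝ F stdTri (0, 1) (0, 1))
        (fderivWithin ℝ F stdTri (0, 1) (-1, 1)) := by
    have e1 : ((0, -1) : ℝ × ℝ) = -(0, 1) := by simp
    have e2 : ((1, -1) : ℝ × ℝ) = -(-1, 1) := by simp
    rw [e1, e2, map_neg, map_neg, InnerProductGeometry.angle_neg_neg]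
  rw [a1, a2, c3, c4, r2, k1, k2]
  linarith

/-! ### Change of variables in the cone over a collar -/

/-- The coordinates of a point of `ℝ⁴`, grouped in pairs. -/
def pairCoord : E4 →L[ℝ] (ℝ × ℝ) × (ℝ × ℝ) :=
  ((EuclideanSpace.proj 0).prod (EuclideanSpace.proj 1)).prod
    ((EuclideanSpace.proj 2).prod (EuclideanSpace.proj 3))

lemma pairCoord_apply (y : E4) : pairCoord y = ((y 0, y 1), (y 2, y 3)) := rfl

/-- `pairCoord` as a measurable equivalence. -/
def pairCoordEquiv : E4 ≃ᵐ (ℝ × ℝ) × (ℝ × ℝ) where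
  toFun := pairCoord
  invFun z := !₂[z.1.1, z.1.2, z.2.1, z.2.2]
  left_inv y := by ext i; fin_cases i <;> rfl
  right_inv z := rfl
  measurable_toFun := pairCoord.continuous.measurable
  measurable_invFun := by
    refine (WithLp.measurable_toLp 2 _).comp (measurable_pi_lambda _ fun i => ?_)
    fin_cases i <;> simp <;> fun_prop

lemma measurePreserving_pairCoord : MeasurePreserving pairCoord := by
  have h1 := EuclideanSpace.volume_preserving_symm_measurableEquiv_toLp (Fin 4)
  have h2 := volume_preserving_piFinSuccAbove (fun _ : Fin 4 => ℝ) 0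
  have h3 := (MeasurePreserving.id (volume : Measure ℝ)).prod
    (volume_preserving_piFinSuccAbove (fun _ : Fin 3 => ℝ) 0)
  have h4 := (MeasurePreserving.id (volume : Measure ℝ)).prod
    ((MeasurePreserving.id (volume : Measure ℝ)).prod (volume_preserving_finTwoArrow ℝ))
  have h5 := (measurePreserving_prodAssoc (volume : Measure ℝ) (volume : Measure ℝ)
    ((volume : Measure ℝ).prod (volume : Measure ℝ))).symm
  exact h5.comp (h4.comp (h3.comp (h2.comp h1)))

lemma det_comp_pairCoord (L : (ℝ × ℝ) × (ℝ × ℝ) →L[ℝ] E4) :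
    (L.comp pairCoord).det = det4 (L ((1, 0), 0)) (L ((0, 1), 0)) (L (0, (1, 0))) (L (0, (0, 1))) := by
  rw [ContinuousLinearMap.det, ← LinearMap.det_toMatrix (EuclideanSpace.basisFun (Fin 4) ℝ).toBasis,
    ← Matrix.det_transpose, det4]
  congr 1
  ext i j
  fin_cases i <;>
    simp [LinearMap.toMatrix_apply, pairCoord_apply, Prod.zero_eq_mk]

/-- Change of variables for a map into `ℝ⁴` of two pairs of real parameters. -/
lemma setIntegral_image_pairs {D : Set ((ℝ × ℝ) × (ℝ × ℝ))} (hD : MeasurableSet D)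
    {f : (ℝ × ℝ) × (ℝ × ℝ) → E4} {f' : (ℝ × ℝ) × (ℝ × ℝ) → (ℝ × ℝ) × (ℝ × ℝ) →L[ℝ] E4}
    (hf : ∀ z ∈ D, HasFDerivAt f (f' z) z) (hinj : InjOn f D) (g : E4 → ℝ) :
    ∫ y in f '' D, g y = ∫ z in D, |((f' z).comp pairCoord).det| * g (f z) := by
  have him : (f ∘ pairCoord) '' (pairCoord ⁻¹' D) = f '' D := by
    rw [image_comp]
    exact congrArg _ (image_preimage_eq _ pairCoordEquiv.surjective)
  rw [← him, integral_image_eq_integral_abs_det_fderiv_smul volume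
    (pairCoord.continuous.measurable hD) (f' := fun y => (f' (pairCoord y)).comp pairCoord)
    (fun y hy => ((hf _ hy).comp y pairCoord.hasFDerivAt).hasFDerivWithinAt)
    (fun a ha b hb hab => pairCoordEquiv.injective (hinj ha hb hab))]
  exact measurePreserving_pairCoord.setIntegral_preimage_emb
    pairCoordEquiv.measurableEmbedding (fun z => |((f' z).comp pairCoord).det| * g (f z)) D

/-- The cone over the surface swept in the normal direction: `ρ (cos ψ(t) G(p) + sin ψ(t) n(p))`. -/
def shell (G n : ℝ × ℝ → E4) (ψ : ℝ → ℝ) (z : (ℝ × ℝ) × (ℝ × ℝ)) : E4 :=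
  z.2.2 • (Real.cos (ψ z.2.1) • G z.1 + Real.sin (ψ z.2.1) • n z.1)

/-- The derivative of `shell`. -/
def shellDeriv (Gp np : E4) (G' n' : ℝ × ℝ →L[ℝ] E4) (θ θ' ρ : ℝ) :
    (ℝ × ℝ) × (ℝ × ℝ) →L[ℝ] E4 :=
  (ρ • (Real.cos θ • G' + Real.sin θ • n')).comp (ContinuousLinearMap.fst ℝ _ _) +
  (((ContinuousLinearMap.fst ℝ ℝ ℝ).smulRight
      ((ρ * θ') • (Real.cos θ • np - Real.sin θ • Gp)) +
    (ContinuousLinearMap.snd ℝ ℝ ℝ).smulRight (Real.cos θ • Gp + Real.sin θ • np))).comp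
    (ContinuousLinearMap.snd ℝ _ _)

lemma hasFDerivWithinAt_shell {G n : ℝ × ℝ → E4} {ψ : ℝ → ℝ} {z : (ℝ × ℝ) × (ℝ × ℝ)}
    {G' n' : ℝ × ℝ →L[ℝ] E4} {ψ' : ℝ} {s : Set (ℝ × ℝ)} (hG : HasFDerivWithinAt G G' s z.1)
    (hn : HasFDerivWithinAt n n' s z.1) (hψ : HasDerivAt ψ ψ' z.2.1) :
    HasFDerivWithinAt (shell G n ψ) (shellDeriv (G z.1) (n z.1) G' n' (ψ z.2.1) ψ' z.2.2)
      (s ×ˢ univ) z := by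
  have hfst : MapsTo Prod.fst (s ×ˢ (univ : Set (ℝ × ℝ))) s := fun x hx => hx.1
  have h1 : HasFDerivWithinAt (fun z : (ℝ × ℝ) × (ℝ × ℝ) => G z.1) _ (s ×ˢ univ) z :=
    hG.comp z hasFDerivWithinAt_fst hfst
  have h2 : HasFDerivWithinAt (fun z : (ℝ × ℝ) × (ℝ × ℝ) => n z.1) _ (s ×ˢ univ) z :=
    hn.comp z hasFDerivWithinAt_fst hfst
  have ht : HasFDerivAt (fun z : (ℝ × ℝ) × (ℝ × ℝ) => z.2.1)
    ((ContinuousLinearMap.fst ℝ ℝ ℝ).comp (ContinuousLinearMap.snd ℝ _ _)) z :=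
    hasFDerivAt_fst.comp z hasFDerivAt_snd
  have hr : HasFDerivAt (fun z : (ℝ × ℝ) × (ℝ × ℝ) => z.2.2)
    ((ContinuousLinearMap.snd ℝ ℝ ℝ).comp (ContinuousLinearMap.snd ℝ _ _)) z :=
    hasFDerivAt_snd.comp z hasFDerivAt_snd
  have h3 := (hψ.comp_hasFDerivAt z ht).cos.hasFDerivWithinAt (s := s ×ˢ univ)
  have h4 := (hψ.comp_hasFDerivAt z ht).sin.hasFDerivWithinAt (s := s ×ˢ univ)
  refine (hr.hasFDerivWithinAt.smul ((h3.smul h1).add (h4.smul h2))).congr_fderiv ?_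
  ext <;> simp [shellDeriv] <;> ring

lemma hasFDerivAt_shell {G n : ℝ × ℝ → E4} {ψ : ℝ → ℝ} {z : (ℝ × ℝ) × (ℝ × ℝ)}
    {G' n' : ℝ × ℝ →L[ℝ] E4} {ψ' : ℝ} (hG : HasFDerivAt G G' z.1)
    (hn : HasFDerivAt n n' z.1) (hψ : HasDerivAt ψ ψ' z.2.1) :
    HasFDerivAt (shell G n ψ) (shellDeriv (G z.1) (n z.1) G' n' (ψ z.2.1) ψ' z.2.2) z := by
  rw [← hasFDerivWithinAt_univ] at *
  simpa using hasFDerivWithinAt_shell hG hn hψ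

/-- The determinant of the parallel surface at distance `θ`. -/
def parallelDet (Gp np : E4) (G' n' : ℝ × ℝ →L[ℝ] E4) (θ : ℝ) : ℝ :=
  det4 (Real.cos θ • G' (1, 0) + Real.sin θ • n' (1, 0))
    (Real.cos θ • G' (0, 1) + Real.sin θ • n' (0, 1)) np Gp

/-- The two surface directions contribute ρ each and the normal direction ρθ'. The turned normal and
position are brought back to the original pair by `det4_rotate`. -/
lemma det_shellDeriv (Gp np : E4) (G' n' : ℝ × ℝ →L[ℝ] E4) (θ θ' ρ : ℝ) :
    ((shellDeriv Gp np G' n' θ θ' ρ).comp pairCoord).det =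
      ρ ^ 3 * (θ' * parallelDet Gp np G' n' θ) := by
  rw [det_comp_pairCoord]
  simp only [shellDeriv, add_apply, ContinuousLinearMap.comp_apply,
    ContinuousLinearMap.coe_fst', ContinuousLinearMap.coe_snd', ContinuousLinearMap.smulRight_apply,
    smul_apply, map_zero, zero_add, add_zero, one_smul,
    zero_smul]
  rw [det4_smul_left, det4_smul_right, det4_smul_third, det4_rotate _ _ _ _ _ _
    (Real.cos_sq_add_sin_sq θ)]
  simp only [parallelDet]
  ring

/-- The mixed term of `parallelDet`. -/
def mixedDet (Gp np : E4) (G' n' : ℝ × ℝ →L[ℝ] E4) : ℝ :=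
  det4 (G' (1, 0)) (n' (0, 1)) np Gp + det4 (n' (1, 0)) (G' (0, 1)) np Gp

lemma parallelDet_eq (Gp np : E4) (G' n' : ℝ × ℝ →L[ℝ] E4) (θ : ℝ) : parallelDet Gp np G' n' θ =
    Real.cos θ ^ 2 * det4 (G' (1, 0)) (G' (0, 1)) np Gp +
      Real.cos θ * Real.sin θ * mixedDet Gp np G' n' +
      Real.sin θ ^ 2 * det4 (n' (1, 0)) (n' (0, 1)) np Gp := by
  simp only [parallelDet, mixedDet, det4_add_left, det4_add_right, det4_smul_left, det4_smul_right]
  ring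

/-- With `A` an antiderivative of the parallel area density, the integral is A ∘ ψ - A between the
ends. The two agree at -δ; at δ the arguments differ by -π, so the π-periodic trigonometric terms
cancel and only the linear part (a + c)θ/2 of `A` contributes. In particular the mixed coefficient
`b` disappears. -/
lemma integral_parallelDet (a b c δ : ℝ) {ψ : ℝ → ℝ} (hψ : ContDiff ℝ ∞ ψ)
    (h0 : ψ (-δ) = -δ) (h1 : ψ δ = δ - Real.pi) :
    ∫ t in (-δ)..δ, (deriv ψ t * (Real.cos (ψ t) ^ 2 * a + Real.cos (ψ t) * Real.sin (ψ t) * b +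
      Real.sin (ψ t) ^ 2 * c) - (Real.cos t ^ 2 * a + Real.cos t * Real.sin t * b +
      Real.sin t ^ 2 * c)) = - (Real.pi / 2) * (a + c) := by
  let A : ℝ → ℝ := fun θ => a * ((θ + Real.sin θ * Real.cos θ) / 2) + b * (Real.sin θ ^ 2 / 2) +
    c * ((θ - Real.sin θ * Real.cos θ) / 2)
  have hA : ∀ θ, HasDerivAt A (Real.cos θ ^ 2 * a + Real.cos θ * Real.sin θ * b +
      Real.sin θ ^ 2 * c) θ := fun θ => by
    have hs := Real.hasDerivAt_sin θ
    have hc := Real.hasDerivAt_cos θ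
    have hsc := hs.mul hc
    have h1 := (((((hasDerivAt_id θ).add hsc).div_const 2).const_mul a).add
      (((hs.pow 2).div_const 2).const_mul b)).add
      ((((hasDerivAt_id θ).sub hsc).div_const 2).const_mul c)
    refine h1.congr_deriv ?_
    have := Real.sin_sq_add_cos_sq θ
    simp
    linear_combination (-(a + c) / 2) * this
  have hd : ∀ t, HasDerivAt ψ (deriv ψ t) t := fun t =>
    (hψ.differentiable (by simp) t).hasDerivAt
  have hcont : Continuous (deriv ψ) := hψ.continuous_deriv (by simp)
  have hcψ := hψ.continuous
  rw [intervalIntegral.integral_eq_sub_of_hasDerivAt (f := fun t => A (ψ t) - A t)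
    (fun t _ => by
      refine (((hA (ψ t)).comp t (hd t)).sub (hA t)).congr_deriv ?_
      ring)
    (Continuous.intervalIntegrable (by fun_prop) _ _)]
  simp only [A, h0, h1, Real.sin_sub_pi, Real.cos_sub_pi]
  ring

/-- As `H` carries the shell with profile `id` to the one with profile ψ, the chain rule turns det
`H` times the volume density into the density with profile ψ. The variables then separate: ρ³
integrates to 1/4, the normal variable gives -(π/2)(a + c), and a + c is the curvature form. -/
theorem SquarePatch.integral_shell {G n R E : ℝ × ℝ → E4} (h : SquarePatch G n R E) {δ : ℝ}
    (hδ : 0 ≤ δ) {ψ : ℝ → ℝ} (hψ : ContDiff ℝ ∞ ψ) (h0 : ψ (-δ) = -δ) (h1 : ψ δ = δ - Real.pi)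
    {H : E4 → E4} {D : Set ((ℝ × ℝ) × (ℝ × ℝ))}
    (hD : D = (Ioo 0 1 ×ˢ Ioo 0 1) ×ˢ (Ioo (-δ) δ ×ˢ Ioo 0 1))
    (hpos : ∀ p ∈ Ioo (0:ℝ) 1 ×ˢ Ioo (0:ℝ) 1, ∀ t ∈ Ioo (-δ) δ,
      0 < parallelDet (G p) (n p) (fderiv ℝ G p) (fderiv ℝ n p) t)
    (hinj : InjOn (shell G n id) D) (hH : ∀ z ∈ D, H (shell G n id z) = shell G n ψ z)
    (hHd : ∀ z ∈ D, DifferentiableAt ℝ H (shell G n id z)) :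
    ∫ y in shell G n id '' D, ((fderiv ℝ H y).det - 1) =
      -(Real.pi / 8) * ∫ x in (0:ℝ)..1, ∫ y in (0:ℝ)..1, curvForm G n (x, y) := by
  have hDo : IsOpen D := hD ▸ (isOpen_Ioo.prod isOpen_Ioo).prod (isOpen_Ioo.prod isOpen_Ioo)
  have hdG : ∀ p ∈ Ioo (0:ℝ) 1 ×ˢ Ioo (0:ℝ) 1, HasFDerivAt G (fderiv ℝ G p) p ∧
      HasFDerivAt n (fderiv ℝ n p) p := fun p hp => by
    rw [← interior_unitSq] at hp
    have := mem_interior_iff_mem_nhds.1 hp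
    exact ⟨((h.contG.contDiffAt this).differentiableAt (by simp)).hasFDerivAt,
      ((h.contn.contDiffAt this).differentiableAt (by simp)).hasFDerivAt⟩
  have hd : ∀ t, HasDerivAt ψ (deriv ψ t) t := fun t =>
    (hψ.differentiable (by simp) t).hasDerivAt
  have hDm : ∀ {z}, z ∈ D → z.1 ∈ Ioo (0:ℝ) 1 ×ˢ Ioo (0:ℝ) 1 ∧ z.2.1 ∈ Ioo (-δ) δ ∧
      z.2.2 ∈ Ioo (0:ℝ) 1 := fun {z} hz => by rw [hD] at hz; exact hz
  set P := fun (p : ℝ × ℝ) (θ : ℝ) => parallelDet (G p) (n p) (fderiv ℝ G p) (fderiv ℝ n p) θ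
  have hder : ∀ z ∈ D, HasFDerivAt (shell G n id)
      (shellDeriv (G z.1) (n z.1) (fderiv ℝ G z.1) (fderiv ℝ n z.1) z.2.1 1 z.2.2) z := fun z hz =>
    hasFDerivAt_shell (hdG _ (hDm hz).1).1 (hdG _ (hDm hz).1).2 (hasDerivAt_id _)
  rw [setIntegral_image_pairs hDo.measurableSet hder hinj]
  have e1 : ∀ z ∈ D, |((shellDeriv (G z.1) (n z.1) (fderiv ℝ G z.1) (fderiv ℝ n z.1) z.2.1 1
      z.2.2).comp pairCoord).det| * ((fderiv ℝ H (shell G n id z)).det - 1) =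
      (deriv ψ z.2.1 * P z.1 (ψ z.2.1) - P z.1 z.2.1) * z.2.2 ^ 3 := fun z hz => by
    have hz' := hDm hz
    have hc : (fderiv ℝ H (shell G n id z)).comp (shellDeriv (G z.1) (n z.1) (fderiv ℝ G z.1)
        (fderiv ℝ n z.1) z.2.1 1 z.2.2) = shellDeriv (G z.1) (n z.1) (fderiv ℝ G z.1)
        (fderiv ℝ n z.1) (ψ z.2.1) (deriv ψ z.2.1) z.2.2 := by
      have a1 := (hHd z hz).hasFDerivAt.comp z (hder z hz)
      have a2 := hasFDerivAt_shell (hdG _ hz'.1).1 (hdG _ hz'.1).2 (hd z.2.1)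
      have a3 : H ∘ shell G n id =ᶠ[𝓝 z] shell G n ψ :=
        Filter.eventually_of_mem (hDo.mem_nhds hz) hH
      exact (a1.congr_of_eventuallyEq a3.symm).unique a2
    have hdet := det_shellDeriv (G z.1) (n z.1) (fderiv ℝ G z.1) (fderiv ℝ n z.1) z.2.1 1 z.2.2
    have hdet' := det_shellDeriv (G z.1) (n z.1) (fderiv ℝ G z.1) (fderiv ℝ n z.1) (ψ z.2.1)
      (deriv ψ z.2.1) z.2.2
    rw [← hc, ContinuousLinearMap.comp_assoc] at hdet'
    have hmul : ∀ A B : E4 →L[ℝ] E4, (A.comp B).det = A.det * B.det := fun A B =>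
      LinearMap.det_comp _ _
    rw [hmul] at hdet'
    have hp := hpos z.1 hz'.1 z.2.1 hz'.2.1
    have hnn : 0 ≤ z.2.2 ^ 3 := pow_nonneg hz'.2.2.1.le 3
    rw [abs_of_nonneg (by rw [hdet]; positivity), mul_sub, mul_comm, hdet', hdet]
    simp only [P]
    ring
  rw [setIntegral_congr_fun hDo.measurableSet e1, hD]
  -- The integrand extends continuously to the compact closure of the parameter box once derivatives
  -- are taken within the square.
  have hint : IntegrableOn (fun z : (ℝ × ℝ) × (ℝ × ℝ) =>
      (deriv ψ z.2.1 * P z.1 (ψ z.2.1) - P z.1 z.2.1) * z.2.2 ^ 3)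
      ((Ioo 0 1 ×ˢ Ioo 0 1) ×ˢ (Ioo (-δ) δ ×ˢ Ioo 0 1)) (volume.prod volume) := by
    have hcm : ∀ X Y : ℝ × ℝ → E4, ContDiffOn ℝ ∞ X unitSq → ContDiffOn ℝ ∞ Y unitSq →
        ContinuousOn (fun z : (ℝ × ℝ) × (ℝ × ℝ) => det4 (fderivWithin ℝ X unitSq z.1 (1, 0))
          (fderivWithin ℝ Y unitSq z.1 (0, 1)) (n z.1) (G z.1))
          (unitSq ×ˢ (Icc (-δ) δ ×ˢ Icc 0 1)) := fun X Y hX hY =>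
      (((hX.continuousOn_fderivWithin_apply' _).det4 (hY.continuousOn_fderivWithin_apply' _)
        h.contn.continuousOn h.contG.continuousOn).comp continuousOn_fst fun z hz => hz.1)
    have hcP : ∀ θ : ℝ → ℝ, Continuous θ → ContinuousOn (fun z : (ℝ × ℝ) × (ℝ × ℝ) =>
        parallelDet (G z.1) (n z.1) (fderivWithin ℝ G unitSq z.1) (fderivWithin ℝ n unitSq z.1)
          (θ z.2.1)) (unitSq ×ˢ (Icc (-δ) δ ×ˢ Icc 0 1)) := fun θ hθ => by
      simp only [parallelDet_eq, mixedDet]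
      have c1 : ContinuousOn (fun z : (ℝ × ℝ) × (ℝ × ℝ) => Real.cos (θ z.2.1))
        (unitSq ×ˢ (Icc (-δ) δ ×ˢ Icc 0 1)) := by fun_prop
      have c2 : ContinuousOn (fun z : (ℝ × ℝ) × (ℝ × ℝ) => Real.sin (θ z.2.1))
        (unitSq ×ˢ (Icc (-δ) δ ×ˢ Icc 0 1)) := by fun_prop
      exact (((c1.pow 2).mul (hcm G G h.contG h.contG)).add ((c1.mul c2).mul
        ((hcm G n h.contG h.contn).add (hcm n G h.contn h.contG)))).add
        ((c2.pow 2).mul (hcm n n h.contn h.contn))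
    have hcd : ContinuousOn (fun z : (ℝ × ℝ) × (ℝ × ℝ) => deriv ψ z.2.1)
        (unitSq ×ˢ (Icc (-δ) δ ×ˢ Icc 0 1)) := by
      have hcont : Continuous (deriv ψ) := hψ.continuous_deriv (by simp)
      fun_prop
    have hcr : ContinuousOn (fun z : (ℝ × ℝ) × (ℝ × ℝ) => z.2.2 ^ 3)
        (unitSq ×ˢ (Icc (-δ) δ ×ˢ Icc 0 1)) := by fun_prop
    have hk : IsCompact (unitSq ×ˢ (Icc (-δ) δ ×ˢ Icc (0:ℝ) 1)) :=
      (isCompact_Icc.prod isCompact_Icc).prod (isCompact_Icc.prod isCompact_Icc)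
    have := (((hcd.mul (hcP ψ hψ.continuous)).sub (hcP id continuous_id)).mul
      hcr).integrableOn_compact (μ := volume.prod volume) hk
    refine (this.mono_set (prod_mono (prod_mono Ioo_subset_Icc_self Ioo_subset_Icc_self)
      (prod_mono Ioo_subset_Icc_self Ioo_subset_Icc_self))).congr_fun (fun z hz => ?_)
      ((measurableSet_Ioo.prod measurableSet_Ioo).prod (measurableSet_Ioo.prod measurableSet_Ioo))
    simp only [P, Pi.mul_apply, Pi.sub_apply, fderivWithin_unitSq hz.1, id]
  rw [Measure.volume_eq_prod, setIntegral_prod _ hint]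
  have e2 : ∀ p ∈ Ioo (0:ℝ) 1 ×ˢ Ioo (0:ℝ) 1, ∫ q in Ioo (-δ) δ ×ˢ Ioo (0:ℝ) 1,
      (deriv ψ q.1 * P p (ψ q.1) - P p q.1) * q.2 ^ 3 = -(Real.pi / 8) * curvForm G n p := by
    intro p _
    rw [Measure.volume_eq_prod, setIntegral_prod_mul
      (fun t => deriv ψ t * P p (ψ t) - P p t) (fun ρ => ρ ^ 3)]
    rw [← integral_Ioc_eq_integral_Ioo, ← integral_Ioc_eq_integral_Ioo,
      ← intervalIntegral.integral_of_le (by linarith), ← intervalIntegral.integral_of_le zero_le_one]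
    simp only [P, parallelDet_eq]
    rw [integral_parallelDet _ _ _ _ hψ h0 h1, integral_pow, curvForm]
    norm_num
    ring
  rw [setIntegral_congr_fun (measurableSet_Ioo.prod measurableSet_Ioo) e2,
    integral_const_mul]
  congr 1
  rw [setIntegral_congr_set openSq_ae_eq, Measure.volume_eq_prod, setIntegral_prod _
    (by rw [← Measure.volume_eq_prod]; exact integrableOn_curvForm h.contG h.contn)]
  simp only [intervalIntegral.integral_of_le zero_le_one, integral_Icc_eq_integral_Ioc]

/-! ### The tubular neighbourhood in conical coordinates -/

/-- A closed surface in `S³` with a unit normal, the two sides, and a tubular neighbourhood. -/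
structure TubularSurface (S A A' : Set E4) (N : E4 → E4) (ε : ℝ) : Prop where
  surf : IsClosedSurface S
  comp : AreComplementComponents S A A'
  normal : IsUnitNormalInto S A' N
  eps_pos : 0 < ε
  tubular : IsTubularDiffeo S N (3 * ε)

/-- The point `ρ (cos t q + sin t N(q))`. -/
def conePt (N : E4 → E4) (q : E4) (t ρ : ℝ) : E4 := ρ • (Real.cos t • q + Real.sin t • N q)

/-- The cone over `S³ ∩ Ω_{3ε}`, without its apex. -/
def coneDom (S : Set E4) (N : E4 → E4) (ε : ℝ) : Set E4 :=
  {y | y ≠ 0 ∧ ‖y‖⁻¹ • y ∈ tube S N (3 * ε)}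

/-- The foot point in `S` of the ray through a point of `coneDom`. -/
def coneFoot (S : Set E4) (N : E4 → E4) (ε : ℝ) (y : E4) : E4 :=
  (tubeInv S N (3 * ε) (‖y‖⁻¹ • y)).1

/-- The signed distance to `S` of the ray through a point of `coneDom`. -/
def coneAngle (S : Set E4) (N : E4 → E4) (ε : ℝ) (y : E4) : ℝ :=
  (tubeInv S N (3 * ε) (‖y‖⁻¹ • y)).2 1

lemma OrthoPair.norm_comb {n x : E4} (h : OrthoPair n x) {c s : ℝ} (hcs : c ^ 2 + s ^ 2 = 1) :
    ‖c • x + s • n‖ = 1 := by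
  have : ‖c • x + s • n‖ ^ 2 = 1 := by
    rw [← real_inner_self_eq_norm_sq]
    simp only [inner_add_left, inner_add_right, inner_smul_left, inner_smul_right,
      real_inner_self_eq_norm_sq, h.inner_eq, real_inner_comm n x, h.norm_left, h.norm_right,
      conj_trivial]
    linear_combination hcs
  exact (pow_eq_one_iff_of_nonneg (norm_nonneg _) two_ne_zero).1 this

lemma norm_E2_zero (t : ℝ) : ‖(!₂[0, t] : E2)‖ = |t| := by
  simp [EuclideanSpace.norm_eq, Real.sqrt_sq_eq_abs]

lemma abs_apply_le_norm_E2 (s : E2) (i : Fin 2) : |s i| ≤ ‖s‖ := by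
  simpa using PiLp.norm_apply_le s i

namespace TubularSurface

variable {S A A' : Set E4} {N : E4 → E4} {ε : ℝ} (h : TubularSurface S A A' N ε)

include h

lemma ortho {p : E4} (hp : p ∈ S) : OrthoPair (N p) p where
  norm_left := (h.normal p hp).1
  norm_right := by simpa using h.surf.subset_sphere hp
  inner_eq := by rw [real_inner_comm]; exact (h.normal p hp).2.1

lemma norm_eq_one {p : E4} (hp : p ∈ S) : ‖p‖ = 1 := (h.ortho hp).norm_right

lemma norm_tubeMap {p : E4} (hp : p ∈ S) (s : E2) : ‖tubeMap N (p, s)‖ = |1 - s 0| := by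
  rw [tubeMap, norm_smul, (h.ortho hp).norm_comb (Real.cos_sq_add_sin_sq _), mul_one,
    Real.norm_eq_abs]

/-- `Λ` sends every point with s₁ = 1 to the origin, so injectivity keeps two such points out of the
half disc. -/
lemma three_eps_le : 3 * ε ≤ 1 := by
  by_contra! hlt
  obtain ⟨p, hp⟩ := h.surf.isConnected.nonempty
  obtain ⟨δ, hδ0, hδ⟩ : ∃ δ : ℝ, 0 < δ ∧ 1 + δ < 3 * ε := ⟨(3 * ε - 1) / 2, by linarith, by linarith⟩
  have hn : ∀ a b : ℝ, ‖(!₂[a, b] : E2)‖ ≤ |a| + |b| := fun a b => by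
    have : (!₂[a, b] : E2) = !₂[a, 0] + !₂[0, b] := by ext i; fin_cases i <;> simp
    rw [this]
    refine (norm_add_le _ _).trans (add_le_add ?_ (norm_E2_zero b).le)
    simp [EuclideanSpace.norm_eq, Real.sqrt_sq_eq_abs]
  have h1 : (p, (!₂[1, 0] : E2)) ∈ S ×ˢ halfDisc (3 * ε) :=
    ⟨hp, (hn 1 0).trans_lt (by simpa using hlt), by simp⟩
  have h2 : (p, (!₂[1, δ] : E2)) ∈ S ×ˢ halfDisc (3 * ε) :=
    ⟨hp, (hn 1 δ).trans_lt (by simpa [abs_of_pos hδ0] using hδ), by simp⟩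
  have := h.tubular.injOn h1 h2 (by simp [tubeMap])
  have h3 := congrArg (fun x : E4 × E2 => x.2 1) this
  simp only [PiLp.toLp_apply, Matrix.cons_val_one, Matrix.cons_val_fin_one] at h3
  linarith

lemma mem_halfDisc {t : ℝ} (ht : |t| < 3 * ε) : (!₂[0, t] : E2) ∈ halfDisc (3 * ε) :=
  ⟨by rwa [norm_E2_zero], by simp⟩

lemma tubeMap_zero (q : E4) (t : ℝ) : tubeMap N (q, !₂[0, t]) = Real.cos t • q + Real.sin t • N q := by
  simp [tubeMap]

lemma tubeInv_eq {q : E4} (hq : q ∈ S) {s : E2} (hs : s ∈ halfDisc (3 * ε)) :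
    tubeInv S N (3 * ε) (tubeMap N (q, s)) = (q, s) :=
  h.tubular.injOn.leftInvOn_invFunOn (Set.mk_mem_prod hq hs)

lemma norm_conePt {q : E4} (hq : q ∈ S) (t : ℝ) {ρ : ℝ} (hρ : 0 ≤ ρ) : ‖conePt N q t ρ‖ = ρ := by
  rw [conePt, norm_smul, (h.ortho hq).norm_comb (Real.cos_sq_add_sin_sq _), mul_one,
    Real.norm_of_nonneg hρ]

lemma normalize_conePt {q : E4} (hq : q ∈ S) (t : ℝ) {ρ : ℝ} (hρ : 0 < ρ) :
    ‖conePt N q t ρ‖⁻¹ • conePt N q t ρ = tubeMap N (q, !₂[0, t]) := by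
  rw [h.norm_conePt hq t hρ.le, h.tubeMap_zero, conePt, smul_smul, inv_mul_cancel₀ hρ.ne', one_smul]

lemma conePt_mem_coneDom {q : E4} (hq : q ∈ S) {t : ℝ} (ht : |t| < 3 * ε) {ρ : ℝ} (hρ : 0 < ρ) :
    conePt N q t ρ ∈ coneDom S N ε := by
  refine ⟨fun h0 => ?_, ?_⟩
  · have := h.norm_conePt hq t hρ.le
    rw [h0, norm_zero] at this
    linarith
  · rw [h.normalize_conePt hq t hρ]
    exact mem_image_of_mem (tubeMap N) (Set.mk_mem_prod hq (h.mem_halfDisc ht))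

lemma coneFoot_conePt {q : E4} (hq : q ∈ S) {t : ℝ} (ht : |t| < 3 * ε) {ρ : ℝ} (hρ : 0 < ρ) :
    coneFoot S N ε (conePt N q t ρ) = q := by
  rw [coneFoot, h.normalize_conePt hq t hρ, h.tubeInv_eq hq (h.mem_halfDisc ht)]

lemma coneAngle_conePt {q : E4} (hq : q ∈ S) {t : ℝ} (ht : |t| < 3 * ε) {ρ : ℝ} (hρ : 0 < ρ) :
    coneAngle S N ε (conePt N q t ρ) = t := by
  rw [coneAngle, h.normalize_conePt hq t hρ, h.tubeInv_eq hq (h.mem_halfDisc ht)]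
  simp

/-- Since 3ε ≤ 1, the factor 1 - s₁ lies in (0, 1], and unit norm forces s₁ = 0. -/
lemma fst_eq_zero {q : E4} (hq : q ∈ S) {s : E2} (hs : s ∈ halfDisc (3 * ε))
    (hn : ‖tubeMap N (q, s)‖ = 1) : s 0 = 0 := by
  rw [h.norm_tubeMap hq] at hn
  have h1 := (abs_apply_le_norm_E2 s 0).trans_lt (hs.1.trans_le h.three_eps_le)
  have h2 := hs.2
  rw [abs_lt] at h1
  rw [abs_of_pos (by linarith)] at hn
  linarith

lemma eq_of_mem_coneDom {y : E4} (hy : y ∈ coneDom S N ε) :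
    coneFoot S N ε y ∈ S ∧ |coneAngle S N ε y| < 3 * ε ∧
      conePt N (coneFoot S N ε y) (coneAngle S N ε y) ‖y‖ = y := by
  obtain ⟨hy0, ⟨q, s⟩, ⟨hq, hs⟩, hqs⟩ := hy
  simp only at hq hs
  have hn : ‖y‖ ≠ 0 := norm_ne_zero_iff.2 hy0
  have h0 := h.fst_eq_zero hq hs (by rw [hqs, norm_smul, norm_inv, norm_norm, inv_mul_cancel₀ hn])
  have hi : tubeInv S N (3 * ε) (‖y‖⁻¹ • y) = (q, s) := by rw [← hqs, h.tubeInv_eq hq hs]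
  refine ⟨by rwa [coneFoot, hi], ?_, ?_⟩
  · rw [coneAngle, hi]; exact (abs_apply_le_norm_E2 s 1).trans_lt hs.1
  · rw [coneFoot, coneAngle, hi]
    simp only [tubeMap, h0, sub_zero, one_smul] at hqs
    rw [conePt, hqs, smul_smul, mul_inv_cancel₀ hn, one_smul]

lemma conePt_injective {q q' : E4} (hq : q ∈ S) (hq' : q' ∈ S) {t t' : ℝ} (ht : |t| < 3 * ε)
    (ht' : |t'| < 3 * ε) {ρ ρ' : ℝ} (hρ : 0 < ρ) (hρ' : 0 < ρ')
    (he : conePt N q t ρ = conePt N q' t' ρ') : q = q' ∧ t = t' ∧ ρ = ρ' := by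
  refine ⟨?_, ?_, ?_⟩
  · rw [← h.coneFoot_conePt hq ht hρ, he, h.coneFoot_conePt hq' ht' hρ']
  · rw [← h.coneAngle_conePt hq ht hρ, he, h.coneAngle_conePt hq' ht' hρ']
  · rw [← h.norm_conePt hq t hρ.le, he, h.norm_conePt hq' t' hρ'.le]

/-- Normalized points already lie in the closed ball, so relative openness of the tube becomes
openness of the cone. -/
lemma isOpen_coneDom : IsOpen (coneDom S N ε) := by
  obtain ⟨O, hO, -, hOt⟩ := h.tubular.isOpen_image
  have : coneDom S N ε = {y | y ≠ 0} ∩ (fun y : E4 => ‖y‖⁻¹ • y) ⁻¹' O := by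
    ext y
    simp only [coneDom, hOt, mem_inter_iff, mem_preimage, mem_closedBall_zero_iff]
    constructor
    · rintro ⟨h1, h2, -⟩; exact ⟨h1, h2⟩
    · rintro ⟨h1, h2⟩
      refine ⟨h1, h2, ?_⟩
      rw [norm_smul, norm_inv, norm_norm, inv_mul_cancel₀ (norm_ne_zero_iff.2 h1)]
  rw [this]
  refine ContinuousOn.isOpen_inter_preimage ?_ isOpen_ne hO
  exact (continuousOn_id.norm.inv₀ fun y hy => norm_ne_zero_iff.2 hy).smul continuousOn_id

omit h in
lemma contDiffOn_normalize : ContDiffOn ℝ ∞ (fun y : E4 => ‖y‖⁻¹ • y) {y | y ≠ 0} := fun y hy =>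
  (((contDiffAt_norm ℝ hy).inv (norm_ne_zero_iff.2 hy)).smul contDiffAt_id).contDiffWithinAt

lemma contDiffOn_tubeInv_cone :
    ContDiffOn ℝ ∞ (fun y => tubeInv S N (3 * ε) (‖y‖⁻¹ • y)) (coneDom S N ε) :=
  h.tubular.contDiffOn_inv.comp (contDiffOn_normalize.mono fun _ hy => hy.1) fun _ hy => hy.2

lemma contDiffOn_coneFoot : ContDiffOn ℝ ∞ (coneFoot S N ε) (coneDom S N ε) :=
  contDiff_fst.comp_contDiffOn h.contDiffOn_tubeInv_cone

lemma contDiffOn_coneAngle : ContDiffOn ℝ ∞ (coneAngle S N ε) (coneDom S N ε) :=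
  (EuclideanSpace.proj (𝕜 := ℝ) (1 : Fin 2)).contDiff.comp_contDiffOn
    (contDiff_snd.comp_contDiffOn h.contDiffOn_tubeInv_cone)

/-- `N` is recovered from the smooth parallel surface at height ε by subtracting cos ε · q and
dividing by sin ε ≠ 0. -/
lemma contDiffOn_normal : ContDiffOn ℝ ∞ N S := by
  have he := h.eps_pos
  have h3 := h.three_eps_le
  have hs : 0 < Real.sin ε := Real.sin_pos_of_pos_of_lt_pi he (by linarith [Real.pi_gt_three])
  have h1 : ContDiffOn ℝ ∞ (fun q => tubeMap N (q, (!₂[0, ε] : E2))) S :=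
    h.tubular.contDiffOn.comp (contDiffOn_id.prodMk contDiffOn_const) fun q hq =>
      ⟨hq, h.mem_halfDisc (by rw [abs_of_pos he]; linarith)⟩
  have h2 : ContDiffOn ℝ ∞ (fun q => (Real.sin ε)⁻¹ • (tubeMap N (q, (!₂[0, ε] : E2)) -
      Real.cos ε • q)) S := (h1.sub (contDiffOn_id.const_smul _)).const_smul _
  refine h2.congr fun q _ => ?_
  rw [h.tubeMap_zero, add_sub_cancel_left, smul_smul, inv_mul_cancel₀ hs.ne', one_smul]

/-- Velocities of curves in the surface are tangent. -/
lemma tang_of_hasFDerivWithinAt {E : Type*} [NormedAddCommGroup E] [NormedSpace ℝ E] {f : E → E4}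
    {f' : E →L[ℝ] E4} {s : Set E} {x w : E} (hx : x ∈ s) (hf : HasFDerivWithinAt f f' s x)
    (hs : MapsTo f s S) (hw : w ∈ tangentConeAt ℝ s x) : Tang (N (f x)) (f x) (f' w) := by
  refine ⟨(h.normal _ (hs hx)).2.2.1 _ (tangentConeAt_mono hs.image_subset
    (hf.mapsTo_tangent_cone hw)), ?_⟩
  have h1 := (hf.inner ℝ hf).mapsTo_tangent_cone hw
  have h2 : (fun y => inner ℝ (f y) (f y)) '' s ⊆ {(1:ℝ)} := by
    rintro _ ⟨y, hy, rfl⟩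
    simp [h.norm_eq_one (hs hy)]
  -- The squared norm is constantly 1 on the surface, and a single point has no tangent direction.
  have h3 := tangentConeAt_subset_zero (𝕜 := ℝ) (x := inner ℝ (f x) (f x)) (s := {(1:ℝ)})
    (fun hacc => by
      obtain ⟨y, hy, hne⟩ := accPt_iff_nhds.1 hacc univ univ_mem
      exact hne (hy.2.trans (h2 (mem_image_of_mem _ hx)).symm))
    (tangentConeAt_mono h2 h1)
  simp only [ContinuousLinearMap.comp_apply, ContinuousLinearMap.prod_apply,
    fderivInnerCLM_apply] at h3
  rw [real_inner_comm] at h3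
  have : inner ℝ (f' w) (f x) + inner ℝ (f' w) (f x) = (0:ℝ) := h3
  linarith

/-- The parallel surfaces inside the tube are immersed. -/
lemma parallelDet_ne_zero {G : ℝ × ℝ → E4} {p : ℝ × ℝ} {G' n' : ℝ × ℝ →L[ℝ] E4}
    (hG : HasFDerivAt G G' p) (hn : HasFDerivAt (N ∘ G) n' p) (hS : ∀ᶠ q in 𝓝 p, G q ∈ S)
    (hinj : ∀ w, G' w = 0 → w = 0) {t : ℝ} (ht : |t| < 3 * ε) :
    parallelDet (G p) (N (G p)) G' n' t ≠ 0 := by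
  have hp := hS.self_of_nhds
  let z : (ℝ × ℝ) × (ℝ × ℝ) := (p, (t, 1))
  have hsh : HasFDerivAt (shell G (N ∘ G) id) (shellDeriv (G p) (N (G p)) G' n' t 1 1) z :=
    hasFDerivAt_shell (z := z) hG hn (hasDerivAt_id _)
  have hz : shell G (N ∘ G) id z ∈ coneDom S N ε := h.conePt_mem_coneDom hp ht one_pos
  have hnear : ∀ᶠ w in 𝓝 z, G w.1 ∈ S ∧ |w.2.1| < 3 * ε ∧ 0 < w.2.2 := by
    have c1 : ContinuousAt (fun w : (ℝ × ℝ) × (ℝ × ℝ) => w.1) z := continuous_fst.continuousAt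
    have c2 : Continuous (fun w : (ℝ × ℝ) × (ℝ × ℝ) => |w.2.1|) := by fun_prop
    have c3 : Continuous (fun w : (ℝ × ℝ) × (ℝ × ℝ) => w.2.2) := by fun_prop
    exact (c1.eventually hS).and (((c2.tendsto z).eventually_lt_const (by simpa [z] using ht)).and
      ((c3.tendsto z).eventually_const_lt (by simp [z])))
  have hU := h.isOpen_coneDom.mem_nhds hz
  -- Foot point, angle and norm recover the parameters of the shell. Differentiating these three
  -- identities shows that the derivative of the shell is injective, so its determinant does not
  -- vanish.
  have d1 := ((h.contDiffOn_coneFoot.contDiffAt hU).differentiableAt (by simp)).hasFDerivAt.comp z hsh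
  have d2 := ((h.contDiffOn_coneAngle.contDiffAt hU).differentiableAt (by simp)).hasFDerivAt.comp z hsh
  have d3 := ((contDiffAt_norm ℝ hz.1 (n := 1)).differentiableAt (by simp)).hasFDerivAt.comp z hsh
  have hG1 : HasFDerivAt (fun w : (ℝ × ℝ) × (ℝ × ℝ) => G w.1)
      (G'.comp (ContinuousLinearMap.fst ℝ (ℝ × ℝ) (ℝ × ℝ))) z :=
    HasFDerivAt.comp z (g := G) (f := Prod.fst) hG hasFDerivAt_fst
  have e1 := (d1.congr_of_eventuallyEq (f₁ := fun w => G w.1)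
    (hnear.mono fun w hw => (h.coneFoot_conePt hw.1 hw.2.1 hw.2.2).symm)).unique
    hG1
  have e2 := (d2.congr_of_eventuallyEq (f₁ := fun w => w.2.1)
    (hnear.mono fun w hw => (h.coneAngle_conePt hw.1 hw.2.1 hw.2.2).symm)).unique
    (hasFDerivAt_fst.comp z hasFDerivAt_snd)
  have e3 := (d3.congr_of_eventuallyEq (f₁ := fun w => w.2.2)
    (hnear.mono fun w hw => (h.norm_conePt hw.1 _ hw.2.2.le).symm)).unique
    (hasFDerivAt_snd.comp z hasFDerivAt_snd)
  set L := shellDeriv (G p) (N (G p)) G' n' t 1 1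
  have hL : ∀ w, L w = 0 → w = 0 := fun w hw => by
    have a1 := congrArg (fun A => A w) e1
    have a2 := congrArg (fun A => A w) e2
    have a3 := congrArg (fun A => A w) e3
    simp only [ContinuousLinearMap.comp_apply, hw, map_zero, ContinuousLinearMap.coe_fst',
      ContinuousLinearMap.coe_snd'] at a1 a2 a3
    exact Prod.ext (hinj _ a1.symm) (Prod.ext a2.symm a3.symm)
  have hdet := det_shellDeriv (G p) (N (G p)) G' n' t 1 1
  have hne : (L.comp pairCoord).det ≠ 0 := by
    intro h0
    obtain ⟨v, hv, hv0⟩ := Submodule.exists_mem_ne_zero_of_ne_bot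
      (LinearMap.bot_lt_ker_of_det_eq_zero h0).ne'
    exact hv0 (pairCoordEquiv.injective (by
      change pairCoord v = pairCoord 0
      rw [map_zero]; exact hL _ hv))
  rw [hdet] at hne
  simpa using hne

/-! ### The two sides -/

/-- A component of an open part of the sphere is relatively open because the sphere is locally
connected: the radial projection of a small Euclidean ball is a connected patch missing `S`. -/
lemma rel_open {C : Set E4} (hC : ∃ x ∈ S3 \ S, C = connectedComponentIn (S3 \ S) x) {x : E4}
    (hx : x ∈ C) : ∃ δ > 0, S3 ∩ Metric.ball x δ ⊆ C := by
  obtain ⟨x₀, -, rfl⟩ := hC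
  have hxS := connectedComponentIn_subset _ _ hx
  rw [connectedComponentIn_eq hx]
  obtain ⟨r, hr0, hr⟩ := Metric.isOpen_iff.1 h.surf.isCompact.isClosed.isOpen_compl x hxS.2
  have hx1 : ‖x‖ = 1 := by simpa using hxS.1
  -- Radial projection moves a point of the ball by less than δ, whence r/2; the bound 1/2 keeps the
  -- ball away from the origin.
  set δ := min (r / 2) (1 / 2) with hδ
  have hδ0 : 0 < δ := by positivity
  have hne : ∀ y ∈ Metric.ball x δ, ‖y‖ ≠ 0 ∧ ‖‖y‖⁻¹ • y - y‖ < δ := fun y hy => by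
    have h1 : ‖y - x‖ < δ := by simpa [dist_eq_norm] using hy
    have h2 : |‖y‖ - 1| ≤ ‖y - x‖ := by rw [← hx1]; exact abs_norm_sub_norm_le y x
    have h3 : δ ≤ 1 / 2 := min_le_right _ _
    have h4 := abs_le.1 h2
    have hy0 : 0 < ‖y‖ := by linarith
    refine ⟨hy0.ne', ?_⟩
    have : ‖y‖⁻¹ • y - y = (‖y‖⁻¹ * (1 - ‖y‖)) • y := by
      rw [mul_sub, inv_mul_cancel₀ hy0.ne', mul_one, sub_smul, one_smul]
    rw [this, norm_smul, norm_mul, norm_inv, norm_norm, mul_comm, ← mul_assoc,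
      mul_inv_cancel₀ hy0.ne', one_mul, Real.norm_eq_abs, abs_sub_comm]
    linarith
  refine ⟨δ, hδ0, ?_⟩
  have hW : IsPreconnected ((fun y : E4 => ‖y‖⁻¹ • y) '' Metric.ball x δ) :=
    (convex_ball x δ).isPreconnected.image _ (contDiffOn_normalize.continuousOn.mono fun y hy =>
      norm_ne_zero_iff.1 (hne y hy).1)
  refine Subset.trans ?_ (hW.subset_connectedComponentIn ⟨x, Metric.mem_ball_self hδ0, by simp [hx1]⟩ ?_)
  · rintro y ⟨hy1, hy2⟩
    have : ‖y‖ = 1 := by simpa using hy1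
    exact ⟨y, hy2, by simp [this]⟩
  · rintro _ ⟨y, hy, rfl⟩
    obtain ⟨h1, h2⟩ := hne y hy
    refine ⟨by simp [norm_smul, h1], hr ?_⟩
    rw [Metric.mem_ball, dist_eq_norm] at hy ⊢
    calc ‖‖y‖⁻¹ • y - x‖ ≤ ‖‖y‖⁻¹ • y - y‖ + ‖y - x‖ := norm_sub_le_norm_sub_add_norm_sub _ _ _
      _ < δ + δ := add_lt_add h2 hy
      _ ≤ r := by have : δ ≤ r / 2 := min_le_left _ _; linarith

lemma comp_A : ∃ x ∈ S3 \ S, A = connectedComponentIn (S3 \ S) x := by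
  have : A ∈ ({A, A'} : Set (Set E4)) := by simp
  rw [← h.comp.2] at this; exact this

lemma comp_A' : ∃ x ∈ S3 \ S, A' = connectedComponentIn (S3 \ S) x := by
  have : A' ∈ ({A, A'} : Set (Set E4)) := by simp
  rw [← h.comp.2] at this; exact this

lemma mem_sides {v : E4} (hv : v ∈ S3 \ S) : v ∈ A ∨ v ∈ A' := by
  have : connectedComponentIn (S3 \ S) v ∈ ({A, A'} : Set (Set E4)) := by
    rw [← h.comp.2]; exact ⟨v, hv, rfl⟩
  have hm := mem_connectedComponentIn hv
  rcases this with h1 | h1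
  · left; rwa [h1] at hm
  · right; rwa [h1] at hm

lemma sides_subset : A ⊆ S3 \ S ∧ A' ⊆ S3 \ S := by
  obtain ⟨x, -, hx⟩ := h.comp_A
  obtain ⟨x', -, hx'⟩ := h.comp_A'
  exact ⟨hx ▸ connectedComponentIn_subset _ _, hx' ▸ connectedComponentIn_subset _ _⟩

lemma sides_disjoint {v : E4} (hv : v ∈ A) (hv' : v ∈ A') : False := by
  obtain ⟨x, -, hx⟩ := h.comp_A
  obtain ⟨x', -, hx'⟩ := h.comp_A'
  refine h.comp.1 ?_
  rw [hx] at hv ⊢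
  rw [hx'] at hv' ⊢
  rw [connectedComponentIn_eq hv, connectedComponentIn_eq hv']

lemma not_mem_of_ne {q : E4} (hq : q ∈ S) {t : ℝ} (ht : |t| < 3 * ε) (ht0 : t ≠ 0) :
    conePt N q t 1 ∈ S3 \ S := by
  refine ⟨by simp [h.norm_conePt hq t zero_le_one], fun hS => ht0 ?_⟩
  refine (h.conePt_injective hq hS ht (t' := 0) (by simpa using h.eps_pos) one_pos one_pos ?_).2.1
  conv_rhs => rw [conePt]
  simp

lemma isPreconnected_strip {a b : ℝ} (hab : Ioo a b ⊆ Ioo (-(3 * ε)) (3 * ε)) :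
    IsPreconnected ((fun x : E4 × ℝ => conePt N x.1 x.2 1) '' (S ×ˢ Ioo a b)) := by
  refine (h.surf.isConnected.isPreconnected.prod isPreconnected_Ioo).image _ ?_
  have hN : ContinuousOn (fun x : E4 × ℝ => N x.1) (S ×ˢ Ioo a b) :=
    h.contDiffOn_normal.continuousOn.comp continuousOn_fst fun x hx => hx.1
  refine (continuousOn_const (c := (1:ℝ))).smul (((Real.continuous_cos.comp continuous_snd).continuousOn.smul
    continuousOn_fst).add ((Real.continuous_sin.comp continuous_snd).continuousOn.smul hN))

/-- The open strip over 0 < t < 3ε is connected and misses `S`, and the normal direction brings some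
of its points into `A'`. -/
lemma mem_A'_of_pos {q : E4} (hq : q ∈ S) {t : ℝ} (ht0 : 0 < t) (ht : t < 3 * ε) :
    conePt N q t 1 ∈ A' := by
  have he := h.eps_pos
  have hsub : Ioo 0 (3 * ε) ⊆ Ioo (-(3 * ε)) (3 * ε) := Ioo_subset_Ioo_left (by linarith)
  have hev := (h.normal q hq).2.2.2
  obtain ⟨s, hs, hs0⟩ := (hev.and (Ioo_mem_nhdsGT (show (0:ℝ) < 3 * ε by linarith))).exists
  obtain ⟨x, -, hx⟩ := h.comp_A'
  have hs' : conePt N q s 1 ∈ A' := by simpa [conePt] using hs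
  rw [hx] at hs' ⊢
  rw [connectedComponentIn_eq hs']
  refine (h.isPreconnected_strip hsub).subset_connectedComponentIn ⟨(q, s), ⟨hq, hs0⟩, rfl⟩ ?_
    ⟨(q, t), ⟨hq, ht0, ht⟩, rfl⟩
  rintro _ ⟨⟨p, r⟩, ⟨hp, hr⟩, rfl⟩
  exact h.not_mem_of_ne hp (abs_lt.2 (hsub hr)) hr.1.ne'

lemma mem_coneDom_of_mem_nhds {p : E4} (hp : p ∈ S) :
    ∃ δ > 0, ∀ v ∈ S3 ∩ Metric.ball p δ, ∃ q ∈ S, ∃ t, |t| < 3 * ε ∧ v = conePt N q t 1 := by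
  have hpd : p ∈ coneDom S N ε := by
    have := h.conePt_mem_coneDom hp (t := 0) (by simpa using h.eps_pos) one_pos
    simpa [conePt] using this
  obtain ⟨δ, hδ, hsub⟩ := Metric.isOpen_iff.1 h.isOpen_coneDom p hpd
  refine ⟨δ, hδ, fun v hv => ?_⟩
  obtain ⟨h1, h2, h3⟩ := h.eq_of_mem_coneDom (hsub hv.2)
  have : ‖v‖ = 1 := by simpa using hv.1
  exact ⟨_, h1, _, h2, by rw [this] at h3; exact h3.symm⟩

/-- If a point on the negative side were in `A'`, both strips would lie in `A'` by connectedness.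
Then `A' ∪ S` would be relatively open, and together with `A` it would disconnect the sphere. -/
lemma mem_A_of_neg {q : E4} (hq : q ∈ S) {t : ℝ} (ht0 : t < 0) (ht : -(3 * ε) < t) :
    conePt N q t 1 ∈ A := by
  have he := h.eps_pos
  have hsub : Ioo (-(3 * ε)) 0 ⊆ Ioo (-(3 * ε)) (3 * ε) := Ioo_subset_Ioo_right (by linarith)
  refine (h.mem_sides (h.not_mem_of_ne hq (abs_lt.2 ⟨ht, by linarith⟩) ht0.ne)).resolve_right ?_
  intro hA'
  have hall : ∀ p ∈ S, ∀ r, |r| < 3 * ε → r ≠ 0 → conePt N p r 1 ∈ A' := by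
    intro p hp r hr hr0
    rw [abs_lt] at hr
    rcases lt_or_gt_of_ne hr0 with hneg | hpos
    · obtain ⟨x, -, hx⟩ := h.comp_A'
      rw [hx] at hA' ⊢
      rw [connectedComponentIn_eq hA']
      refine (h.isPreconnected_strip hsub).subset_connectedComponentIn ⟨(q, t), ⟨hq, ht, ht0⟩, rfl⟩
        ?_ ⟨(p, r), ⟨hp, hr.1, hneg⟩, rfl⟩
      rintro _ ⟨⟨p, r⟩, ⟨hp, hr⟩, rfl⟩
      exact h.not_mem_of_ne hp (abs_lt.2 (hsub hr)) hr.2.ne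
    · exact h.mem_A'_of_pos hp hpos hr.2
  -- then `A` and `A' ∪ S` would disconnect the sphere
  have hop : ∀ U : Set E4, (∀ x ∈ U, ∃ δ > 0, S3 ∩ Metric.ball x δ ⊆ U) →
      ∃ O, IsOpen O ∧ U ⊆ O ∧ S3 ∩ O ⊆ U := by
    intro U hU
    choose! δ hδ hsub using hU
    refine ⟨⋃ x ∈ U, Metric.ball x (δ x), isOpen_biUnion fun _ _ => Metric.isOpen_ball,
      fun x hx => mem_biUnion hx (Metric.mem_ball_self (hδ x hx)), ?_⟩
    rintro y ⟨hy, hyU⟩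
    obtain ⟨x, hx, hxy⟩ := mem_iUnion₂.1 hyU
    exact hsub x hx ⟨hy, hxy⟩
  obtain ⟨O₁, hO₁, hAO₁, hO₁A⟩ := hop A fun x hx => h.rel_open h.comp_A hx
  obtain ⟨O₂, hO₂, hAO₂, hO₂A⟩ := hop (A' ∪ S) fun x hx => by
    rcases hx with hx | hx
    · obtain ⟨δ, hδ, hsub⟩ := h.rel_open h.comp_A' hx
      exact ⟨δ, hδ, hsub.trans subset_union_left⟩
    · obtain ⟨δ, hδ, hsub⟩ := h.mem_coneDom_of_mem_nhds hx
      refine ⟨δ, hδ, fun v hv => ?_⟩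
      obtain ⟨p, hp, r, hr, rfl⟩ := hsub v hv
      by_cases hr0 : r = 0
      · right; simpa [hr0, conePt] using hp
      · left; exact hall p hp r hr hr0
  have hconn : IsPreconnected S3 := isPreconnected_sphere (by
    rw [← Module.finrank_eq_rank]; simp) 0 1
  obtain ⟨x, hx, hAx⟩ := h.comp_A
  have hxA : x ∈ A := hAx ▸ mem_connectedComponentIn hx
  obtain ⟨y, hy, hy1, hy2⟩ := hconn O₁ O₂ hO₁ hO₂ (fun v hv => by
    by_cases hvS : v ∈ S
    · exact Or.inr (hAO₂ (Or.inr hvS))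
    · rcases h.mem_sides ⟨hv, hvS⟩ with h1 | h1
      · exact Or.inl (hAO₁ h1)
      · exact Or.inr (hAO₂ (Or.inl h1))) ⟨x, hx.1, hAO₁ hxA⟩
    ⟨q, h.surf.subset_sphere hq, hAO₂ (Or.inr hq)⟩
  have hyA := hO₁A ⟨hy, hy1⟩
  rcases hO₂A ⟨hy, hy2⟩ with h1 | h1
  · exact h.sides_disjoint hyA h1
  · exact (h.sides_subset.1 hyA).2 h1

end TubularSurface

/-! ### Collar profiles and the twist map -/

/-- The profile `ψ` interpolates between `t` on the inner side of the collar and `t - π` on the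
outer side. -/
structure IsCollarProfile (ε : ℝ) (ψ : ℝ → ℝ) : Prop where
  eq_inner : ∀ t, -(3 * ε) < t → t ≤ -(2 * ε) → ψ t = t
  eq_outer : ∀ t, 2 * ε ≤ t → t < 3 * ε → ψ t = t - Real.pi

open Classical in
/-- The map, homogeneous of degree one, which is `id` on the cone over the side `A`, `-id` on the
cone over the side `A'`, and which turns the normal coordinate `t` into `ψ t` in the collar. -/
def twist (S A' : Set E4) (N : E4 → E4) (ε : ℝ) (ψ : ℝ → ℝ) (y : E4) : E4 :=
  if y ∈ coneDom S N ε then conePt N (coneFoot S N ε y) (ψ (coneAngle S N ε y)) ‖y‖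
  else if ‖y‖⁻¹ • y ∈ A' then -y else y

/-- The profile of the extended Gauss map. -/
def gaussProfile (ε : ℝ) (φ : ℝ → ℝ) (t : ℝ) : ℝ :=
  φ |t| * t - Real.pi / 2 - Real.arcsin (t / ε)

/-- A smooth profile. -/
def smoothProfile (ε : ℝ) (t : ℝ) : ℝ :=
  t - Real.pi * Real.smoothTransition ((t + ε) / (2 * ε))

lemma contDiff_smoothProfile (ε : ℝ) : ContDiff ℝ ∞ (smoothProfile ε) := by
  unfold smoothProfile
  exact contDiff_id.sub (contDiff_const.mul (Real.smoothTransition.contDiff.comp (by fun_prop)))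

lemma smoothProfile_of_le {ε t : ℝ} (hε : 0 < ε) (ht : t ≤ -ε) : smoothProfile ε t = t := by
  rw [smoothProfile, Real.smoothTransition.zero_of_nonpos, mul_zero, sub_zero]
  exact div_nonpos_of_nonpos_of_nonneg (by linarith) (by linarith)

lemma smoothProfile_of_ge {ε t : ℝ} (hε : 0 < ε) (ht : ε ≤ t) :
    smoothProfile ε t = t - Real.pi := by
  rw [smoothProfile, Real.smoothTransition.one_of_one_le, mul_one]
  rw [le_div_iff₀ (by linarith)]
  linarith

lemma isCollarProfile_smooth {ε : ℝ} (hε : 0 < ε) : IsCollarProfile ε (smoothProfile ε) where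
  eq_inner t _ ht := smoothProfile_of_le hε (by linarith)
  eq_outer t ht _ := smoothProfile_of_ge hε (by linarith)

/-- For |t| ≥ 2ε the cutoff is 1, and `Real.arcsin` is constantly ±π/2 outside [-1, 1]; so one
formula serves on the whole collar. -/
lemma isCollarProfile_gauss {ε : ℝ} (hε : 0 < ε) {φ : ℝ → ℝ} (hφ : IsCutoff ε φ) :
    IsCollarProfile ε (gaussProfile ε φ) where
  eq_inner t h1 h2 := by
    have : |t| = -t := abs_of_neg (by linarith)
    rw [gaussProfile, this, hφ.eq_one _ ⟨by linarith, by linarith⟩, Real.arcsin_of_le_neg_one]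
    · ring
    · rw [div_le_iff₀ hε]; linarith
  eq_outer t h1 h2 := by
    have : |t| = t := abs_of_pos (by linarith)
    rw [gaussProfile, this, hφ.eq_one _ ⟨by linarith, by linarith⟩, Real.arcsin_of_one_le]
    · ring
    · rw [le_div_iff₀ hε]; linarith

lemma continuousOn_gaussProfile {ε : ℝ} {φ : ℝ → ℝ} (hφ : IsCutoff ε φ) :
    ContinuousOn (gaussProfile ε φ) (Ioo (-(3 * ε)) (3 * ε)) := by
  have h1 : ContinuousOn (fun t : ℝ => φ |t|) (Ioo (-(3 * ε)) (3 * ε)) :=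
    hφ.contDiffOn.continuousOn.comp continuous_abs.continuousOn fun t ht =>
      ⟨abs_nonneg t, (abs_lt.2 ht).le⟩
  have h2 : Continuous fun t : ℝ => Real.arcsin (t / ε) :=
    Real.continuous_arcsin.comp (continuous_id.div_const _)
  exact ((h1.mul continuousOn_id).sub continuousOn_const).sub h2.continuousOn

/-- Write t = ε sin α. The slope is k = tan α, so the Gauss point is -sin α · q - cos α · N(q), the
point at angle -π/2 - α on the normal great circle. -/
lemma gaussPt_gaussSlope (N : E4 → E4) (q : E4) {ε : ℝ} (hε : 0 < ε) (t : ℝ) :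
    gaussPt N q (gaussSlope ε t) = conePt N q (-(Real.pi / 2) - Real.arcsin (t / ε)) 1 := by
  have hc : Real.cos (-(Real.pi / 2) - Real.arcsin (t / ε)) = - Real.sin (Real.arcsin (t / ε)) := by
    rw [show -(Real.pi / 2) - Real.arcsin (t / ε) = -(Real.arcsin (t / ε) + Real.pi / 2) by ring,
      Real.cos_neg, Real.cos_add_pi_div_two]
  have hs : Real.sin (-(Real.pi / 2) - Real.arcsin (t / ε)) = - Real.cos (Real.arcsin (t / ε)) := by
    rw [show -(Real.pi / 2) - Real.arcsin (t / ε) = -(Real.arcsin (t / ε) + Real.pi / 2) by ring,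
      Real.sin_neg, Real.sin_add_pi_div_two]
  rw [conePt, hc, hs, gaussSlope]
  split_ifs with h1 h2
  · rw [Real.arcsin_of_one_le (by rwa [le_div_iff₀ hε, one_mul])]
    change -q = _
    simp
  · rw [Real.arcsin_of_le_neg_one (by rw [div_le_iff₀ hε]; linarith)]
    change q = _
    simp
  · push Not at h1 h2
    have hpos : 0 < ε ^ 2 - t ^ 2 := by nlinarith
    have hr : 0 < √(ε ^ 2 - t ^ 2) := Real.sqrt_pos.2 hpos
    have hsq := Real.sq_sqrt hpos.le
    have h3 : √(1 + (t / √(ε ^ 2 - t ^ 2)) ^ 2) = ε / √(ε ^ 2 - t ^ 2) := by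
      rw [Real.sqrt_eq_iff_mul_self_eq (by positivity) (by positivity)]
      field_simp
      rw [hsq]; ring
    rw [Real.sin_arcsin (by rw [le_div_iff₀ hε]; linarith) (by rw [div_le_iff₀ hε]; linarith),
      Real.cos_arcsin]
    have h4 : √(1 - (t / ε) ^ 2) = √(ε ^ 2 - t ^ 2) / ε := by
      rw [Real.sqrt_eq_iff_mul_self_eq (by
        rw [sub_nonneg, div_pow, div_le_one (by positivity)]; nlinarith) (by positivity)]
      field_simp
      rw [hsq]
    change -(t / √(ε ^ 2 - t ^ 2) / √(1 + (t / √(ε ^ 2 - t ^ 2)) ^ 2)) • q -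
      (1 / √(1 + (t / √(ε ^ 2 - t ^ 2)) ^ 2)) • N q = _
    rw [h3, h4]
    have h5 : t / √(ε ^ 2 - t ^ 2) / (ε / √(ε ^ 2 - t ^ 2)) = t / ε := by field_simp
    have h6 : 1 / (ε / √(ε ^ 2 - t ^ 2)) = √(ε ^ 2 - t ^ 2) / ε := by field_simp
    rw [h5, h6, one_smul, neg_smul, neg_smul, ← sub_eq_add_neg]

namespace TubularSurface

variable {S A A' : Set E4} {N : E4 → E4} {ε : ℝ} (h : TubularSurface S A A' N ε)

include h

lemma normalize_mem_S3 {y : E4} (hy : y ≠ 0) : ‖y‖⁻¹ • y ∈ S3 := by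
  simp [norm_smul, norm_ne_zero_iff.2 hy]

lemma normalize_eq_conePt {y : E4} (hy : y ∈ coneDom S N ε) :
    ‖y‖⁻¹ • y = conePt N (coneFoot S N ε y) (coneAngle S N ε y) 1 := by
  have h3 := (h.eq_of_mem_coneDom hy).2.2
  conv_lhs => rw [← h3, h.norm_conePt (h.eq_of_mem_coneDom hy).1 _ (norm_nonneg _)]
  rw [conePt, smul_smul, inv_mul_cancel₀ (norm_ne_zero_iff.2 hy.1), conePt]

/-- The part of the tube over `[-2ε, 2ε]`. -/
lemma isClosed_core :
    IsClosed ((fun x : E4 × ℝ => conePt N x.1 x.2 1) '' (S ×ˢ Icc (-(2 * ε)) (2 * ε))) := by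
  refine (IsCompact.image_of_continuousOn (h.surf.isCompact.prod isCompact_Icc) ?_).isClosed
  have hN : ContinuousOn (fun x : E4 × ℝ => N x.1) (S ×ˢ Icc (-(2 * ε)) (2 * ε)) :=
    h.contDiffOn_normal.continuousOn.comp continuousOn_fst fun x hx => hx.1
  refine (continuousOn_const (c := (1:ℝ))).smul (((Real.continuous_cos.comp continuous_snd).continuousOn.smul
    continuousOn_fst).add ((Real.continuous_sin.comp continuous_snd).continuousOn.smul hN))

/-- The part of the tube with |t| ≤ 2ε is closed, hence away from a direction outside the tube. A
nearby ray can enter the tube only where all collar profiles are already standard. -/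
lemma eventually_side {C : Set E4} (hC : ∃ x ∈ S3 \ S, C = connectedComponentIn (S3 \ S) x)
    {y₀ : E4} (hy₀ : y₀ ≠ 0) (hd : y₀ ∉ coneDom S N ε) (hside : ‖y₀‖⁻¹ • y₀ ∈ C) :
    ∀ᶠ y in 𝓝 y₀, y ≠ 0 ∧ ‖y‖⁻¹ • y ∈ C ∧ (y ∈ coneDom S N ε → 2 * ε < |coneAngle S N ε y|) := by
  have hc : ContinuousAt (fun y : E4 => ‖y‖⁻¹ • y) y₀ :=
    (contDiffOn_normalize.contDiffAt (isOpen_ne.mem_nhds hy₀)).continuousAt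
  obtain ⟨δ, hδ, hsub⟩ := h.rel_open hC hside
  have h1 := hc.eventually (Metric.ball_mem_nhds _ hδ)
  have h2 := hc.eventually (h.isClosed_core.isOpen_compl.mem_nhds (fun hm => hd ⟨hy₀, by
    obtain ⟨⟨q, t⟩, ⟨hq, ht⟩, hqt⟩ := hm
    have hqt' : conePt N q t 1 = ‖y₀‖⁻¹ • y₀ := hqt
    rw [← hqt']
    have := h.conePt_mem_coneDom hq (t := t) (by
      rw [abs_lt]; have := h.eps_pos; exact ⟨by linarith [ht.1], by linarith [ht.2]⟩) one_pos
    simpa [h.norm_conePt hq t zero_le_one] using this.2⟩))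
  filter_upwards [h1, h2, isOpen_ne.mem_nhds hy₀] with y k1 k2 k3
  refine ⟨k3, hsub ⟨h.normalize_mem_S3 k3, k1⟩, fun hy => ?_⟩
  by_contra! hle
  refine k2 ⟨(coneFoot S N ε y, coneAngle S N ε y), ⟨(h.eq_of_mem_coneDom hy).1, abs_le.1 hle⟩, ?_⟩
  exact (h.normalize_eq_conePt hy).symm

/-- Away from the tube, `twist` is locally `id` or `-id`. -/
lemma eventually_twist {y₀ : E4} (hy₀ : y₀ ≠ 0) (hd : y₀ ∉ coneDom S N ε) :
    ∃ σ : ℝ, ∀ᶠ y in 𝓝 y₀, ∀ ψ, IsCollarProfile ε ψ → twist S A' N ε ψ y = σ • y := by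
  have hS : ‖y₀‖⁻¹ • y₀ ∉ S := fun hS => hd ⟨hy₀, by
    have := h.conePt_mem_coneDom hS (t := 0) (by simpa using h.eps_pos) one_pos
    rw [show conePt N (‖y₀‖⁻¹ • y₀) 0 1 = ‖y₀‖⁻¹ • y₀ by simp [conePt]] at this
    have h2 := this.2
    rwa [h.norm_eq_one hS, inv_one, one_smul] at h2⟩
  -- The sign is 1 over `A` and -1 over `A'`. It and the neighbourhood are chosen before the
  -- profile, as needed for continuity in a family of profiles.
  rcases h.mem_sides ⟨h.normalize_mem_S3 hy₀, hS⟩ with hA | hA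
  · refine ⟨1, (h.eventually_side h.comp_A hy₀ hd hA).mono fun y hy ψ hψ => ?_⟩
    obtain ⟨-, hyA, hy2⟩ := hy
    rw [one_smul, twist]
    split_ifs with h1 h2
    · obtain ⟨k1, k2, k3⟩ := h.eq_of_mem_coneDom h1
      have hneg : ¬ 0 < coneAngle S N ε y := fun hpos => by
        rw [h.normalize_eq_conePt h1] at hyA
        exact h.sides_disjoint hyA (h.mem_A'_of_pos k1 hpos (abs_lt.1 k2).2)
      have h5 := hy2 h1
      rw [abs_of_nonpos (not_lt.1 hneg)] at h5
      rw [hψ.eq_inner _ (abs_lt.1 k2).1 (by linarith), k3]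
    · exact (h.sides_disjoint hyA h2).elim
    · rfl
  · refine ⟨-1, (h.eventually_side h.comp_A' hy₀ hd hA).mono fun y hy ψ hψ => ?_⟩
    obtain ⟨-, hyA, hy2⟩ := hy
    rw [neg_one_smul, twist]
    split_ifs with h1
    · obtain ⟨k1, k2, k3⟩ := h.eq_of_mem_coneDom h1
      have h5 := hy2 h1
      have he := h.eps_pos
      have hneg : ¬ coneAngle S N ε y ≤ 0 := fun hpos => by
        rw [h.normalize_eq_conePt h1] at hyA
        have h0 : coneAngle S N ε y ≠ 0 := fun h0 => by rw [h0, abs_zero] at h5; linarith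
        exact h.sides_disjoint (h.mem_A_of_neg k1 (lt_of_le_of_ne hpos h0) (abs_lt.1 k2).1) hyA
      rw [abs_of_pos (not_le.1 hneg)] at h5
      rw [hψ.eq_outer _ (by linarith) (abs_lt.1 k2).2]
      conv_rhs => rw [← k3]
      simp only [conePt, Real.cos_sub_pi, Real.sin_sub_pi, neg_smul, ← neg_add, smul_neg]
    · rfl

/-- `twist` depends continuously on the point and on the profile. -/
lemma continuousOn_twist {X : Type*} [TopologicalSpace X] {Ψ : X → ℝ → ℝ}
    (hΨ : ∀ x, IsCollarProfile ε (Ψ x))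
    (hc : ContinuousOn (fun z : X × ℝ => Ψ z.1 z.2) (univ ×ˢ Ioo (-(3 * ε)) (3 * ε))) :
    ContinuousOn (fun z : X × E4 => twist S A' N ε (Ψ z.1) z.2) (univ ×ˢ {y | y ≠ 0}) := by
  rintro ⟨x₀, y₀⟩ ⟨-, hy₀⟩
  refine ContinuousAt.continuousWithinAt ?_
  by_cases hd : y₀ ∈ coneDom S N ε
  · have hU : (univ : Set X) ×ˢ coneDom S N ε ∈ 𝓝 (x₀, y₀) :=
      (isOpen_univ.prod h.isOpen_coneDom).mem_nhds ⟨trivial, hd⟩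
    have c1 : ContinuousOn (fun z : X × E4 => coneFoot S N ε z.2) (univ ×ˢ coneDom S N ε) :=
      h.contDiffOn_coneFoot.continuousOn.comp continuousOn_snd fun z hz => hz.2
    have c2 : ContinuousOn (fun z : X × E4 => coneAngle S N ε z.2) (univ ×ˢ coneDom S N ε) :=
      h.contDiffOn_coneAngle.continuousOn.comp continuousOn_snd fun z hz => hz.2
    have c3 : ContinuousOn (fun z : X × E4 => N (coneFoot S N ε z.2)) (univ ×ˢ coneDom S N ε) :=
      h.contDiffOn_normal.continuousOn.comp c1 fun z hz => (h.eq_of_mem_coneDom hz.2).1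
    have c4 : ContinuousOn (fun z : X × E4 => Ψ z.1 (coneAngle S N ε z.2))
        (univ ×ˢ coneDom S N ε) :=
      hc.comp (f := fun z : X × E4 => (z.1, coneAngle S N ε z.2)) (continuousOn_fst.prodMk c2)
        fun z hz => ⟨trivial, abs_lt.1 (h.eq_of_mem_coneDom hz.2).2.1⟩
    have c5 : ContinuousOn (fun z : X × E4 => conePt N (coneFoot S N ε z.2)
        (Ψ z.1 (coneAngle S N ε z.2)) ‖z.2‖) (univ ×ˢ coneDom S N ε) :=
      continuousOn_snd.norm.smul (((Real.continuous_cos.comp_continuousOn c4).smul c1).add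
        ((Real.continuous_sin.comp_continuousOn c4).smul c3))
    refine (c5.continuousAt hU).congr ?_
    filter_upwards [hU] with z hz
    rw [twist, if_pos hz.2]
  · obtain ⟨σ, hσ⟩ := h.eventually_twist hy₀ hd
    have : ContinuousAt (fun z : X × E4 => σ • z.2) (x₀, y₀) := by fun_prop
    refine this.congr ?_
    filter_upwards [continuousAt_snd.eventually hσ] with z hz
    exact (hz _ (hΨ z.1)).symm

lemma contDiffOn_twist {ψ : ℝ → ℝ} (hψ : IsCollarProfile ε ψ) (hc : ContDiff ℝ ∞ ψ) :
    ContDiffOn ℝ ∞ (twist S A' N ε ψ) {y | y ≠ 0} := by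
  intro y₀ hy₀
  refine ContDiffAt.contDiffWithinAt ?_
  by_cases hd : y₀ ∈ coneDom S N ε
  · have hU := h.isOpen_coneDom.mem_nhds hd
    have c1 := h.contDiffOn_coneFoot
    have c3 : ContDiffOn ℝ ∞ (fun z : E4 => N (coneFoot S N ε z)) (coneDom S N ε) :=
      h.contDiffOn_normal.comp c1 fun z hz => (h.eq_of_mem_coneDom hz).1
    have c4 : ContDiffOn ℝ ∞ (fun z : E4 => ψ (coneAngle S N ε z)) (coneDom S N ε) :=
      hc.comp_contDiffOn h.contDiffOn_coneAngle
    have c5 : ContDiffOn ℝ ∞ (fun z : E4 => conePt N (coneFoot S N ε z)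
        (ψ (coneAngle S N ε z)) ‖z‖) (coneDom S N ε) :=
      (contDiffOn_id.norm ℝ fun z hz => hz.1).smul
        (((Real.contDiff_cos.comp_contDiffOn c4).smul c1).add
        ((Real.contDiff_sin.comp_contDiffOn c4).smul c3))
    refine (c5.contDiffAt hU).congr_of_eventuallyEq ?_
    filter_upwards [hU] with z hz
    rw [twist, if_pos hz]
  · obtain ⟨σ, hσ⟩ := h.eventually_twist hy₀ hd
    exact (contDiffAt_id.const_smul σ).congr_of_eventuallyEq (hσ.mono fun y hy => hy ψ hψ)

lemma norm_twist (ψ : ℝ → ℝ) (y : E4) : ‖twist S A' N ε ψ y‖ = ‖y‖ := by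
  rw [twist]
  split_ifs with h1
  · exact h.norm_conePt (h.eq_of_mem_coneDom h1).1 _ (norm_nonneg y)
  · exact norm_neg y
  · rfl

lemma smul_twist_normalize (ψ : ℝ → ℝ) {y : E4} (hy : y ≠ 0) :
    ‖y‖ • twist S A' N ε ψ (‖y‖⁻¹ • y) = twist S A' N ε ψ y := by
  have hn := norm_ne_zero_iff.2 hy
  have h1 : ‖‖y‖⁻¹ • y‖ = 1 := by simp [norm_smul, hn]
  have h2 : ‖‖y‖⁻¹ • y‖⁻¹ • (‖y‖⁻¹ • y) = ‖y‖⁻¹ • y := by rw [h1, inv_one, one_smul]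
  have h3 : ‖y‖⁻¹ • y ∈ coneDom S N ε ↔ y ∈ coneDom S N ε := by
    simp only [coneDom, mem_ofPred_eq, h2]
    simp [hy]
  have h4 : coneFoot S N ε (‖y‖⁻¹ • y) = coneFoot S N ε y := by rw [coneFoot, h2, coneFoot]
  have h5 : coneAngle S N ε (‖y‖⁻¹ • y) = coneAngle S N ε y := by rw [coneAngle, h2, coneAngle]
  by_cases hd : y ∈ coneDom S N ε
  · rw [twist, twist, if_pos (h3.2 hd), if_pos hd, h4, h5, h1, conePt, conePt, one_smul]
  · rw [twist, twist, if_neg (mt h3.1 hd), if_neg hd, h2]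
    split_ifs
    · rw [smul_neg, smul_smul, mul_inv_cancel₀ hn, one_smul]
    · rw [smul_smul, mul_inv_cancel₀ hn, one_smul]

lemma twist_conePt {q : E4} (hq : q ∈ S) {t ρ : ℝ} (ht : |t| < 3 * ε) (hρ : 0 < ρ) (ψ : ℝ → ℝ) :
    twist S A' N ε ψ (conePt N q t ρ) = conePt N q (ψ t) ρ := by
  rw [twist, if_pos (h.conePt_mem_coneDom hq ht hρ), h.coneFoot_conePt hq ht hρ,
    h.coneAngle_conePt hq ht hρ, h.norm_conePt hq t hρ.le]

/-- Away from the core of the collar, `twist` is `id` or `-id` near each point. -/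
lemma eventually_twist_smooth {y : E4} (hy : y ≠ 0)
    (hn : ∀ q ∈ S, ∀ t, |t| ≤ ε → ∀ ρ > 0, y ≠ conePt N q t ρ) :
    ∃ σ : ℝ, σ ^ 2 = 1 ∧ twist S A' N ε (smoothProfile ε) =ᶠ[𝓝 y] fun z => σ • z := by
  have he := h.eps_pos
  by_cases hd : y ∈ coneDom S N ε
  · obtain ⟨k1, k2, k3⟩ := h.eq_of_mem_coneDom hd
    have hlt : ε < |coneAngle S N ε y| := by
      by_contra! hle
      exact hn _ k1 _ hle _ (norm_pos_iff.2 hy) k3.symm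
    have hU := h.isOpen_coneDom.mem_nhds hd
    have hcont := (h.contDiffOn_coneAngle.contDiffAt hU).continuousAt
    rcases lt_abs.1 hlt with hpos | hneg
    · refine ⟨-1, by norm_num, ?_⟩
      filter_upwards [hU, hcont.eventually_const_lt hpos] with z hz hz2
      rw [twist, if_pos hz, smoothProfile_of_ge he hz2.le]
      conv_rhs => rw [← (h.eq_of_mem_coneDom hz).2.2]
      simp only [conePt, Real.cos_sub_pi, Real.sin_sub_pi, neg_smul, ← neg_add, smul_neg, one_smul]
    · refine ⟨1, by norm_num, ?_⟩
      filter_upwards [hU, hcont.eventually_lt_const (show coneAngle S N ε y < -ε by linarith)]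
        with z hz hz2
      rw [twist, if_pos hz, smoothProfile_of_le he hz2.le, (h.eq_of_mem_coneDom hz).2.2, one_smul]
  · obtain ⟨σ, hσ⟩ := h.eventually_twist hy hd
    refine ⟨σ, ?_, hσ.mono fun z hz => hz _ (isCollarProfile_smooth he)⟩
    have h1 := hσ.self_of_nhds _ (isCollarProfile_smooth he)
    have h2 := h.norm_twist (smoothProfile ε) y
    rw [h1, norm_smul] at h2
    have h3 : ‖σ‖ = 1 := by
      have := norm_pos_iff.2 hy
      exact (mul_eq_right₀ this.ne').1 h2
    rw [← sq_abs, ← Real.norm_eq_abs, h3, one_pow]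

/-! ### The extended Gauss map -/

/-- The closed half disc of radius ε is compact and stays inside the domain of `Λ`, so the image on
the right is closed. -/
lemma closure_tube_subset :
    closure (tube S N ε) ⊆ tubeMap N '' (S ×ˢ {s | ‖s‖ ≤ ε ∧ 0 ≤ s 0}) := by
  have he := h.eps_pos
  have hk : IsCompact {s : E2 | ‖s‖ ≤ ε ∧ 0 ≤ s 0} := by
    refine (isCompact_closedBall (0 : E2) ε).of_isClosed_subset
      ((isClosed_le continuous_norm continuous_const).inter (isClosed_le continuous_const
        (EuclideanSpace.proj (𝕜 := ℝ) (0 : Fin 2)).continuous)) fun s hs => by simpa using hs.1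
  refine closure_minimal (image_mono (Set.prod_mono_right fun s hs => ⟨hs.1.le, hs.2⟩))
    (IsCompact.image_of_continuousOn (h.surf.isCompact.prod hk)
      (h.tubular.contDiffOn.continuousOn.mono ?_)).isClosed
  exact Set.prod_mono_right fun s hs => ⟨by linarith [hs.1], hs.2⟩

lemma extGauss_of_mem_closure (φ : ℝ → ℝ) {v : E4} (hv : v ∈ closure (tube S N ε)) :
    extGauss S A A' N ε φ v = conePt N (tubeInv S N (3 * ε) v).1
      (-(Real.pi / 2) - Real.arcsin ((tubeInv S N (3 * ε) v).2 1 / ε)) 1 := by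
  rw [extGauss, if_pos hv]
  exact gaussPt_gaussSlope N _ h.eps_pos _

lemma closure_tube_subset_tube : closure (tube S N ε) ⊆ tube S N (3 * ε) :=
  h.closure_tube_subset.trans (image_mono (Set.prod_mono_right fun s hs =>
    ⟨by linarith [hs.1, h.eps_pos], hs.2⟩))

lemma tubeInv_mem {v : E4} (hv : v ∈ tube S N (3 * ε)) : (tubeInv S N (3 * ε) v).1 ∈ S :=
  (Function.invFunOn_mem (f := tubeMap N) hv).1

lemma continuousOn_extGauss_closure (φ : ℝ → ℝ) :
    ContinuousOn (extGauss S A A' N ε φ) (closure (tube S N ε)) := by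
  have hc := h.tubular.contDiffOn_inv.continuousOn.mono h.closure_tube_subset_tube
  have c1 : ContinuousOn (fun v => (tubeInv S N (3 * ε) v).1) (closure (tube S N ε)) :=
    continuousOn_fst.comp hc fun _ _ => mem_univ _
  have c2 : ContinuousOn (fun v => (tubeInv S N (3 * ε) v).2 1) (closure (tube S N ε)) :=
    (EuclideanSpace.proj (𝕜 := ℝ) (1 : Fin 2)).continuous.comp_continuousOn
      (continuousOn_snd.comp hc fun _ _ => mem_univ _)
  have c3 : ContinuousOn (fun v => N (tubeInv S N (3 * ε) v).1) (closure (tube S N ε)) :=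
    h.contDiffOn_normal.continuousOn.comp c1 fun v hv =>
      h.tubeInv_mem (h.closure_tube_subset_tube hv)
  have c4 : ContinuousOn (fun v => -(Real.pi / 2) -
      Real.arcsin ((tubeInv S N (3 * ε) v).2 1 / ε)) (closure (tube S N ε)) :=
    continuousOn_const.sub (Real.continuous_arcsin.comp_continuousOn (c2.div_const _))
  refine ContinuousOn.congr ?_ fun v hv => h.extGauss_of_mem_closure φ hv
  exact (continuousOn_const (c := (1:ℝ))).smul (((Real.continuous_cos.comp_continuousOn c4).smul
    c1).add ((Real.continuous_sin.comp_continuousOn c4).smul c3))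

lemma tube_cases {v : E4} (hv : v ∈ S3) : v ∈ tube S N (3 * ε) ↔ v ∈ coneDom S N ε := by
  have hv1 : ‖v‖ = 1 := by simpa using hv
  have : v ≠ 0 := by rintro rfl; simp at hv1
  simp [coneDom, hv1, this]

/-- On the closure of Ω_ε the cutoff vanishes and `gaussPt_gaussSlope` applies. For ε ≤ |t| < 3ε the
arcsine is ±π/2, so the profile is the collapsed coordinate on the side `A` and that minus π on the
side `A'`; subtracting π from the angle is multiplication by -1. Elsewhere `collapse` is the
identity. -/
lemma extGauss_eq_twist {φ : ℝ → ℝ} (hφ : IsCutoff ε φ) {v : E4} (hv : v ∈ S3) :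
    extGauss S A A' N ε φ v = twist S A' N ε (gaussProfile ε φ) v := by
  have he := h.eps_pos
  have hv1 : ‖v‖ = 1 := by simpa using hv
  have hvn : ‖v‖⁻¹ • v = v := by rw [hv1, inv_one, one_smul]
  have hφ0 : φ 0 = 0 := hφ.eq_zero 0 ⟨le_rfl, he.le⟩
  have hφε : ∀ t, |t| ≤ ε → φ |t| = 0 := fun t ht => hφ.eq_zero _ ⟨abs_nonneg t, ht⟩
  by_cases hcl : v ∈ closure (tube S N ε)
  · rw [h.extGauss_of_mem_closure φ hcl]
    obtain ⟨⟨q, s⟩, ⟨hq, hs⟩, hqs⟩ := h.closure_tube_subset hcl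
    simp only at hq
    have hs' : s ∈ halfDisc (3 * ε) := ⟨by linarith [hs.1], hs.2⟩
    have h0 := h.fst_eq_zero hq hs' (by rw [hqs, hv1])
    have hi : tubeInv S N (3 * ε) v = (q, s) := by rw [← hqs, h.tubeInv_eq hq hs']
    have hvc : v = conePt N q (s 1) 1 := by
      rw [← hqs, tubeMap, conePt]; simp [h0]
    have hs1 := (abs_apply_le_norm_E2 s 1).trans hs.1
    rw [hi, hvc, h.twist_conePt hq (by linarith) one_pos, gaussProfile, hφε _ hs1]
    congr 1
    ring
  · rw [extGauss, if_neg hcl]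
    by_cases hd : v ∈ coneDom S N ε
    · obtain ⟨k1, k2, k3⟩ := h.eq_of_mem_coneDom hd
      set q := coneFoot S N ε v
      set t := coneAngle S N ε v
      rw [hv1] at k3
      have htm : tubeMap N (q, !₂[0, t]) = v := by rw [h.tubeMap_zero, ← k3, conePt, one_smul]
      have hlt : ε ≤ |t| := by
        by_contra! hlt
        refine hcl (subset_closure ⟨(q, !₂[0, t]), ⟨k1, ?_, by simp⟩, htm⟩)
        rwa [norm_E2_zero]
      have hcol : collapse S N ε φ v = conePt N q (φ |t| * t) 1 := by
        have hi : tubeInv S N (3 * ε) v = (q, !₂[0, t]) := by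
          rw [← htm, h.tubeInv_eq k1 (h.mem_halfDisc k2)]
        rw [collapse, if_pos ((h.tube_cases hv).2 hd)]
        simp only [hi, norm_E2_zero]
        rw [tubeMap, conePt]
        simp
      have htw : twist S A' N ε (gaussProfile ε φ) v = conePt N q (gaussProfile ε φ t) 1 := by
        rw [twist, if_pos hd, hv1]
      rw [htw, hcol]
      rcases le_abs.1 hlt with hpos | hneg
      · have hA' : v ∈ A' := k3 ▸ h.mem_A'_of_pos k1 (by linarith) (abs_lt.1 k2).2
        rw [if_pos hA', gaussProfile, Real.arcsin_of_one_le (by rwa [le_div_iff₀ he, one_mul])]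
        rw [show φ |t| * t - Real.pi / 2 - Real.pi / 2 = φ |t| * t - Real.pi by ring]
        simp only [conePt, Real.cos_sub_pi, Real.sin_sub_pi, neg_smul, ← neg_add, smul_neg]
      · have hA : v ∈ A := k3 ▸ h.mem_A_of_neg k1 (by linarith) (abs_lt.1 k2).1
        rw [if_neg fun hA' => h.sides_disjoint hA hA', if_pos hA, gaussProfile,
          Real.arcsin_of_le_neg_one (by rw [div_le_iff₀ he]; linarith)]
        congr 1
        ring
    · have hS : v ∉ S := fun hS => hd (by
        have := h.conePt_mem_coneDom hS (t := 0) (by simpa using h.eps_pos) one_pos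
        simpa [conePt] using this)
      have hcol : collapse S N ε φ v = v := by
        rw [collapse, if_neg fun ht => hd ((h.tube_cases hv).1 ht)]
      rw [hcol, twist, if_neg hd, hvn]
      split_ifs with h1 h2
      · rfl
      · rfl
      · exact ((h.mem_sides ⟨hv, hS⟩).elim h2 h1).elim

theorem mapsTo_extGauss {φ : ℝ → ℝ} (hφ : IsCutoff ε φ) :
    MapsTo (extGauss S A A' N ε φ) (S3 ∪ closure (tube S N ε)) S3 := by
  rintro v (hv | hv)
  · rw [h.extGauss_eq_twist hφ hv]
    simpa [h.norm_twist] using hv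
  · rw [h.extGauss_of_mem_closure φ hv]
    simpa using h.norm_conePt (h.tubeInv_mem (h.closure_tube_subset_tube hv)) _ zero_le_one

lemma continuousOn_twist_sphere {ψ : ℝ → ℝ} (hψ : IsCollarProfile ε ψ)
    (hc : ContinuousOn ψ (Ioo (-(3 * ε)) (3 * ε))) : ContinuousOn (twist S A' N ε ψ) S3 := by
  have := h.continuousOn_twist (X := Unit) (Ψ := fun _ => ψ) (fun _ => hψ)
    (hc.comp continuousOn_snd fun z hz => hz.2)
  refine this.comp (f := fun v => ((), v)) (by fun_prop) fun v hv => ⟨trivial, ?_⟩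
  rintro rfl
  simp at hv

/-- The sphere and the closed tube are closed pieces with a continuous formula on each. -/
theorem continuousOn_extGauss {φ : ℝ → ℝ} (hφ : IsCutoff ε φ) :
    ContinuousOn (extGauss S A A' N ε φ) (S3 ∪ closure (tube S N ε)) := by
  refine ContinuousOn.union_of_isClosed ?_ (h.continuousOn_extGauss_closure φ)
    Metric.isClosed_sphere isClosed_closure
  exact (h.continuousOn_twist_sphere (isCollarProfile_gauss h.eps_pos hφ)
    (continuousOn_gaussProfile hφ)).congr fun v hv => h.extGauss_eq_twist hφ hv

lemma twist_mem_S3 (ψ : ℝ → ℝ) (v : S3) : twist S A' N ε ψ v ∈ S3 := by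
  have := v.2; simpa [h.norm_twist] using this

lemma continuous_twist_sphere {ψ : ℝ → ℝ} (hψ : IsCollarProfile ε ψ)
    (hc : ContinuousOn ψ (Ioo (-(3 * ε)) (3 * ε))) :
    Continuous fun v : S3 => (⟨twist S A' N ε ψ v, h.twist_mem_S3 ψ v⟩ : S3) :=
  ((h.continuousOn_twist_sphere hψ hc).comp_continuous continuous_subtype_val
    fun v => v.2).subtype_mk _

/-- `twist` as a self-map of the sphere. -/
def twistMap {ψ : ℝ → ℝ} (hψ : IsCollarProfile ε ψ)
    (hc : ContinuousOn ψ (Ioo (-(3 * ε)) (3 * ε))) : C(S3, S3) :=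
  ⟨fun v => ⟨twist S A' N ε ψ v, h.twist_mem_S3 ψ v⟩, h.continuous_twist_sphere hψ hc⟩

/-- Collar profiles with given ends form a convex set, and `twist` is jointly continuous in the
point and the profile. -/
lemma twistMap_homotopic {ψ₀ ψ₁ : ℝ → ℝ} (hψ₀ : IsCollarProfile ε ψ₀)
    (hc₀ : ContinuousOn ψ₀ (Ioo (-(3 * ε)) (3 * ε))) (hψ₁ : IsCollarProfile ε ψ₁)
    (hc₁ : ContinuousOn ψ₁ (Ioo (-(3 * ε)) (3 * ε))) :
    (h.twistMap hψ₀ hc₀).Homotopic (h.twistMap hψ₁ hc₁) := by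
  let Ψ : unitInterval → ℝ → ℝ := fun τ t => (1 - τ) * ψ₀ t + τ * ψ₁ t
  have hΨ : ∀ τ, IsCollarProfile ε (Ψ τ) := fun τ =>
    ⟨fun t h1 h2 => by simp only [Ψ, hψ₀.eq_inner t h1 h2, hψ₁.eq_inner t h1 h2]; ring,
      fun t h1 h2 => by simp only [Ψ, hψ₀.eq_outer t h1 h2, hψ₁.eq_outer t h1 h2]; ring⟩
  have hcΨ : ContinuousOn (fun z : unitInterval × ℝ => Ψ z.1 z.2)
      (univ ×ˢ Ioo (-(3 * ε)) (3 * ε)) := by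
    have c0 : ContinuousOn (fun z : unitInterval × ℝ => ψ₀ z.2)
      (univ ×ˢ Ioo (-(3 * ε)) (3 * ε)) := hc₀.comp continuousOn_snd fun z hz => hz.2
    have c1 : ContinuousOn (fun z : unitInterval × ℝ => ψ₁ z.2)
      (univ ×ˢ Ioo (-(3 * ε)) (3 * ε)) := hc₁.comp continuousOn_snd fun z hz => hz.2
    have cτ : ContinuousOn (fun z : unitInterval × ℝ => (z.1 : ℝ))
      (univ ×ˢ Ioo (-(3 * ε)) (3 * ε)) :=
      (continuous_subtype_val.comp continuous_fst).continuousOn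
    exact ((continuousOn_const.sub cτ).mul c0).add (cτ.mul c1)
  have hcont := h.continuousOn_twist hΨ hcΨ
  refine ⟨⟨⟨fun z => ⟨twist S A' N ε (Ψ z.1) z.2, ?_⟩, ?_⟩, ?_, ?_⟩⟩
  · have := z.2.2; simpa [h.norm_twist] using this
  · refine Continuous.subtype_mk (hcont.comp_continuous
      (f := fun z : unitInterval × S3 => (z.1, (z.2 : E4))) (by fun_prop) fun z => ⟨trivial, ?_⟩) _
    exact ne_zero_of_mem_unit_sphere z.2
  · intro v
    ext1
    simp [twistMap, Ψ]
  · intro v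
    ext1
    simp [twistMap, Ψ]

lemma radialExt_twistMap {ψ : ℝ → ℝ} (hψ : IsCollarProfile ε ψ)
    (hc : ContinuousOn ψ (Ioo (-(3 * ε)) (3 * ε))) {y : E4} (hy : y ≠ 0) :
    radialExt (h.twistMap hψ hc) y = twist S A' N ε ψ y := by
  rw [radialExt, dif_neg hy]
  exact h.smul_twist_normalize ψ hy

lemma contMDiff_twistMap {ψ : ℝ → ℝ} (hψ : IsCollarProfile ε ψ) (hs : ContDiff ℝ ∞ ψ) :
    ContMDiff (𝓡 3) (𝓡 3) ∞ (h.twistMap hψ hs.continuous.continuousOn) := by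
  have h1 : ContMDiff (𝓡 3) 𝓘(ℝ, E4) ∞ (fun v : S3 => twist S A' N ε ψ v) := fun v => by
    have hv : (v : E4) ∈ {y : E4 | y ≠ 0} := ne_zero_of_mem_unit_sphere v
    have := ((h.contDiffOn_twist hψ hs).contDiffAt (isOpen_ne.mem_nhds hv)).contMDiffAt
    exact this.comp v (contMDiff_coe_sphere v)
  exact h1.codRestrict_sphere (fun v => by have := v.2; simpa [h.norm_twist] using this)

end TubularSurface

/-! ### Simplices of the triangulation and their orientation -/

/-- The affine parametrization of a triangle by the standard triangle. -/
def triPt {V : Type*} [AddCommGroup V] [Module ℝ V] (a b c : V) (u : ℝ × ℝ) : V :=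
  a + (u.1 • (b - a) + u.2 • (c - a))

lemma mem_convexHull_triple {V : Type*} [AddCommGroup V] [Module ℝ V] {a b c x : V}
    [DecidableEq V] (hab : a ≠ b) (hac : a ≠ c) (hbc : b ≠ c) :
    x ∈ convexHull ℝ (({a, b, c} : Finset V) : Set V) ↔ ∃ u ∈ stdTri, triPt a b c u = x := by
  rw [Finset.mem_convexHull']
  constructor
  · rintro ⟨w, hw, hw1, rfl⟩
    rw [Finset.sum_insert (by simp [hab, hac]), Finset.sum_pair hbc] at hw1 ⊢
    refine ⟨(w b, w c), ⟨hw b (by simp), hw c (by simp), ?_⟩, ?_⟩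
    · have := hw a (by simp); simp only; linarith
    · have : w a = 1 - w b - w c := by linarith
      simp only [triPt, this]
      module
  · rintro ⟨u, ⟨h1, h2, h3⟩, rfl⟩
    refine ⟨fun y => if y = a then 1 - u.1 - u.2 else if y = b then u.1 else u.2, ?_, ?_, ?_⟩
    · intro y _
      dsimp only
      split_ifs
      · linarith
      · exact h1
      · exact h2
    · rw [Finset.sum_insert (by simp [hab, hac]), Finset.sum_pair hbc]
      simp [hab.symm, hac.symm, hbc.symm]
    · rw [Finset.sum_insert (by simp [hab, hac]), Finset.sum_pair hbc]
      simp only [if_true, hab.symm, hac.symm, hbc.symm, if_false, triPt]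
      module

lemma mem_convexHull_pair' {V : Type*} [AddCommGroup V] [Module ℝ V] {a b x : V} [DecidableEq V] :
    x ∈ convexHull ℝ (({a, b} : Finset V) : Set V) ↔ ∃ s ∈ Icc (0:ℝ) 1, a + s • (b - a) = x := by
  rw [Finset.coe_pair, convexHull_pair, segment_eq_image']
  rfl

namespace SmoothTriangulation

variable {S : Set E4} (τ : SmoothTriangulation S)

/-- The space in which the simplicial complex lies. -/
abbrev V : Type := EuclideanSpace ℝ (Fin τ.dim)

/-- The closed simplex spanned by a face. -/
abbrev hull (s : Finset τ.V) : Set τ.V := convexHull ℝ (s : Set τ.V)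

/-- The differential along a face. -/
def diffOn (s : Finset τ.V) (x : τ.V) : τ.V →L[ℝ] E4 := fderivWithin ℝ τ.toFun (τ.hull s) x

variable {τ}

lemma hasFDerivWithinAt {s : Finset τ.V} (hs : s ∈ τ.K.faces) {x : τ.V} (hx : x ∈ τ.hull s) :
    HasFDerivWithinAt τ.toFun (τ.diffOn s x) (τ.hull s) x :=
  ((τ.contDiffOn s hs).differentiableOn (by simp) x hx).hasFDerivWithinAt

lemma hull_subset {s : Finset τ.V} (hs : s ∈ τ.K.faces) : τ.hull s ⊆ τ.K.space :=
  Geometry.SimplicialComplex.convexHull_subset_space hs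

lemma mapsTo_hull {s : Finset τ.V} (hs : s ∈ τ.K.faces) : MapsTo τ.toFun (τ.hull s) S :=
  τ.bijOn.mapsTo.mono_left (hull_subset hs)

/-- A simplex meeting the interior of a face contains that face. -/
lemma subset_of_interior {s s' : Finset τ.V} (hs : s ∈ τ.K.faces) (hs' : s' ∈ τ.K.faces)
    {w : τ.V → ℝ} (hw : ∀ y ∈ s, 0 < w y) (hw1 : ∑ y ∈ s, w y = 1)
    (hx : ∑ y ∈ s, w y • y ∈ τ.hull s') : s ⊆ s' := by
  classical
  have hxs : ∑ y ∈ s, w y • y ∈ τ.hull s :=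
    Finset.mem_convexHull'.2 ⟨w, fun y hy => (hw y hy).le, hw1, rfl⟩
  -- The point lies in the hull of the common vertices. Extending those weights by zero gives a
  -- second set of barycentric coordinates on `s`, so by affine independence every positive weight
  -- belongs to a common vertex.
  have hi := τ.K.inter_subset_convexHull hs hs' ⟨hxs, hx⟩
  rw [← Finset.coe_inter, Finset.mem_convexHull'] at hi
  obtain ⟨w', hw', hw1', hx'⟩ := hi
  let w'' : τ.V → ℝ := fun y => if y ∈ s' then w' y else 0
  have e1 : ∑ y ∈ s, w'' y = 1 := by
    rw [← hw1', ← Finset.filter_mem_eq_inter, Finset.sum_filter]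
  have e2 : ∑ y ∈ s, w'' y • y = ∑ y ∈ s, w y • y := by
    rw [← hx', ← Finset.filter_mem_eq_inter, Finset.sum_filter]
    exact Finset.sum_congr rfl fun y _ => by simp only [w'']; split_ifs <;> simp
  have hind := affineIndependent_iff.1 (τ.K.indep hs) Finset.univ (fun y => w y - w'' y)
    (by rw [Finset.univ_eq_attach, Finset.sum_attach s (fun y => w y - w'' y),
          Finset.sum_sub_distrib, hw1, e1, sub_self])
    (by
      rw [Finset.univ_eq_attach, Finset.sum_attach s (fun y => (w y - w'' y) • y)]
      simp only [sub_smul]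
      rw [Finset.sum_sub_distrib, e2, sub_self])
  intro y hy
  by_contra hy'
  have := hind ⟨y, hy⟩ (Finset.mem_univ _)
  simp only [w'', hy', if_false, sub_zero] at this
  exact (hw y hy).ne' this

lemma vertex_mem_of_mem_hull {a : τ.V} {s : Finset τ.V} (ha : {a} ∈ τ.K.faces)
    (hs : s ∈ τ.K.faces) (hx : a ∈ τ.hull s) : a ∈ s := by
  have := subset_of_interior ha hs (w := fun _ => 1) (by simp) (by simp) (by simpa using hx)
  simpa using this

lemma edge_subset_of_mem_hull {a b : τ.V} {s : Finset τ.V} (hab : a ≠ b) (ha : {a, b} ∈ τ.K.faces)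
    (hs : s ∈ τ.K.faces) (hx : (1 / 2 : ℝ) • a + (1 / 2 : ℝ) • b ∈ τ.hull s) : {a, b} ⊆ s :=
  subset_of_interior ha hs (w := fun _ => 1 / 2) (by simp) (by rw [Finset.sum_pair hab]; norm_num)
    (by rwa [Finset.sum_pair hab])

variable (τ) in
/-- `a`, `b`, `c` are the vertices of a triangle. -/
structure IsTri (a b c : τ.V) : Prop where
  mem : {a, b, c} ∈ τ.K.faces
  ab : a ≠ b
  ac : a ≠ c
  bc : b ≠ c

namespace IsTri

variable {a b c : τ.V} (h : τ.IsTri a b c)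

include h

lemma rotate : τ.IsTri b c a where
  mem := by
    have : ({b, c, a} : Finset τ.V) = {a, b, c} := by ext; simp; tauto
    rw [this]; exact h.mem
  ab := h.bc
  ac := h.ab.symm
  bc := h.ac.symm

lemma swap : τ.IsTri a c b where
  mem := by
    have : ({a, c, b} : Finset τ.V) = {a, b, c} := by ext; simp; tauto
    rw [this]; exact h.mem
  ab := h.ac
  ac := h.ab
  bc := h.bc.symm

lemma indep {r s : ℝ} (hrs : r • (b - a) + s • (c - a) = 0) : r = 0 ∧ s = 0 := by
  have hind := affineIndependent_iff.1 (τ.K.indep h.mem) Finset.univ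
    (fun y => if (y : τ.V) = a then -r - s else if (y : τ.V) = b then r else s)
  rw [Finset.univ_eq_attach, Finset.sum_attach {a, b, c}
      (fun y : τ.V => if y = a then -r - s else if y = b then r else s),
    Finset.sum_attach {a, b, c}
      (fun y : τ.V => (if y = a then -r - s else if y = b then r else s) • y),
    Finset.sum_insert (by simp [h.ab, h.ac]), Finset.sum_pair h.bc,
    Finset.sum_insert (by simp [h.ab, h.ac]), Finset.sum_pair h.bc] at hind
  simp only [if_true, h.ab.symm, h.ac.symm, h.bc.symm, if_false] at hind
  have := hind (by ring) (by rw [← hrs]; module)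
  constructor
  · simpa [h.ab.symm] using this ⟨b, by simp⟩ (Finset.mem_attach _ _)
  · simpa [h.ac.symm, h.bc.symm] using this ⟨c, by simp⟩ (Finset.mem_attach _ _)

lemma triPt_mem {u : ℝ × ℝ} (hu : u ∈ stdTri) : triPt a b c u ∈ τ.hull {a, b, c} :=
  (mem_convexHull_triple h.ab h.ac h.bc).2 ⟨u, hu, rfl⟩

lemma triPt_injective : Function.Injective (triPt a b c) := by
  intro u v huv
  have := h.indep (r := u.1 - v.1) (s := u.2 - v.2) (by
    simp only [triPt] at huv
    have := add_left_cancel huv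
    rw [← sub_eq_zero] at this
    rw [← this]; module)
  exact Prod.ext (by linarith [this.1]) (by linarith [this.2])

/-- An open triangle is disjoint from the other closed triangles. -/
lemma subset_of_openTri {u : ℝ × ℝ} (hu : u ∈ openTri) {s : Finset τ.V} (hs : s ∈ τ.K.faces)
    (hx : triPt a b c u ∈ τ.hull s) : {a, b, c} ⊆ s := by
  obtain ⟨h1, h2, h3⟩ := hu
  refine subset_of_interior h.mem hs
    (w := fun y => if y = a then 1 - u.1 - u.2 else if y = b then u.1 else u.2) ?_ ?_ ?_
  · intro y _
    split_ifs
    · linarith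
    · exact h1
    · exact h2
  · rw [Finset.sum_insert (by simp [h.ab, h.ac]), Finset.sum_pair h.bc]
    simp [h.ab.symm, h.ac.symm, h.bc.symm]
  · rw [Finset.sum_insert (by simp [h.ab, h.ac]), Finset.sum_pair h.bc]
    simp only [if_true, h.ab.symm, h.ac.symm, h.bc.symm, if_false]
    convert hx using 1
    simp only [triPt]
    module

/-- The linear part of `triPt`. -/
def lin (a b c : τ.V) : ℝ × ℝ →L[ℝ] τ.V :=
  (ContinuousLinearMap.fst ℝ ℝ ℝ).smulRight (b - a) + (ContinuousLinearMap.snd ℝ ℝ ℝ).smulRight (c - a)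

omit h in
lemma hasFDerivAt_triPt (u : ℝ × ℝ) : HasFDerivAt (triPt a b c) (lin a b c) u :=
  (lin a b c).hasFDerivAt.const_add a

lemma contDiffOn_patch : ContDiffOn ℝ ∞ (τ.toFun ∘ triPt a b c) stdTri :=
  (τ.contDiffOn _ h.mem).comp (ContDiff.contDiffOn (by unfold triPt; fun_prop)) fun _ hu =>
    h.triPt_mem hu

lemma hasFDerivWithinAt_patch {u : ℝ × ℝ} (hu : u ∈ stdTri) :
    HasFDerivWithinAt (τ.toFun ∘ triPt a b c)
      ((τ.diffOn {a, b, c} (triPt a b c u)).comp (lin a b c)) stdTri u :=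
  (hasFDerivWithinAt h.mem (h.triPt_mem hu)).comp u (hasFDerivAt_triPt u).hasFDerivWithinAt
    fun _ hv => h.triPt_mem hv

lemma fderivWithin_patch {u : ℝ × ℝ} (hu : u ∈ stdTri) (w : ℝ × ℝ) :
    fderivWithin ℝ (τ.toFun ∘ triPt a b c) stdTri u w =
      τ.diffOn {a, b, c} (triPt a b c u) (w.1 • (b - a) + w.2 • (c - a)) := by
  rw [(h.hasFDerivWithinAt_patch hu).fderivWithin (uniqueDiffOn_stdTri u hu)]
  rfl

lemma fderivWithin_patch_injective {u : ℝ × ℝ} (hu : u ∈ stdTri) {w : ℝ × ℝ}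
    (hw : fderivWithin ℝ (τ.toFun ∘ triPt a b c) stdTri u w = 0) : w = 0 := by
  rw [h.fderivWithin_patch hu] at hw
  have := τ.injective_differential _ h.mem _ (h.triPt_mem hu) _
    (Submodule.add_mem _ (Submodule.smul_mem _ _ (vsub_mem_vectorSpan ℝ (by simp) (by simp)))
      (Submodule.smul_mem _ _ (vsub_mem_vectorSpan ℝ (by simp) (by simp)))) hw
  exact Prod.ext (h.indep this).1 (h.indep this).2

lemma mapsTo_patch : MapsTo (τ.toFun ∘ triPt a b c) stdTri S := fun _ hu =>
  mapsTo_hull h.mem (h.triPt_mem hu)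

lemma injOn_patch : InjOn (τ.toFun ∘ triPt a b c) stdTri := fun _ hu _ hv huv =>
  h.triPt_injective (τ.bijOn.injOn (hull_subset h.mem (h.triPt_mem hu))
    (hull_subset h.mem (h.triPt_mem hv)) huv)

lemma image_patch : (τ.toFun ∘ triPt a b c) '' stdTri = τ.toFun '' τ.hull {a, b, c} := by
  rw [image_comp]
  congr 1
  ext x
  exact (mem_convexHull_triple h.ab h.ac h.bc).symm

end IsTri

variable (τ) in
/-- `a`, `b`, `c` are the vertices of a triangle in the order given by the orientation of the
surface. -/
structure PosTri (N : E4 → E4) (a b c : τ.V) : Prop extends τ.IsTri a b c where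
  pos : ∀ x ∈ τ.hull {a, b, c}, 0 < det4 (τ.diffOn {a, b, c} x (b - a))
    (τ.diffOn {a, b, c} x (c - a)) (N (τ.toFun x)) (τ.toFun x)

lemma PosTri.rotate {N : E4 → E4} {a b c : τ.V} (h : τ.PosTri N a b c) : τ.PosTri N b c a where
  toIsTri := h.toIsTri.rotate
  pos x hx := by
    have e : ({b, c, a} : Finset τ.V) = {a, b, c} := by ext; simp; tauto
    rw [e] at hx ⊢
    have e1 : c - b = (c - a) + (-1 : ℝ) • (b - a) := by module
    have e2 : a - b = (-1 : ℝ) • (b - a) := by module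
    have := h.pos x hx
    rw [e1, e2, map_add, map_smul, det4_add_left, det4_smul_left, det4_smul_right,
      det4_smul_right, det4_self, det4_swap]
    linarith

lemma PosTri.not_swap {N : E4 → E4} {a b c : τ.V} (h : τ.PosTri N a b c) :
    ¬ τ.PosTri N a c b := fun h' => by
  have e : ({a, c, b} : Finset τ.V) = {a, b, c} := by ext; simp; tauto
  have ha : a ∈ τ.hull {a, b, c} := subset_convexHull _ _ (by simp)
  have h1 := h.pos a ha
  have h2 := h'.pos a (by rw [e]; exact ha)
  rw [e, det4_swap] at h2
  linarith

/-- The cyclic orders agree for positive triangles with the same vertices. -/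
lemma PosTri.eq_of_subset {N : E4 → E4} {a b c b' c' : τ.V} (h : τ.PosTri N a b c)
    (h' : τ.PosTri N a b' c') (hs : ({a, b, c} : Finset τ.V) ⊆ {a, b', c'}) : b = b' ∧ c = c' := by
  have hb := hs (show b ∈ _ by simp)
  have hc := hs (show c ∈ _ by simp)
  simp only [Finset.mem_insert, Finset.mem_singleton, h.ab.symm, h.ac.symm, false_or] at hb hc
  rcases hb with rfl | rfl
  · exact ⟨rfl, hc.resolve_left h.bc.symm⟩
  · rcases hc with rfl | rfl
    · exact (h'.not_swap h).elim
    · exact (h.bc rfl).elim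

end SmoothTriangulation

/-- Tangent vectors are combinations of two independent ones. -/
lemma OrthoPair.eq_comb {n x : E4} (ho : OrthoPair n x) {a b c : E4} (ha : Tang n x a)
    (hb : Tang n x b) (hc : Tang n x c) (hab : det4 a b n x ≠ 0) :
    c = (det4 c b n x / det4 a b n x) • a + (det4 a c n x / det4 a b n x) • b := by
  obtain ⟨d, hd⟩ : ∃ d, d = det4 a b n x := ⟨_, rfl⟩
  rw [← hd] at hab ⊢
  -- Cramer's rule. The error `v` has zero determinant with `a` and with `b`; the Gram identities
  -- make it orthogonal to `a`, and then of norm zero.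
  obtain ⟨v, hv⟩ : ∃ v, v = c - ((det4 c b n x / d) • a + (det4 a c n x / d) • b) := ⟨_, rfl⟩
  have tv : Tang n x v := hv ▸ hc.sub ((ha.smul _).add (hb.smul _))
  have e1 : det4 a v n x = 0 := by
    rw [hv, sub_eq_add_neg, neg_add, ← neg_smul, ← neg_smul, det4_add_right, det4_add_right,
      det4_smul_right, det4_smul_right, det4_self, ← hd]
    field_simp
    ring
  have e2 : det4 v b n x = 0 := by
    rw [hv, sub_eq_add_neg, neg_add, ← neg_smul, ← neg_smul, det4_add_left, det4_add_left,
      det4_smul_left, det4_smul_left, det4_self, ← hd]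
    field_simp
    ring
  have g1 := ho.gram a v a b ha hb
  have g2 := ho.gram v b a b ha hb
  have g3 := ho.det4_sq ha hb
  have g4 := ho.det4_sq ha tv
  rw [e1, zero_mul, real_inner_self_eq_norm_sq] at g1
  rw [e2, zero_mul, real_inner_self_eq_norm_sq, real_inner_comm a b] at g2
  rw [← hd] at g3
  have i1 : inner ℝ v a = (0:ℝ) := by
    have : d ^ 2 * inner ℝ v a = 0 := by
      rw [g3]; linear_combination - inner ℝ a b * g1 - ‖a‖ ^ 2 * g2
    exact (mul_eq_zero.1 this).resolve_left (pow_ne_zero 2 hab)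
  rw [e1, real_inner_comm, i1] at g4
  have ha0 : ‖a‖ ^ 2 ≠ 0 := by
    intro h0
    have : a = 0 := by simpa using h0
    rw [this, ← zero_smul ℝ (0 : E4), det4_smul_left, zero_mul] at hd
    exact hab hd
  have : ‖v‖ ^ 2 = 0 := (mul_eq_zero.1 (show ‖a‖ ^ 2 * ‖v‖ ^ 2 = 0 by linarith)).resolve_left ha0
  have : v = 0 := by simpa using this
  rw [this] at hv
  exact (sub_eq_zero.1 hv.symm)

/-! ### Triangles as patches of the surface -/

namespace TubularSurface

open SmoothTriangulation

variable {S A A' : Set E4} {N : E4 → E4} {ε : ℝ} (h : TubularSurface S A A' N ε)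
  {τ : SmoothTriangulation S}

include h

lemma tang_diffOn {s : Finset τ.V} (hs : s ∈ τ.K.faces) {x y : τ.V} (hx : x ∈ τ.hull s)
    (hy : y ∈ τ.hull s) : Tang (N (τ.toFun x)) (τ.toFun x) (τ.diffOn s x (y - x)) :=
  h.tang_of_hasFDerivWithinAt hx (hasFDerivWithinAt hs hx) (mapsTo_hull hs)
    (mem_tangentConeAt_of_segment_subset ((convex_convexHull ℝ _).segment_subset hx hy))

/-- An edge vector need not start at `x`; it is the difference of two vectors from `x` that point
into the simplex. -/
lemma tang_diffOn_vertices {s : Finset τ.V} (hs : s ∈ τ.K.faces) {x a b : τ.V} (hx : x ∈ τ.hull s)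
    (ha : a ∈ s) (hb : b ∈ s) : Tang (N (τ.toFun x)) (τ.toFun x) (τ.diffOn s x (b - a)) := by
  have := (h.tang_diffOn hs hx (subset_convexHull ℝ _ hb)).sub
    (h.tang_diffOn hs hx (subset_convexHull ℝ _ ha))
  rwa [← map_sub, sub_sub_sub_cancel_right] at this

lemma tang_patch {a b c : τ.V} (ht : τ.IsTri a b c) {u : ℝ × ℝ} (hu : u ∈ stdTri) (w : ℝ × ℝ) :
    Tang (N ((τ.toFun ∘ triPt a b c) u)) ((τ.toFun ∘ triPt a b c) u)
      (fderivWithin ℝ (τ.toFun ∘ triPt a b c) stdTri u w) := by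
  rw [ht.fderivWithin_patch hu, map_add, map_smul, map_smul]
  exact ((h.tang_diffOn_vertices ht.mem (ht.triPt_mem hu) (by simp) (by simp)).smul _).add
    ((h.tang_diffOn_vertices ht.mem (ht.triPt_mem hu) (by simp) (by simp)).smul _)

end TubularSurface

/-- The points of the cone over a piece of the surface. -/
def coneOver (N : E4 → E4) (C : Set E4) : Set E4 := {y | ∃ q ∈ C, ∃ t ρ, conePt N q t ρ = y}

namespace TubularSurface

open SmoothTriangulation

variable {S A A' : Set E4} {N : E4 → E4} {ε : ℝ} (h : TubularSurface S A A' N ε)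
  {τ : SmoothTriangulation S}

include h

lemma contDiffOn_normal_patch {a b c : τ.V} (ht : τ.IsTri a b c) :
    ContDiffOn ℝ ∞ (N ∘ (τ.toFun ∘ triPt a b c)) stdTri :=
  h.contDiffOn_normal.comp ht.contDiffOn_patch ht.mapsTo_patch

lemma ortho_patch {a b c : τ.V} (ht : τ.IsTri a b c) {u : ℝ × ℝ} (hu : u ∈ stdTri) :
    OrthoPair ((N ∘ (τ.toFun ∘ triPt a b c)) u) ((τ.toFun ∘ triPt a b c) u) :=
  h.ortho (ht.mapsTo_patch hu)

lemma det4_patch_ne_zero {a b c : τ.V} (ht : τ.IsTri a b c) {u : ℝ × ℝ} (hu : u ∈ stdTri) :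
    det4 (fderivWithin ℝ (τ.toFun ∘ triPt a b c) stdTri u (1, 0))
      (fderivWithin ℝ (τ.toFun ∘ triPt a b c) stdTri u (0, 1))
      ((N ∘ (τ.toFun ∘ triPt a b c)) u) ((τ.toFun ∘ triPt a b c) u) ≠ 0 := by
  refine (h.ortho_patch ht hu).det4_ne_zero (h.tang_patch ht hu _) (h.tang_patch ht hu _)
    fun r s hrs => ?_
  rw [← map_smul, ← map_smul, ← map_add] at hrs
  have := ht.fderivWithin_patch_injective hu hrs
  simpa using this

omit h in
lemma posTri_iff {a b c : τ.V} (ht : τ.IsTri a b c) : τ.PosTri N a b c ↔ ∀ u ∈ stdTri,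
    0 < det4 (fderivWithin ℝ (τ.toFun ∘ triPt a b c) stdTri u (1, 0))
      (fderivWithin ℝ (τ.toFun ∘ triPt a b c) stdTri u (0, 1))
      ((N ∘ (τ.toFun ∘ triPt a b c)) u) ((τ.toFun ∘ triPt a b c) u) := by
  constructor
  · intro hp u hu
    rw [ht.fderivWithin_patch hu, ht.fderivWithin_patch hu]
    simpa using hp.pos _ (ht.triPt_mem hu)
  · intro hp
    refine ⟨ht, fun x hx => ?_⟩
    obtain ⟨u, hu, rfl⟩ := (mem_convexHull_triple ht.ab ht.ac ht.bc).1 hx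
    have := hp u hu
    rw [ht.fderivWithin_patch hu, ht.fderivWithin_patch hu] at this
    simpa using this

/-- The determinant is continuous and never zero on the connected triangle, so it has constant sign;
exchanging two vertices reverses it. -/
lemma posTri_or {a b c : τ.V} (ht : τ.IsTri a b c) : τ.PosTri N a b c ∨ τ.PosTri N a c b := by
  have hc : ContinuousOn (fun u =>
      det4 (fderivWithin ℝ (τ.toFun ∘ triPt a b c) stdTri u (1, 0))
      (fderivWithin ℝ (τ.toFun ∘ triPt a b c) stdTri u (0, 1))
      ((N ∘ (τ.toFun ∘ triPt a b c)) u) ((τ.toFun ∘ triPt a b c) u)) stdTri := by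
    have hd := ht.contDiffOn_patch.continuousOn_fderivWithin uniqueDiffOn_stdTri (by simp)
    exact ContinuousOn.det4 (hd.clm_apply continuousOn_const) (hd.clm_apply continuousOn_const)
      (h.contDiffOn_normal_patch ht).continuousOn ht.contDiffOn_patch.continuousOn
  have hconv : IsPreconnected stdTri := convex_stdTri.isPreconnected
  have h0 : ((0:ℝ), (0:ℝ)) ∈ stdTri := by simp [stdTri]
  rcases lt_or_gt_of_ne (h.det4_patch_ne_zero ht h0) with hneg | hpos
  · right
    refine ⟨ht.swap, fun x hx => ?_⟩
    have e : ({a, c, b} : Finset τ.V) = {a, b, c} := by ext; simp; tauto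
    rw [e] at hx ⊢
    obtain ⟨u, hu, rfl⟩ := (mem_convexHull_triple ht.ab ht.ac ht.bc).1 hx
    rw [det4_swap, neg_pos]
    by_contra! hge
    have hge' : 0 ≤ det4 (fderivWithin ℝ (τ.toFun ∘ triPt a b c) stdTri u (1, 0))
        (fderivWithin ℝ (τ.toFun ∘ triPt a b c) stdTri u (0, 1))
        ((N ∘ (τ.toFun ∘ triPt a b c)) u) ((τ.toFun ∘ triPt a b c) u) := by
      rw [ht.fderivWithin_patch hu, ht.fderivWithin_patch hu]
      simpa using hge
    obtain ⟨v, hv, hv0⟩ := hconv.intermediate_value h0 hu hc ⟨hneg.le, hge'⟩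
    exact h.det4_patch_ne_zero ht hv hv0
  · left
    refine (posTri_iff ht).2 fun u hu => ?_
    by_contra! hle
    obtain ⟨v, hv, hv0⟩ := hconv.intermediate_value hu h0 hc ⟨hle, hpos.le⟩
    exact h.det4_patch_ne_zero ht hv hv0

lemma trianglePatch {a b c : τ.V} (ht : τ.PosTri N a b c) :
    TrianglePatch (τ.toFun ∘ triPt a b c) (N ∘ (τ.toFun ∘ triPt a b c)) where
  contF := ht.contDiffOn_patch
  contn := h.contDiffOn_normal_patch ht.toIsTri
  ortho _ hu := h.ortho_patch ht.toIsTri hu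
  tang _ hu := h.tang_patch ht.toIsTri hu
  pos := (posTri_iff ht.toIsTri).1 ht

/-- The differential is injective on the span of a simplex and takes values in the two-dimensional
tangent plane, so three edges at a vertex would be dependent, against affine independence. -/
lemma card_le_three {s : Finset τ.V} (hs : s ∈ τ.K.faces) : s.card ≤ 3 := by
  by_contra! hlt
  obtain ⟨a, b, c, d, ha, hb, hc, hd, hab, hac, had, hbc, hbd, hcd⟩ :
      ∃ a b c d, a ∈ s ∧ b ∈ s ∧ c ∈ s ∧ d ∈ s ∧ a ≠ b ∧ a ≠ c ∧ a ≠ d ∧ b ≠ c ∧ b ≠ d ∧ c ≠ d := by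
    obtain ⟨t, hts, ht⟩ := Finset.exists_subset_card_eq (show 4 ≤ s.card by omega)
    obtain ⟨a, b, c, d, h1, h2, h3, h4, h5, h6, rfl⟩ := Finset.card_eq_four.1 ht
    exact ⟨a, b, c, d, hts (by simp), hts (by simp), hts (by simp), hts (by simp), h1, h2, h3, h4,
      h5, h6⟩
  have htri : τ.IsTri a b c := ⟨τ.K.down_closed hs (by
    intro x hx; simp only [Finset.mem_insert, Finset.mem_singleton] at hx
    rcases hx with rfl | rfl | rfl <;> assumption) (by simp), hab, hac, hbc⟩
  have hah : a ∈ τ.hull s := subset_convexHull ℝ _ ha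
  have hpa := mapsTo_hull hs hah
  have t1 := h.tang_diffOn_vertices hs hah ha hb
  have t2 := h.tang_diffOn_vertices hs hah ha hc
  have t3 := h.tang_diffOn_vertices hs hah ha hd
  have hv : ∀ y ∈ s, y - a ∈ vectorSpan ℝ (s : Set τ.V) := fun y hy =>
    vsub_mem_vectorSpan ℝ (by simpa using hy) (by simpa using ha)
  have hne := (h.ortho hpa).det4_ne_zero t1 t2 fun r t hrt => by
    rw [← map_smul, ← map_smul, ← map_add] at hrt
    exact htri.indep (τ.injective_differential _ hs _ hah _ (Submodule.add_mem _
      (Submodule.smul_mem _ _ (hv b hb)) (Submodule.smul_mem _ _ (hv c hc))) hrt)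
  have hcomb := (h.ortho hpa).eq_comb t1 t2 t3 hne
  rw [← sub_eq_zero, ← map_smul, ← map_smul, ← map_add, ← map_sub] at hcomb
  have hz := τ.injective_differential _ hs _ hah _ (Submodule.sub_mem _ (hv d hd)
    (Submodule.add_mem _ (Submodule.smul_mem _ _ (hv b hb)) (Submodule.smul_mem _ _ (hv c hc)))) hcomb
  generalize det4 _ _ _ _ / _ = r at hz
  generalize det4 _ _ _ _ / _ = t at hz
  have hd4 : ({a, b, c, d} : Finset τ.V) ∈ τ.K.faces := τ.K.down_closed hs (by
    intro x hx; simp only [Finset.mem_insert, Finset.mem_singleton] at hx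
    rcases hx with rfl | rfl | rfl | rfl <;> assumption) (by simp)
  have hind := affineIndependent_iff.1 (τ.K.indep hd4) Finset.univ
    (fun y => if (y : τ.V) = a then r + t - 1 else if (y : τ.V) = b then -r else
      if (y : τ.V) = c then -t else 1)
  rw [Finset.univ_eq_attach, Finset.sum_attach {a, b, c, d}
      (fun y : τ.V => if y = a then r + t - 1 else if y = b then -r else if y = c then -t else 1),
    Finset.sum_attach {a, b, c, d} (fun y : τ.V =>
      (if y = a then r + t - 1 else if y = b then -r else if y = c then -t else 1) • y),
    Finset.sum_insert (by simp [hab, hac, had]), Finset.sum_insert (by simp [hbc, hbd]),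
    Finset.sum_pair hcd,
    Finset.sum_insert (by simp [hab, hac, had]), Finset.sum_insert (by simp [hbc, hbd]),
    Finset.sum_pair hcd] at hind
  simp only [if_true, hab.symm, hac.symm, had.symm, hbc.symm, hbd.symm, hcd.symm, if_false] at hind
  have := hind (by ring) (by rw [← hz]; module) ⟨d, by simp⟩ (Finset.mem_attach _ _)
  simp [had.symm, hbd.symm, hcd.symm] at this

/-- The cone over an edge is a null set. -/
lemma volume_coneOver_edge {a b : τ.V} (hab : {a, b} ∈ τ.K.faces) :
    volume (coneOver N (τ.toFun '' τ.hull {a, b})) = 0 := by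
  let γ : ℝ → E4 := fun s => τ.toFun (a + s • (b - a))
  have hm : MapsTo (fun s : ℝ => a + s • (b - a)) (Icc 0 1) (τ.hull {a, b}) := fun s hs =>
    mem_convexHull_pair'.2 ⟨s, hs, rfl⟩
  have hγ : ContDiffOn ℝ ∞ γ (Icc 0 1) :=
    (τ.contDiffOn _ hab).comp (ContDiff.contDiffOn (by fun_prop)) hm
  have hNγ : ContDiffOn ℝ ∞ (N ∘ γ) (Icc 0 1) :=
    h.contDiffOn_normal.comp hγ fun s hs => mapsTo_hull hab (hm hs)
  -- A dummy fourth coordinate, set to zero, makes the three-parameter cone the image of a null set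
  -- of `ℝ⁴` under a differentiable map.
  let D : Set E4 := {y | y 0 ∈ Icc (0:ℝ) 1 ∧ y 3 = 0}
  let f : E4 → E4 := fun y => conePt N (γ (y 0)) (y 1) (y 2)
  have hf : DifferentiableOn ℝ f D := by
    have p : ∀ i : Fin 4, ContDiff ℝ ∞ fun y : E4 => y i := fun i =>
      (EuclideanSpace.proj (𝕜 := ℝ) i).contDiff
    have c1 : ContDiffOn ℝ ∞ (fun y : E4 => γ (y 0)) D := hγ.comp (p 0).contDiffOn fun y hy => hy.1
    have c2 : ContDiffOn ℝ ∞ (fun y : E4 => N (γ (y 0))) D :=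
      hNγ.comp (p 0).contDiffOn fun y hy => hy.1
    exact ((p 2).contDiffOn.smul (((Real.contDiff_cos.comp (p 1)).contDiffOn.smul c1).add
      ((Real.contDiff_sin.comp (p 1)).contDiffOn.smul c2))).differentiableOn (by simp)
  have hD : volume D = 0 := by
    refine measure_mono_null (t := (LinearMap.ker (EuclideanSpace.proj (𝕜 := ℝ) (3 : Fin 4) :
      E4 →L[ℝ] ℝ).toLinearMap : Set E4)) (fun y hy => hy.2) ?_
    refine Measure.addHaar_submodule _ _ fun htop => ?_
    have : EuclideanSpace.single (3 : Fin 4) (1:ℝ) ∈ LinearMap.ker (EuclideanSpace.proj (𝕜 := ℝ) (3 : Fin 4) :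
      E4 →L[ℝ] ℝ).toLinearMap := by rw [htop]; trivial
    simp at this
  refine measure_mono_null ?_ (addHaar_image_eq_zero_of_differentiableOn_of_addHaar_eq_zero volume hf hD)
  rintro _ ⟨_, ⟨x, hx, rfl⟩, t, ρ, rfl⟩
  obtain ⟨s, hs, rfl⟩ := mem_convexHull_pair'.1 hx
  exact ⟨!₂[s, t, ρ, 0], ⟨by simpa using hs, by simp⟩, by simp [f, γ]⟩

lemma isCompact_image_hull {s : Finset τ.V} (hs : s ∈ τ.K.faces) :
    IsCompact (τ.toFun '' τ.hull s) :=
  s.finite_toSet.isCompact_convexHull (𝕜 := ℝ) |>.image_of_continuousOn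
    (τ.continuousOn.mono (hull_subset hs))

/-- The union of the edges, and of the vertices that are on no edge. -/
lemma volume_coneOver_edges :
    volume (coneOver N (⋃ s ∈ {s ∈ τ.K.faces | s.card ≤ 2}, τ.toFun '' τ.hull s)) = 0 := by
  have : coneOver N (⋃ s ∈ {s ∈ τ.K.faces | s.card ≤ 2}, τ.toFun '' τ.hull s) ⊆
      ⋃ s ∈ {s ∈ τ.K.faces | s.card ≤ 2}, coneOver N (τ.toFun '' τ.hull s) := by
    rintro y ⟨q, hq, t, ρ, rfl⟩
    obtain ⟨s, hs, hqs⟩ := mem_iUnion₂.1 hq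
    exact mem_biUnion hs ⟨q, hqs, t, ρ, rfl⟩
  refine measure_mono_null this
    ((measure_biUnion_null_iff (τ.finite_faces.subset (sep_subset _ _)).countable).2 ?_)
  rintro s ⟨hs, hcard⟩
  obtain ⟨a, b, rfl⟩ : ∃ a b, s = {a, b} := by
    have h0 := (τ.K.nonempty_of_mem_faces hs).card_pos
    interval_cases hc : s.card
    · obtain ⟨a, rfl⟩ := Finset.card_eq_one.1 hc
      exact ⟨a, a, by simp⟩
    · obtain ⟨a, b, -, rfl⟩ := Finset.card_eq_two.1 hc
      exact ⟨a, b, rfl⟩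
  exact h.volume_coneOver_edge hs

/-- The triangles cover the surface. -/
lemma exists_isTri {x : τ.V} (hx : x ∈ τ.K.space) : ∃ a b c, τ.PosTri N a b c ∧
    x ∈ τ.hull {a, b, c} := by
  suffices hs : ∃ s ∈ τ.K.faces, s.card = 3 ∧ x ∈ τ.hull s by
    obtain ⟨s, hs, hc, hxs⟩ := hs
    obtain ⟨a, b, c, h1, h2, h3, rfl⟩ := Finset.card_eq_three.1 hc
    rcases h.posTri_or ⟨hs, h1, h2, h3⟩ with hp | hp
    · exact ⟨a, b, c, hp, hxs⟩
    · refine ⟨a, c, b, hp, ?_⟩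
      have e : ({a, c, b} : Finset τ.V) = {a, b, c} := by ext; simp; tauto
      rwa [e]
  by_contra! hno
  let B : Set E4 := ⋃ s ∈ {s ∈ τ.K.faces | s.card = 3}, τ.toFun '' τ.hull s
  have hB : IsClosed B := (τ.finite_faces.subset (sep_subset _ _)).isClosed_biUnion fun s hs =>
    (h.isCompact_image_hull hs.1).isClosed
  have hxB : τ.toFun x ∉ B := fun hxB => by
    obtain ⟨s, hs, y, hy, hyx⟩ := mem_iUnion₂.1 hxB
    rw [τ.bijOn.injOn (hull_subset hs.1 hy) hx hyx] at hy
    exact hno s hs.1 hs.2 hy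
  have hxS := τ.bijOn.mapsTo hx
  -- Were `x` in no triangle, the cone over the complement of all triangles would be a nonempty open
  -- set. All its foot points lie on edges or vertices, so it would also be null.
  let O : Set E4 := coneDom S N ε ∩ coneFoot S N ε ⁻¹' Bᶜ
  have hO : IsOpen O := h.contDiffOn_coneFoot.continuousOn.isOpen_inter_preimage h.isOpen_coneDom
    hB.isOpen_compl
  have h3 : |(0:ℝ)| < 3 * ε := by simpa using h.eps_pos
  have hne : O.Nonempty := ⟨conePt N (τ.toFun x) 0 1, h.conePt_mem_coneDom hxS h3 one_pos, by
    rw [mem_preimage, h.coneFoot_conePt hxS h3 one_pos]; exact hxB⟩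
  refine (hO.measure_pos volume hne).ne' (measure_mono_null ?_ (h.volume_coneOver_edges (τ := τ)))
  rintro y ⟨hy, hyB⟩
  obtain ⟨e1, -, e3⟩ := h.eq_of_mem_coneDom hy
  refine ⟨_, ?_, _, _, e3⟩
  obtain ⟨z, hz, hzy⟩ := τ.bijOn.surjOn e1
  obtain ⟨s, hs, hzs⟩ := (Geometry.SimplicialComplex.mem_space_iff).1 hz
  refine mem_biUnion (x := s) ⟨hs, ?_⟩ ⟨z, hzs, hzy⟩
  have := h.card_le_three hs
  by_contra! hgt
  exact hyB (mem_biUnion (x := s) ⟨hs, by omega⟩ ⟨z, hzs, hzy⟩)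

end TubularSurface

/-! ### Angles around a point of the tangent plane -/

lemma det_prod_prod (L : ℝ × ℝ →L[ℝ] ℝ × ℝ) :
    L.det = (L (1, 0)).1 * (L (0, 1)).2 - (L (0, 1)).1 * (L (1, 0)).2 := by
  rw [ContinuousLinearMap.det, ← LinearMap.det_toMatrix (Module.Basis.finTwoProd ℝ), Matrix.det_fin_two]
  simp [LinearMap.toMatrix_apply]

/-- A parametrization of the open sector spanned by `p` and `q`. -/
def sectorMap (p q : ℝ × ℝ) (z : ℝ × ℝ) : ℝ × ℝ := z.1 • ((1 - z.2) • p + z.2 • q)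

/-- The open sector spanned by `p` and `q`. -/
def sector (p q : ℝ × ℝ) : Set (ℝ × ℝ) := {z | ∃ s t : ℝ, 0 < s ∧ 0 < t ∧ z = s • p + t • q}

lemma image_sectorMap (p q : ℝ × ℝ) : sectorMap p q '' (Ioi 0 ×ˢ Ioo 0 1) = sector p q := by
  ext z
  constructor
  · rintro ⟨⟨r, t⟩, ⟨hr, ht⟩, rfl⟩
    exact ⟨r * (1 - t), r * t, mul_pos hr (sub_pos.2 ht.2), mul_pos hr ht.1, by
      simp only [sectorMap]; module⟩
  · rintro ⟨s, t, hs, ht, rfl⟩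
    have h0 : s + t ≠ 0 := by positivity
    refine ⟨(s + t, t / (s + t)), ⟨by simp only [mem_Ioi]; positivity, by simp only; positivity, ?_⟩, ?_⟩
    · rw [div_lt_one (by positivity)]; linarith
    · simp only [sectorMap, smul_add, smul_smul]
      congr 2 <;> field_simp
      ring

lemma isOpen_sector {p q : ℝ × ℝ} (hd : p.1 * q.2 - p.2 * q.1 ≠ 0) : IsOpen (sector p q) := by
  have : sector p q = {z | 0 < (z.1 * q.2 - z.2 * q.1) / (p.1 * q.2 - p.2 * q.1) ∧
      0 < (p.1 * z.2 - p.2 * z.1) / (p.1 * q.2 - p.2 * q.1)} := by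
    ext z
    constructor
    · rintro ⟨s, t, hs, ht, rfl⟩
      simp only [mem_ofPred_eq, Prod.fst_add, Prod.snd_add, Prod.smul_fst, Prod.smul_snd, smul_eq_mul]
      constructor
      · convert hs using 1; rw [div_eq_iff hd]; ring
      · convert ht using 1; rw [div_eq_iff hd]; ring
    · rintro ⟨h1, h2⟩
      refine ⟨_, _, h1, h2, ?_⟩
      ext <;> simp only [Prod.fst_add, Prod.snd_add, Prod.smul_fst, Prod.smul_snd, smul_eq_mul,
        div_mul_eq_mul_div, ← add_div] <;> rw [eq_div_iff hd] <;> ring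
  have c1 : Continuous fun z : ℝ × ℝ => (z.1 * q.2 - z.2 * q.1) / (p.1 * q.2 - p.2 * q.1) := by
    fun_prop
  have c2 : Continuous fun z : ℝ × ℝ => (p.1 * z.2 - p.2 * z.1) / (p.1 * q.2 - p.2 * q.1) := by
    fun_prop
  rw [this]
  exact (isOpen_lt continuous_const c1).inter (isOpen_lt continuous_const c2)

lemma lintegral_mul_exp_neg_mul_sq {d a : ℝ} (hd : 0 < d) (ha : 0 < a) :
    ∫⁻ r in Ioi (0:ℝ), ENNReal.ofReal (r * d * Real.exp (-(a * r ^ 2))) =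
      ENNReal.ofReal (d / (2 * a)) := by
  have hderiv : ∀ r ∈ Ioi (0:ℝ), HasDerivAt (fun r => -(d / (2 * a)) * Real.exp (-(a * r ^ 2)))
      (r * d * Real.exp (-(a * r ^ 2))) r := fun r _ => by
    have h1 : HasDerivAt (fun r : ℝ => -(a * r ^ 2)) (-(a * (2 * r))) r := by
      simpa using ((hasDerivAt_pow 2 r).const_mul a).fun_neg
    refine (h1.exp.const_mul (-(d / (2 * a)))).congr_deriv ?_
    field_simp
  have hlim : Tendsto (fun r => -(d / (2 * a)) * Real.exp (-(a * r ^ 2))) atTop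
      (𝓝 (-(d / (2 * a)) * 0)) :=
    (Real.tendsto_exp_neg_atTop_nhds_zero.comp
      ((tendsto_pow_atTop two_ne_zero).const_mul_atTop ha)).const_mul _
  have hcont : ContinuousWithinAt (fun r => -(d / (2 * a)) * Real.exp (-(a * r ^ 2))) (Ici 0) 0 := by
    fun_prop
  have hnn : ∀ r ∈ Ioi (0:ℝ), 0 ≤ r * d * Real.exp (-(a * r ^ 2)) := fun r hr => by
    have : (0:ℝ) < r := hr
    positivity
  have hint := integrableOn_Ioi_deriv_of_nonneg hcont hderiv hnn hlim
  have hval := integral_Ioi_of_hasDerivAt_of_nonneg hcont hderiv hnn hlim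
  rw [← ofReal_integral_eq_lintegral_ofReal hint ((ae_restrict_iff' measurableSet_Ioi).2
    (Eventually.of_forall hnn)), hval]
  congr 1
  simp

/-- The Gaussian measure of a sector. -/
lemma lintegral_sector {p q : ℝ × ℝ} (hd : 0 < p.1 * q.2 - p.2 * q.1) :
    ∫⁻ z in sector p q, ENNReal.ofReal (Real.exp (-(z.1 ^ 2 + z.2 ^ 2))) =
      ∫⁻ t in Ioo (0:ℝ) 1, ENNReal.ofReal ((p.1 * q.2 - p.2 * q.1) /
        (2 * (((1 - t) * p.1 + t * q.1) ^ 2 + ((1 - t) * p.2 + t * q.2) ^ 2))) := by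
  set d := p.1 * q.2 - p.2 * q.1 with hdd
  have hpos : ∀ t : ℝ, 0 < ((1 - t) * p.1 + t * q.1) ^ 2 + ((1 - t) * p.2 + t * q.2) ^ 2 := by
    intro t
    by_contra! hle
    have h1 : (1 - t) * p.1 + t * q.1 = 0 := by nlinarith [sq_nonneg ((1 - t) * p.1 + t * q.1), sq_nonneg ((1 - t) * p.2 + t * q.2)]
    have h2 : (1 - t) * p.2 + t * q.2 = 0 := by nlinarith [sq_nonneg ((1 - t) * p.1 + t * q.1), sq_nonneg ((1 - t) * p.2 + t * q.2)]
    have e1 : (1 - t) * d = 0 := by rw [hdd]; linear_combination q.2 * h1 - q.1 * h2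
    have e2 : t * d = 0 := by rw [hdd]; linear_combination p.1 * h2 - p.2 * h1
    linarith
  let A : ℝ × ℝ → (ℝ × ℝ →L[ℝ] ℝ × ℝ) := fun z =>
    z.1 • (ContinuousLinearMap.snd ℝ ℝ ℝ).smulRight (q - p) +
      (ContinuousLinearMap.fst ℝ ℝ ℝ).smulRight ((1 - z.2) • p + z.2 • q)
  have hder : ∀ z, HasFDerivAt (sectorMap p q) (A z) z := fun z => by
    have h2 : HasFDerivAt (fun z : ℝ × ℝ => (1 - z.2) • p + z.2 • q)
        ((ContinuousLinearMap.snd ℝ ℝ ℝ).smulRight (q - p)) z := by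
      have e : (fun z : ℝ × ℝ => (1 - z.2) • p + z.2 • q) = fun z => p + z.2 • (q - p) := by
        funext z; module
      rw [e]
      exact ((hasFDerivAt_snd (𝕜 := ℝ) (p := z)).smul_const (q - p)).const_add p
    exact (hasFDerivAt_fst (𝕜 := ℝ) (p := z)).smul h2
  have hdet : ∀ z, (A z).det = z.1 * d := fun z => by
    rw [det_prod_prod]
    simp [A, hdd]
    ring
  have hms : MeasurableSet (Ioi (0:ℝ) ×ˢ Ioo (0:ℝ) 1) := measurableSet_Ioi.prod measurableSet_Ioo
  have hinj : InjOn (sectorMap p q) (Ioi (0:ℝ) ×ˢ Ioo (0:ℝ) 1) := by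
    rintro ⟨r, t⟩ ⟨hr, ht⟩ ⟨r', t'⟩ ⟨hr', ht'⟩ he
    have h1 := congrArg Prod.fst he
    have h2 := congrArg Prod.snd he
    simp only [sectorMap, Prod.smul_fst, Prod.fst_add, Prod.smul_snd, Prod.snd_add, smul_eq_mul] at h1 h2
    have e1 : d * (r * (1 - t) - r' * (1 - t')) = 0 := by
      rw [hdd]; linear_combination q.2 * h1 - q.1 * h2
    have e2 : d * (r * t - r' * t') = 0 := by rw [hdd]; linear_combination p.1 * h2 - p.2 * h1
    have e1' := (mul_eq_zero.1 e1).resolve_left hd.ne'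
    have e2' := (mul_eq_zero.1 e2).resolve_left hd.ne'
    have hrr : r = r' := by linarith
    subst hrr
    have : t = t' := mul_left_cancel₀ (ne_of_gt hr) (by linarith)
    rw [this]
  rw [← image_sectorMap, lintegral_image_eq_lintegral_abs_det_fderiv_mul volume hms
    (fun z _ => (hder z).hasFDerivWithinAt) hinj]
  have hcongr : ∀ z ∈ Ioi (0:ℝ) ×ˢ Ioo (0:ℝ) 1, ENNReal.ofReal |(A z).det| *
      ENNReal.ofReal (Real.exp (-((sectorMap p q z).1 ^ 2 + (sectorMap p q z).2 ^ 2))) =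
      ENNReal.ofReal (z.1 * d * Real.exp (-((((1 - z.2) * p.1 + z.2 * q.1) ^ 2 +
        ((1 - z.2) * p.2 + z.2 * q.2) ^ 2) * z.1 ^ 2))) := by
    rintro z ⟨hz, -⟩
    have hz' : (0:ℝ) < z.1 := hz
    rw [hdet, abs_of_pos (by positivity), ← ENNReal.ofReal_mul (by positivity)]
    congr 4
    simp only [sectorMap, Prod.smul_fst, Prod.fst_add, Prod.smul_snd, Prod.snd_add, smul_eq_mul]
    ring
  rw [setLIntegral_congr_fun hms hcongr, Measure.volume_eq_prod, ← Measure.prod_restrict,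
    lintegral_prod_symm' _ (by fun_prop)]
  exact lintegral_congr fun t => lintegral_mul_exp_neg_mul_sq hd (hpos t)

/-- An angle as an integral along the chord. -/
lemma OrthoPair.integral_chord {n x : E4} (h : OrthoPair n x) {p q : E4} (hp : Tang n x p)
    (hq : Tang n x q) (hd : 0 < det4 p q n x) :
    IntegrableOn (fun t : ℝ => det4 p q n x / ‖(1 - t) • p + t • q‖ ^ 2) (Ioo 0 1) ∧
    ∫ t in Ioo (0:ℝ) 1, det4 p q n x / ‖(1 - t) • p + t • q‖ ^ 2 = InnerProductGeometry.angle p q := by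
  obtain ⟨hp0, hq0⟩ := ne_zero_of_det4_pos hd
  have hdet1 : ∀ t : ℝ, det4 p ((1 - t) • p + t • q) n x = t * det4 p q n x := fun t => by
    rw [det4_add_right, det4_smul_right, det4_smul_right, det4_self]; ring
  have hdet2 : ∀ t : ℝ, det4 ((1 - t) • p + t • q) q n x = (1 - t) * det4 p q n x := fun t => by
    rw [det4_add_left, det4_smul_left, det4_smul_left, det4_self]; ring
  have hne : ∀ t : ℝ, (1 - t) • p + t • q ≠ 0 := fun t h0 => by
    have h1 := hdet1 t
    have h2 := hdet2 t
    rw [h0] at h1 h2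
    have z1 : det4 p 0 n x = 0 := by simp [det4_eq]
    have z2 : det4 0 q n x = 0 := by simp [det4_eq]
    rw [z1] at h1; rw [z2] at h2
    nlinarith
  have hc : Continuous (fun t : ℝ => det4 p q n x / ‖(1 - t) • p + t • q‖ ^ 2) :=
    continuous_const.div (by fun_prop) fun t => pow_ne_zero 2 (norm_ne_zero_iff.2 (hne t))
  refine ⟨(hc.integrableOn_Icc (a := 0) (b := 1)).mono_set Ioo_subset_Icc_self, ?_⟩
  have hang : ContinuousOn (fun t : ℝ => InnerProductGeometry.angle p ((1 - t) • p + t • q)) (Icc 0 1) :=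
    fun t _ => (ContinuousAt.comp (f := fun t : ℝ => (p, (1 - t) • p + t • q))
      (g := fun y : E4 × E4 => InnerProductGeometry.angle y.1 y.2)
      (InnerProductGeometry.continuousAt_angle hp0 (hne t)) (by fun_prop)).continuousWithinAt
  have hder : ∀ t ∈ Ioo (0:ℝ) 1, HasDerivAt
      (fun t : ℝ => InnerProductGeometry.angle p ((1 - t) • p + t • q))
      (det4 p q n x / ‖(1 - t) • p + t • q‖ ^ 2) t := fun t ht => by
    have hE : HasDerivAt (fun t : ℝ => (1 - t) • p + t • q) (q - p) t := by
      have e : (fun t : ℝ => (1 - t) • p + t • q) = fun t => p + t • (q - p) := by funext t; module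
      rw [e]
      simpa using ((hasDerivAt_id t).smul_const (q - p)).const_add p
    have := h.hasDerivAt_angle (hasDerivAt_const t p) hE hp ((hp.smul _).add (hq.smul _)) (by
      rw [hdet1]; exact mul_pos ht.1 hd)
    refine this.congr_deriv ?_
    have z1 : det4 p 0 n x = 0 := by simp [det4_eq]
    have e : det4 ((1 - t) • p + t • q) (q - p) n x = det4 p q n x := by
      rw [show q - p = q + (-1 : ℝ) • p by module, det4_add_right, det4_smul_right, hdet2,
        det4_swap p, hdet1]
      ring
    rw [z1, e]; ring
  have := intervalIntegral.integral_eq_sub_of_hasDerivAt_of_le zero_le_one hang hder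
    (hc.intervalIntegrable 0 1)
  rw [intervalIntegral.integral_of_le zero_le_one, integral_Ioc_eq_integral_Ioo] at this
  rw [this]
  simp [InnerProductGeometry.angle_self hp0]

lemma lintegral_gaussian_plane :
    ∫⁻ z : ℝ × ℝ, ENNReal.ofReal (Real.exp (-(z.1 ^ 2 + z.2 ^ 2))) = ENNReal.ofReal Real.pi := by
  have h1 : ∫⁻ x : ℝ, ENNReal.ofReal (Real.exp (-x ^ 2)) = ENNReal.ofReal (√Real.pi) := by
    have hi := integrable_exp_neg_mul_sq (b := 1) one_pos
    have hg := integral_gaussian 1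
    simp only [neg_mul, one_mul, div_one] at hi hg
    rw [← hg, ofReal_integral_eq_lintegral_ofReal hi (Eventually.of_forall fun x => (Real.exp_pos _).le)]
  simp only [neg_add, Real.exp_add]
  simp_rw [ENNReal.ofReal_mul (Real.exp_pos _).le]
  rw [Measure.volume_eq_prod, lintegral_prod_mul (f := fun x : ℝ => ENNReal.ofReal (Real.exp (-x ^ 2)))
    (g := fun x : ℝ => ENNReal.ofReal (Real.exp (-x ^ 2))) (by fun_prop) (by fun_prop), h1,
    ← ENNReal.ofReal_mul (Real.sqrt_nonneg _), Real.mul_self_sqrt Real.pi_pos.le]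

lemma volume_line (p : ℝ × ℝ) : volume {z : ℝ × ℝ | ∃ s : ℝ, z = s • p} = 0 := by
  have : {z : ℝ × ℝ | ∃ s : ℝ, z = s • p} = (Submodule.span ℝ {p} : Set (ℝ × ℝ)) := by
    ext z; simp [Submodule.mem_span_singleton, eq_comm]
  rw [this]
  refine Measure.addHaar_submodule _ _ fun htop => ?_
  have h1 := finrank_span_le_card (R := ℝ) ({p} : Set (ℝ × ℝ))
  rw [htop, finrank_top] at h1
  simp at h1

lemma OrthoPair.exists_frame {n x : E4} (h : OrthoPair n x) {p q : E4} (hp : Tang n x p)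
    (hq : Tang n x q) (hd : 0 < det4 p q n x) : ∃ e₁ e₂ : E4, Tang n x e₁ ∧ Tang n x e₂ ∧
      ‖e₁‖ = 1 ∧ ‖e₂‖ = 1 ∧ inner ℝ e₁ e₂ = (0:ℝ) ∧ det4 e₁ e₂ n x = 1 := by
  obtain ⟨hp0, -⟩ := ne_zero_of_det4_pos hd
  have hpn : ‖p‖ ≠ 0 := norm_ne_zero_iff.2 hp0
  set d := det4 p q n x with hdd
  set e₁ := ‖p‖⁻¹ • p with he1
  set e₂ := (‖p‖ / d) • (q + (-(inner ℝ p q / ‖p‖ ^ 2)) • p) with he2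
  have t1 : Tang n x e₁ := hp.smul _
  have t2 : Tang n x e₂ := (hq.add (hp.smul _)).smul _
  have n1 : ‖e₁‖ = 1 := by rw [he1, norm_smul, norm_inv, norm_norm, inv_mul_cancel₀ hpn]
  have i : inner ℝ e₁ e₂ = (0:ℝ) := by
    simp only [he1, he2, inner_smul_left, inner_smul_right, inner_add_right,
      real_inner_self_eq_norm_sq, conj_trivial]
    field_simp
    ring
  have dt : det4 e₁ e₂ n x = 1 := by
    rw [he1, he2, det4_smul_left, det4_smul_right, det4_add_right, det4_smul_right, det4_self, ← hdd]
    field_simp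
    ring
  refine ⟨e₁, e₂, t1, t2, n1, ?_, i, dt⟩
  have := h.det4_sq t1 t2
  rw [dt, i, n1] at this
  exact (pow_eq_one_iff_of_nonneg (norm_nonneg _) two_ne_zero).1 (by linarith)

/-- The angles of sectors that tile the tangent plane add up to `2π`. -/
theorem OrthoPair.sum_angle {n x : E4} (h : OrthoPair n x) {ι : Type*} (I : Finset ι) (p q : ι → E4)
    (hp : ∀ i ∈ I, Tang n x (p i)) (hq : ∀ i ∈ I, Tang n x (q i))
    (hd : ∀ i ∈ I, 0 < det4 (p i) (q i) n x)
    (hcover : ∀ w, Tang n x w → ∃ i ∈ I, ∃ s t : ℝ, 0 ≤ s ∧ 0 ≤ t ∧ w = s • p i + t • q i)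
    (hdisj : ∀ i ∈ I, ∀ j ∈ I, ∀ s t s' t' : ℝ, 0 < s → 0 < t → 0 < s' → 0 < t' →
      s • p i + t • q i = s' • p j + t' • q j → i = j) :
    ∑ i ∈ I, InnerProductGeometry.angle (p i) (q i) = 2 * Real.pi := by
  obtain ⟨i₀, hi₀, -⟩ := hcover 0 (by simp [Tang])
  obtain ⟨e₁, e₂, t1, t2, n1, n2, i12, dt⟩ := h.exists_frame (hp _ hi₀) (hq _ hi₀) (hd _ hi₀)
  let c : E4 → ℝ × ℝ := fun w => (inner ℝ w e₁, inner ℝ w e₂)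
  have hcadd : ∀ (s t : ℝ) (v w : E4), c (s • v + t • w) = s • c v + t • c w := fun s t v w => by
    simp [c, inner_add_left, inner_smul_left]
  have hexp : ∀ w, Tang n x w → w = (c w).1 • e₁ + (c w).2 • e₂ := fun w hw => by
    have := h.eq_comb t1 t2 hw (by rw [dt]; exact one_ne_zero)
    have g1 := h.gram w e₂ e₁ e₂ t1 t2
    have g2 := h.gram e₁ w e₁ e₂ t1 t2
    rw [dt, mul_one, real_inner_self_eq_norm_sq, n2, real_inner_comm e₁ e₂, i12] at g1
    rw [dt, mul_one, real_inner_self_eq_norm_sq, n1, i12] at g2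
    rw [dt, g1, g2] at this
    simpa [c] using this
  have hc : ∀ z : ℝ × ℝ, Tang n x (z.1 • e₁ + z.2 • e₂) ∧ c (z.1 • e₁ + z.2 • e₂) = z := fun z => by
    refine ⟨(t1.smul _).add (t2.smul _), ?_⟩
    simp [c, inner_add_left, inner_smul_left, n1, n2, i12, real_inner_comm e₁ e₂]
  have hinj : ∀ v w, Tang n x v → Tang n x w → c v = c w → v = w := fun v w hv hw he => by
    rw [hexp v hv, hexp w hw, he]
  have hdet : ∀ i ∈ I, (c (p i)).1 * (c (q i)).2 - (c (p i)).2 * (c (q i)).1 = det4 (p i) (q i) n x := by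
    intro i hi
    have := h.gram (p i) (q i) e₁ e₂ t1 t2
    rw [dt, mul_one] at this
    rw [this]
  have hnorm : ∀ w, Tang n x w → (c w).1 ^ 2 + (c w).2 ^ 2 = ‖w‖ ^ 2 := fun w hw => by
    have : ‖w‖ ^ 2 = ‖(c w).1 • e₁ + (c w).2 • e₂‖ ^ 2 := by rw [← hexp w hw]
    rw [this, ← real_inner_self_eq_norm_sq]
    simp only [inner_add_left, inner_add_right, inner_smul_left, inner_smul_right,
      real_inner_self_eq_norm_sq, n1, n2, i12, real_inner_comm e₁ e₂, conj_trivial]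
    ring
  -- The Gaussian weight has mass angle/2 on a sector and π on the plane, so additivity of measure
  -- replaces any cyclic ordering of the sectors.
  let f : ℝ × ℝ → ENNReal := fun z => ENNReal.ofReal (Real.exp (-(z.1 ^ 2 + z.2 ^ 2)))
  have hsec : ∀ i ∈ I, ∫⁻ z in sector (c (p i)) (c (q i)), f z =
      ENNReal.ofReal (InnerProductGeometry.angle (p i) (q i) / 2) := fun i hi => by
    obtain ⟨hint, hval⟩ := h.integral_chord (hp i hi) (hq i hi) (hd i hi)
    have hd' := hd i hi
    rw [lintegral_sector (by rw [hdet i hi]; exact hd i hi), ← hval, ← integral_div,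
      ofReal_integral_eq_lintegral_ofReal (hint.div_const 2)
        (Eventually.of_forall fun t => by dsimp only; positivity)]
    refine lintegral_congr fun t => ?_
    rw [hdet i hi, div_div, mul_comm _ (2:ℝ), ← hnorm _ (((hp i hi).smul _).add ((hq i hi).smul _)), hcadd]
    rfl
  have hmeas : ∀ i ∈ I, MeasurableSet (sector (c (p i)) (c (q i))) := fun i hi =>
    (isOpen_sector (by rw [hdet i hi]; exact (hd i hi).ne')).measurableSet
  have hpd : Set.PairwiseDisjoint (I : Set ι) fun i => sector (c (p i)) (c (q i)) := by
    intro i hi j hj hij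
    refine Set.disjoint_left.2 ?_
    rintro z ⟨s, t, hs, ht, rfl⟩ ⟨s', t', hs', ht', he⟩
    rw [← hcadd, ← hcadd] at he
    exact hij (hdisj i hi j hj s t s' t' hs ht hs' ht' (hinj _ _
      (((hp i hi).smul _).add ((hq i hi).smul _)) (((hp j hj).smul _).add ((hq j hj).smul _)) he))
  -- A point outside all open sectors is on a boundary ray of some closed one, by the covering
  -- hypothesis.
  have hnull : volume (⋃ i ∈ I, sector (c (p i)) (c (q i)))ᶜ = 0 := by
    refine measure_mono_null (t := ⋃ i ∈ I, ({z | ∃ s : ℝ, z = s • c (p i)} ∪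
      {z | ∃ s : ℝ, z = s • c (q i)})) ?_ ((measure_biUnion_null_iff I.countable_toSet).2 fun i _ =>
        measure_union_null (volume_line _) (volume_line _))
    intro z hz
    obtain ⟨i, hi, s, t, hs, ht, he⟩ := hcover _ (hc z).1
    have he' : z = s • c (p i) + t • c (q i) := by rw [← hcadd, ← he, (hc z).2]
    refine mem_biUnion hi ?_
    rcases hs.eq_or_lt with rfl | hs
    · right; exact ⟨t, by simpa using he'⟩
    rcases ht.eq_or_lt with rfl | ht
    · left; exact ⟨s, by simpa using he'⟩
    exact (hz (mem_iUnion₂.2 ⟨i, hi, s, t, hs, ht, he'⟩)).elim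
  have htot : ∫⁻ z in ⋃ i ∈ I, sector (c (p i)) (c (q i)), f z = ENNReal.ofReal Real.pi := by
    rw [← lintegral_gaussian_plane]
    exact (setLIntegral_congr (ae_eq_univ.2 hnull)).trans (setLIntegral_univ _)
  rw [lintegral_biUnion_finset hpd hmeas, Finset.sum_congr rfl hsec,
    ← ENNReal.ofReal_sum_of_nonneg fun i _ => div_nonneg (InnerProductGeometry.angle_nonneg _ _) two_pos.le,
    ENNReal.ofReal_eq_ofReal_iff (Finset.sum_nonneg fun i _ =>
      div_nonneg (InnerProductGeometry.angle_nonneg _ _) two_pos.le) Real.pi_pos.le,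
    ← Finset.sum_div] at htot
  linarith

/-! ### Directions at a point and the triangles that contain them -/

/-- A continuous injection of a compact set into a Hausdorff space is an embedding: each cluster
point of the arguments has the image of `u`, hence is `u`. -/
lemma IsCompact.tendsto_of_tendsto_comp {X Y α : Type*} [TopologicalSpace X] [TopologicalSpace Y]
    [T2Space Y] {s : Set X} (hs : IsCompact s) {f : X → Y} (hf : ContinuousOn f s)
    (hinj : InjOn f s) {u : X} (hu : u ∈ s) {l : Filter α} {v : α → X} (hv : ∀ᶠ r in l, v r ∈ s)
    (ht : Tendsto (fun r => f (v r)) l (𝓝 (f u))) : Tendsto v l (𝓝 u) := by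
  refine hs.tendsto_nhds_of_unique_mapClusterPt hv fun y hy hcl => ?_
  obtain ⟨U, hU, hUy⟩ := mapClusterPt_iff_ultrafilter.1 hcl
  have h1 : Tendsto v U (𝓝[s] y) := tendsto_nhdsWithin_iff.2 ⟨hUy, hU hv⟩
  exact hinj hy hu (tendsto_nhds_unique ((hf y hy).tendsto.comp h1) (ht.mono_left hU))

/-- If the values of a map with injective differential have a direction, so do the arguments. -/
lemma HasFDerivWithinAt.tendsto_of_injective {E F : Type*} [NormedAddCommGroup E]
    [NormedSpace ℝ E] [FiniteDimensional ℝ E] [NormedAddCommGroup F] [NormedSpace ℝ F] {f : E → F}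
    {L : E →L[ℝ] F} {s : Set E} {u ζ : E} (hf : HasFDerivWithinAt f L s u) (hL : ∀ w, L w = 0 → w = 0)
    {l : Filter ℝ} {v : ℝ → E} (hv : ∀ᶠ r in l, v r ∈ s)
    (hvu : Tendsto v l (𝓝 u)) (ht : Tendsto (fun r => r⁻¹ • (f (v r) - f u)) l (𝓝 (L ζ))) :
    Tendsto (fun r => r⁻¹ • (v r - u)) l (𝓝 ζ) := by
  obtain ⟨K, -, hK⟩ := (L : E →ₗ[ℝ] F).exists_antilipschitzWith
    (LinearMap.ker_eq_bot'.2 fun w hw => hL w hw)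
  have hK' : AntilipschitzWith K L := hK
  have h1 : Tendsto v l (𝓝[s] u) := tendsto_nhdsWithin_iff.2 ⟨hvu, hv⟩
  have ho := hf.isLittleO.comp_tendsto h1
  have hG : (fun r => r⁻¹ • (f (v r) - f u - L (v r - u))) =o[l] fun r => r⁻¹ • (v r - u) :=
    (Asymptotics.isBigO_refl (fun r : ℝ => r⁻¹) l).smul_isLittleO ho
  have hY : ∀ w, ‖w‖ ≤ K * ‖L w‖ := fun w => by simpa using hK'.le_mul_dist w 0
  have hO : (fun r => r⁻¹ • (v r - u)) =O[l] fun r => L (r⁻¹ • (v r - u)) :=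
    Asymptotics.IsBigO.of_bound K (Eventually.of_forall fun r => hY _)
  have hsum : (fun r => r⁻¹ • (f (v r) - f u - L (v r - u)) + L (r⁻¹ • (v r - u))) =
      fun r => r⁻¹ • (f (v r) - f u) := by
    funext r
    simp only [map_smul, ← smul_add, sub_add_cancel]
  -- The remainder is negligible against the scaled increment of the arguments, which is bounded by
  -- its image under `L`. It can therefore be absorbed: the arguments are controlled by the values,
  -- and the remainder tends to zero.
  have hYO := (hG.trans_isBigO hO).right_isBigO_add
  rw [hsum] at hYO
  have hG0 : Tendsto (fun r => r⁻¹ • (f (v r) - f u - L (v r - u))) l (𝓝 0) :=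
    (Asymptotics.isLittleO_one_iff ℝ).1 (hG.trans_isBigO (hO.trans (hYO.trans (ht.isBigO_one ℝ))))
  have hlim : Tendsto (fun r => L (r⁻¹ • (v r - u))) l (𝓝 (L ζ)) := by
    have := ht.sub hG0
    rw [sub_zero] at this
    refine this.congr fun r => ?_
    rw [sub_eq_iff_eq_add']
    exact (congrFun hsum r).symm
  rw [tendsto_iff_dist_tendsto_zero] at hlim ⊢
  have := hlim.const_mul (K:ℝ)
  rw [mul_zero] at this
  exact squeeze_zero (fun _ => dist_nonneg) (fun r => hK'.le_mul_dist _ _) this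

namespace TubularSurface

open SmoothTriangulation

variable {S A A' : Set E4} {N : E4 → E4} {ε : ℝ} (h : TubularSurface S A A' N ε)
  {τ : SmoothTriangulation S}

include h

lemma mem_coneDom {q : E4} (hq : q ∈ S) : q ∈ coneDom S N ε := by
  have := h.conePt_mem_coneDom hq (t := 0) (by simpa using h.eps_pos) one_pos
  simpa [conePt] using this

lemma coneFoot_of_mem {q : E4} (hq : q ∈ S) : coneFoot S N ε q = q := by
  have := h.coneFoot_conePt hq (t := 0) (by simpa using h.eps_pos) one_pos
  simpa [conePt] using this

lemma hasFDerivAt_coneFoot {q : E4} (hq : q ∈ S) :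
    HasFDerivAt (coneFoot S N ε) (fderiv ℝ (coneFoot S N ε) q) q :=
  ((h.contDiffOn_coneFoot.contDiffAt (h.isOpen_coneDom.mem_nhds (h.mem_coneDom hq))).differentiableAt
    (by simp)).hasFDerivAt

lemma exists_fderivWithin_patch {a b c : τ.V} (ht : τ.IsTri a b c) {u : ℝ × ℝ} (hu : u ∈ stdTri)
    {w : E4} (hw : Tang (N ((τ.toFun ∘ triPt a b c) u)) ((τ.toFun ∘ triPt a b c) u) w) :
    ∃ ζ, fderivWithin ℝ (τ.toFun ∘ triPt a b c) stdTri u ζ = w := by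
  have := (h.ortho_patch ht hu).eq_comb (h.tang_patch ht hu (1, 0)) (h.tang_patch ht hu (0, 1)) hw
    (h.det4_patch_ne_zero ht hu)
  rw [← map_smul, ← map_smul, ← map_add] at this
  exact ⟨_, this.symm⟩

/-- The foot point map is the identity to first order along the surface. -/
lemma fderiv_coneFoot_of_tang {x : τ.V} (hx : x ∈ τ.K.space) {w : E4}
    (hw : Tang (N (τ.toFun x)) (τ.toFun x) w) :
    fderiv ℝ (coneFoot S N ε) (τ.toFun x) w = w := by
  obtain ⟨a, b, c, ht, hxt⟩ := h.exists_isTri hx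
  obtain ⟨u, hu, rfl⟩ := (mem_convexHull_triple ht.ab ht.ac ht.bc).1 hxt
  obtain ⟨ζ, rfl⟩ := h.exists_fderivWithin_patch ht.toIsTri hu hw
  have hF := (ht.contDiffOn_patch.differentiableOn (by simp) u hu).hasFDerivWithinAt
  have h1 := (h.hasFDerivAt_coneFoot (ht.mapsTo_patch hu)).comp_hasFDerivWithinAt u hF
  have h2 := h1.congr (f₁ := τ.toFun ∘ triPt a b c)
    (fun v hv => (h.coneFoot_of_mem (ht.mapsTo_patch hv)).symm)
    (h.coneFoot_of_mem (ht.mapsTo_patch hu)).symm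
  have := (uniqueDiffOn_stdTri u hu).eq h2 hF
  exact congrArg (fun A => A ζ) this

lemma tendsto_coneFoot {x : τ.V} (hx : x ∈ τ.K.space) {w : E4}
    (hw : Tang (N (τ.toFun x)) (τ.toFun x) w) {l : Filter ℝ} (hl : l ≤ 𝓝[>] 0) {z : ℝ → E4}
    (hz : Tendsto (fun r => r⁻¹ • (z r - τ.toFun x)) l (𝓝 w)) :
    Tendsto z l (𝓝 (τ.toFun x)) ∧
      Tendsto (fun r => r⁻¹ • (coneFoot S N ε (z r) - τ.toFun x)) l (𝓝 w) := by
  have hxS := τ.bijOn.mapsTo hx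
  have hr0 : Tendsto (fun r : ℝ => r) l (𝓝 0) := hl.trans nhdsWithin_le_nhds
  have hpos : ∀ᶠ r in l, (0:ℝ) < r := hl self_mem_nhdsWithin
  have hd : Tendsto (fun r => z r - τ.toFun x) l (𝓝 0) := by
    have := hr0.smul hz
    rw [zero_smul] at this
    refine this.congr' (hpos.mono fun r hr => ?_)
    rw [smul_smul, mul_inv_cancel₀ hr.ne', one_smul]
  refine ⟨by simpa using hd.add_const (τ.toFun x), ?_⟩
  have := ((h.hasFDerivAt_coneFoot hxS).hasFDerivWithinAt (s := univ)).lim hd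
    (Eventually.of_forall fun _ => mem_univ _) hz
  rw [h.fderiv_coneFoot_of_tang hx hw, h.coneFoot_of_mem hxS] at this
  simpa using this

/-- A direction of approach in the surface pulls back to the parameter triangle. This holds at
boundary points too, and along any filter of positive times tending to 0. -/
lemma tendsto_patch {a b c : τ.V} (ht : τ.IsTri a b c) {u : ℝ × ℝ} (hu : u ∈ stdTri)
    {ζ : ℝ × ℝ} {l : Filter ℝ} {v : ℝ → ℝ × ℝ} (hl : l ≤ 𝓝[>] 0) (hv : ∀ᶠ r in l, v r ∈ stdTri)
    (hlim : Tendsto (fun r => r⁻¹ • ((τ.toFun ∘ triPt a b c) (v r) - (τ.toFun ∘ triPt a b c) u)) l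
      (𝓝 (fderivWithin ℝ (τ.toFun ∘ triPt a b c) stdTri u ζ))) :
    Tendsto (fun r => r⁻¹ • (v r - u)) l (𝓝 ζ) := by
  have hx := hull_subset ht.mem (ht.triPt_mem hu)
  have h1 := (h.tendsto_coneFoot hx (h.tang_patch ht hu ζ) hl hlim).1
  exact (ht.contDiffOn_patch.differentiableOn (by simp) u hu).hasFDerivWithinAt.tendsto_of_injective
    (fun w hw => ht.fderivWithin_patch_injective hu hw) hv
    (isCompact_stdTri.tendsto_of_tendsto_comp ht.contDiffOn_patch.continuousOn ht.injOn_patch hu hv h1)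
    hlim

omit h in
lemma finite_vertices : {a : τ.V | {a} ∈ τ.K.faces}.Finite :=
  τ.finite_faces.preimage (f := fun a : τ.V => ({a} : Finset τ.V))
    (Finset.singleton_injective.injOn)

omit h in
lemma finite_posTri : {t : τ.V × τ.V × τ.V | τ.PosTri N t.1 t.2.1 t.2.2}.Finite := by
  refine (finite_vertices.prod (finite_vertices.prod finite_vertices)).subset ?_
  rintro ⟨a, b, c⟩ ht
  exact ⟨τ.K.down_closed ht.mem (by simp) (by simp), τ.K.down_closed ht.mem (by simp) (by simp),
    τ.K.down_closed ht.mem (by simp) (by simp)⟩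

/-- Every tangent vector points into one of the triangles at the point. Here `R` fixes the order
of the vertices. -/
lemma exists_direction {x : τ.V} (hx : x ∈ τ.K.space) {w : E4}
    (hw : Tang (N (τ.toFun x)) (τ.toFun x) w) {R : τ.V → τ.V → τ.V → Prop}
    (hR : ∀ a b c, τ.PosTri N a b c → x ∈ τ.hull {a, b, c} →
      ∃ a' b' c', R a' b' c' ∧ τ.IsTri a' b' c' ∧ ({a', b', c'} : Finset τ.V) = {a, b, c}) :
    ∃ a b c, R a b c ∧ τ.IsTri a b c ∧ ∃ u ∈ stdTri, triPt a b c u = x ∧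
      ∃ ζ, fderivWithin ℝ (τ.toFun ∘ triPt a b c) stdTri u ζ = w ∧
      ∃ (l : Filter ℝ) (v : ℝ → ℝ × ℝ), l.NeBot ∧ l ≤ 𝓝[>] 0 ∧ (∀ᶠ r in l, v r ∈ stdTri) ∧
        Tendsto (fun r => r⁻¹ • (v r - u)) l (𝓝 ζ) := by
  have hxS := τ.bijOn.mapsTo hx
  have hz : Tendsto (fun r : ℝ => r⁻¹ • ((τ.toFun x + r • w) - τ.toFun x)) (𝓝[>] 0) (𝓝 w) := by
    refine tendsto_const_nhds.congr' (eventually_nhdsWithin_of_forall fun r hr => ?_)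
    dsimp only
    rw [add_sub_cancel_left, smul_smul, inv_mul_cancel₀ (ne_of_gt hr), one_smul]
  obtain ⟨h1, h2⟩ := h.tendsto_coneFoot hx hw le_rfl hz
  -- The retraction turns the straight ray into a curve in the surface with initial velocity `w`.
  let γ : ℝ → E4 := fun r => coneFoot S N ε (τ.toFun x + r • w)
  have hγS : ∀ᶠ r in 𝓝[>] (0:ℝ), γ r ∈ S :=
    (h1.eventually (h.isOpen_coneDom.mem_nhds (h.mem_coneDom hxS))).mono fun r hr =>
      (h.eq_of_mem_coneDom hr).1
  have hγ0 : Tendsto γ (𝓝[>] 0) (𝓝 (τ.toFun x)) := by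
    have := (h.hasFDerivAt_coneFoot hxS).continuousAt.tendsto.comp h1
    rwa [h.coneFoot_of_mem hxS] at this
  -- Finitely many triangles cover the surface, so one of them contains the curve at arbitrarily
  -- small times.
  have hfreq : ∃ t ∈ {t : τ.V × τ.V × τ.V | τ.PosTri N t.1 t.2.1 t.2.2},
      ∃ᶠ r in 𝓝[>] (0:ℝ), γ r ∈ (τ.toFun ∘ triPt t.1 t.2.1 t.2.2) '' stdTri := by
    by_contra! hno
    have hall := (eventually_all_finite (finite_posTri (τ := τ) (N := N))).2
      hno
    obtain ⟨r, hr1, hr2⟩ := (hall.and hγS).exists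
    obtain ⟨y, hy, hyr⟩ := τ.bijOn.surjOn hr2
    obtain ⟨a, b, c, ht, hyt⟩ := h.exists_isTri (N := N) hy
    refine hr1 (a, b, c) ht ?_
    simp only [ht.toIsTri.image_patch]
    exact ⟨y, hyt, hyr⟩
  obtain ⟨⟨a, b, c⟩, ht, hf⟩ := hfreq
  have ht : τ.PosTri N a b c := ht
  -- Only the times spent in that triangle are kept.
  let l : Filter ℝ := 𝓝[>] 0 ⊓ 𝓟 {r | γ r ∈ (τ.toFun ∘ triPt a b c) '' stdTri}
  have hl : l ≤ 𝓝[>] 0 := inf_le_left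
  have hne : l.NeBot := frequently_mem_iff_neBot.1 hf
  have hmem : ∀ᶠ r in l, γ r ∈ (τ.toFun ∘ triPt a b c) '' stdTri :=
    mem_inf_of_right (mem_principal_self _)
  have hcl : IsClosed ((τ.toFun ∘ triPt a b c) '' stdTri) :=
    (isCompact_stdTri.image_of_continuousOn ht.contDiffOn_patch.continuousOn).isClosed
  have hxh : x ∈ τ.hull {a, b, c} := by
    have := hcl.mem_of_tendsto (hγ0.mono_left hl) hmem
    rw [ht.toIsTri.image_patch] at this
    obtain ⟨y, hy, hyx⟩ := this
    rwa [← τ.bijOn.injOn (hull_subset ht.mem hy) hx hyx]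
  obtain ⟨a', b', c', hR', ht', he⟩ := hR a b c ht hxh
  rw [ht.toIsTri.image_patch, ← he, ← ht'.image_patch] at hmem
  rw [← he] at hxh
  obtain ⟨u, hu, rfl⟩ := (mem_convexHull_triple ht'.ab ht'.ac ht'.bc).1 hxh
  obtain ⟨ζ, hζ⟩ := h.exists_fderivWithin_patch ht' hu hw
  obtain ⟨v, hv⟩ := hmem.choice
  refine ⟨a', b', c', hR', ht', u, hu, rfl, ζ, hζ, l, v, hne, hl, hv.mono fun r hr => hr.1, ?_⟩
  refine h.tendsto_patch ht' hu hl (hv.mono fun r hr => hr.1) ?_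
  rw [hζ]
  exact (h2.mono_left hl).congr' (hv.mono fun r hr => by dsimp only; rw [hr.2]; rfl)

/-- Different triangles do not share interior directions. -/
lemma direction_unique {a b c a' b' c' : τ.V} (ht : τ.IsTri a b c) (ht' : τ.IsTri a' b' c')
    (hne : ¬ ({a, b, c} : Finset τ.V) ⊆ {a', b', c'}) {u u' : ℝ × ℝ} (hu : u ∈ stdTri)
    (hu' : u' ∈ stdTri) (hx : triPt a b c u = triPt a' b' c' u') {ζ ζ' : ℝ × ℝ}
    (hζ : ∀ᶠ z : ℝ × (ℝ × ℝ) in 𝓝[>] 0 ×ˢ 𝓝 ζ, u + z.1 • z.2 ∈ openTri)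
    (hζ' : ∀ᶠ z : ℝ × (ℝ × ℝ) in 𝓝[>] 0 ×ˢ 𝓝 ζ', u' + z.1 • z.2 ∈ openTri)
    (he : fderivWithin ℝ (τ.toFun ∘ triPt a b c) stdTri u ζ =
      fderivWithin ℝ (τ.toFun ∘ triPt a' b' c') stdTri u' ζ') : False := by
  have hxK := hull_subset ht.mem (ht.triPt_mem hu)
  have hxS := τ.bijOn.mapsTo hxK
  set P := τ.toFun (triPt a b c u) with hP
  set w := fderivWithin ℝ (τ.toFun ∘ triPt a b c) stdTri u ζ with hw
  have hwt : Tang (N P) P w := h.tang_patch ht hu ζ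
  let f : ℝ → E4 := fun r => (τ.toFun ∘ triPt a b c) (u + r • ζ)
  let f' : ℝ → E4 := fun r => (τ.toFun ∘ triPt a' b' c') (u' + r • ζ')
  have hpair : ∀ ζ : ℝ × ℝ, Tendsto (fun r : ℝ => (r, ζ)) (𝓝[>] 0) (𝓝[>] 0 ×ˢ 𝓝 ζ) := fun ζ =>
    tendsto_id.prodMk tendsto_const_nhds
  have hin : ∀ᶠ r in 𝓝[>] (0:ℝ), u + r • ζ ∈ openTri := (hpair ζ).eventually hζ
  have hin' : ∀ᶠ r in 𝓝[>] (0:ℝ), u' + r • ζ' ∈ openTri := (hpair ζ').eventually hζ'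
  have hsm : ∀ ζ : ℝ × ℝ, Tendsto (fun r : ℝ => r • ζ) (𝓝[>] 0) (𝓝 0) := fun ζ => by
    have : Tendsto (fun r : ℝ => r • ζ) (𝓝 0) (𝓝 ((0:ℝ) • ζ)) :=
      (continuous_id.smul continuous_const).tendsto 0
    rw [zero_smul] at this
    exact this.mono_left nhdsWithin_le_nhds
  have hcs : ∀ ζ : ℝ × ℝ, Tendsto (fun r : ℝ => r⁻¹ • r • ζ) (𝓝[>] 0) (𝓝 ζ) := fun ζ => by
    refine tendsto_const_nhds.congr' (eventually_nhdsWithin_of_forall fun r hr => ?_)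
    dsimp only
    rw [smul_smul, inv_mul_cancel₀ (ne_of_gt hr), one_smul]
  have hf : Tendsto (fun r => r⁻¹ • (f r - P)) (𝓝[>] 0) (𝓝 w) :=
    (ht.contDiffOn_patch.differentiableOn (by simp) u hu).hasFDerivWithinAt.lim (hsm ζ)
      (hin.mono fun r hr => openTri_subset hr) (hcs ζ)
  have hf' : Tendsto (fun r => r⁻¹ • (f' r - P)) (𝓝[>] 0) (𝓝 w) := by
    have := (ht'.contDiffOn_patch.differentiableOn (by simp) u' hu').hasFDerivWithinAt.lim (hsm ζ')
      (hin'.mono fun r hr => openTri_subset hr) (hcs ζ')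
    rw [← he] at this
    rw [hP, hx]
    exact this
  -- a closed set cover of the surface
  let C : Set E4 := ⋃ s ∈ {s ∈ τ.K.faces | ¬ {a, b, c} ⊆ s}, τ.toFun '' τ.hull s
  let D : Set E4 := (τ.toFun ∘ triPt a b c) '' stdTri
  have hC : IsClosed C := (τ.finite_faces.subset (sep_subset _ _)).isClosed_biUnion fun s hs =>
    (h.isCompact_image_hull hs.1).isClosed
  have hD : IsClosed D :=
    (isCompact_stdTri.image_of_continuousOn ht.contDiffOn_patch.continuousOn).isClosed
  have hcov : S ⊆ D ∪ C := by
    intro q hq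
    obtain ⟨y, hy, rfl⟩ := τ.bijOn.surjOn hq
    obtain ⟨s, hs, hys⟩ := (Geometry.SimplicialComplex.mem_space_iff).1 hy
    by_cases hsub : {a, b, c} ⊆ s
    · left
      have : ({a, b, c} : Finset τ.V) = s := Finset.eq_of_subset_of_card_le hsub (by
        rw [Finset.card_eq_three.2 ⟨a, b, c, ht.ab, ht.ac, ht.bc, rfl⟩]; exact h.card_le_three hs)
      subst this
      change _ ∈ (τ.toFun ∘ triPt a b c) '' stdTri
      rw [ht.image_patch]
      exact ⟨y, hys, rfl⟩
    · right; exact mem_biUnion (x := s) ⟨hs, hsub⟩ ⟨y, hys, rfl⟩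
  have hCo : ∀ v ∈ stdTri, (τ.toFun ∘ triPt a b c) v ∈ C → v ∉ openTri := by
    intro v hv hvC hvo
    obtain ⟨s, hs, y, hy, hyv⟩ := mem_iUnion₂.1 hvC
    rw [τ.bijOn.injOn (hull_subset hs.1 hy) (hull_subset ht.mem (ht.triPt_mem hv)) hyv] at hy
    exact hs.2 (ht.subset_of_openTri hvo hs.1 hy)
  obtain ⟨δ, hδ, hball⟩ := Metric.isOpen_iff.1 h.isOpen_coneDom P (h.mem_coneDom hxS)
  have hfP := (h.tendsto_coneFoot hxK hwt le_rfl hf).1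
  have hfP' := (h.tendsto_coneFoot hxK hwt le_rfl hf').1
  -- The retracted segment from `f r` to `f' r` is a connected subset of the surface joining the
  -- first triangle to another face. It meets the closed set `D ∩ C`, whose points have parameters
  -- outside the open triangle.
  have hex : ∀ᶠ r in 𝓝[>] (0:ℝ), ∃ y : ℝ × (ℝ × ℝ), y.1 ∈ Icc (0:ℝ) 1 ∧ y.2 ∈ stdTri ∧
      y.2 ∉ openTri ∧ (τ.toFun ∘ triPt a b c) y.2 = coneFoot S N ε (f r + y.1 • (f' r - f r)) := by
    filter_upwards [hin, hin', hfP.eventually (Metric.ball_mem_nhds P hδ),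
      hfP'.eventually (Metric.ball_mem_nhds P hδ)] with r h1 h2 h3 h4
    have hseg : segment ℝ (f r) (f' r) ⊆ coneDom S N ε :=
      ((convex_ball P δ).segment_subset h3 h4).trans hball
    have hX : IsPreconnected (coneFoot S N ε '' segment ℝ (f r) (f' r)) :=
      (convex_segment _ _).isPreconnected.image _ (h.contDiffOn_coneFoot.continuousOn.mono hseg)
    have hXS : coneFoot S N ε '' segment ℝ (f r) (f' r) ⊆ S := by
      rintro _ ⟨z, hz, rfl⟩; exact (h.eq_of_mem_coneDom (hseg hz)).1
    have hfD : f r ∈ D := mem_image_of_mem _ (openTri_subset h1)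
    have hfC : f' r ∈ C := mem_biUnion (x := {a', b', c'}) ⟨ht'.mem, hne⟩
      (mem_image_of_mem τ.toFun (ht'.triPt_mem (openTri_subset h2)))
    obtain ⟨y, ⟨z, hz, rfl⟩, ⟨v, hv, hvy⟩, hyC⟩ := isPreconnected_closed_iff.1 hX D C hD hC
      (hXS.trans hcov)
      ⟨f r, ⟨f r, left_mem_segment _ _ _, h.coneFoot_of_mem (ht.mapsTo_patch (openTri_subset h1))⟩, hfD⟩
      ⟨f' r, ⟨f' r, right_mem_segment _ _ _, h.coneFoot_of_mem (ht'.mapsTo_patch (openTri_subset h2))⟩, hfC⟩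
    rw [segment_eq_image'] at hz
    obtain ⟨θ, hθ, rfl⟩ := hz
    exact ⟨(θ, v), hθ, hv, hCo v hv (by rw [hvy]; exact hyC), hvy⟩
  obtain ⟨y, hy⟩ := hex.choice
  -- Both endpoints leave P with velocity `w`, hence so does any point of the segment between them.
  -- The parameters of the crossing point then leave `u` in the direction ζ and must enter the open
  -- triangle, a contradiction.
  have hz : Tendsto (fun r => r⁻¹ • (f r + (y r).1 • (f' r - f r) - P)) (𝓝[>] 0) (𝓝 w) := by
    have h0 : Tendsto (fun r => (y r).1 • (r⁻¹ • (f' r - P) - r⁻¹ • (f r - P))) (𝓝[>] 0) (𝓝 0) := by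
      have h1 := (hf'.sub hf).norm
      rw [sub_self, norm_zero] at h1
      refine squeeze_zero_norm' (hy.mono fun r hr => ?_) h1
      rw [norm_smul, Real.norm_of_nonneg hr.1.1]
      exact mul_le_of_le_one_left (norm_nonneg _) hr.1.2
    have h1 := hf.add h0
    rw [add_zero] at h1
    refine h1.congr fun r => ?_
    module
  have h2 := (h.tendsto_coneFoot hxK hwt le_rfl hz).2
  have h3 := h.tendsto_patch ht hu (v := fun r => (y r).2) (ζ := ζ) le_rfl (hy.mono fun r hr => hr.2.1)
    (h2.congr' (hy.mono fun r hr => by dsimp only; rw [hr.2.2.2]; rfl))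
  have h4 : Tendsto (fun r : ℝ => (r, r⁻¹ • ((y r).2 - u))) (𝓝[>] 0) (𝓝[>] 0 ×ˢ 𝓝 ζ) :=
    tendsto_id.prodMk h3
  obtain ⟨r, hr1, hr2, hr3⟩ := ((h4.eventually hζ).and (hy.and self_mem_nhdsWithin)).exists
  have hr3 : (0:ℝ) < r := hr3
  rw [smul_smul, mul_inv_cancel₀ hr3.ne', one_smul, add_sub_cancel] at hr1
  exact hr2.2.2.1 hr1

end TubularSurface

namespace SmoothTriangulation

variable {S : Set E4} {τ : SmoothTriangulation S}

lemma triPt_zero {V : Type*} [AddCommGroup V] [Module ℝ V] (a b c : V) : triPt a b c (0, 0) = a := by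
  simp [triPt]

lemma triPt_mid {V : Type*} [AddCommGroup V] [Module ℝ V] (a b c : V) :
    triPt a b c (1 / 2, 0) = (1 / 2 : ℝ) • a + (1 / 2 : ℝ) • b := by
  simp only [triPt]; module

lemma zero_mem_stdTri : ((0, 0) : ℝ × ℝ) ∈ stdTri := by simp [stdTri]

lemma mid_mem_stdTri : ((1 / 2, 0) : ℝ × ℝ) ∈ stdTri := by norm_num [stdTri]

/-- The product filter lets the direction vary with the time, as `direction_unique` requires: its
crossing points only have ζ as limiting direction. -/
lemma eventually_corner {ζ : ℝ × ℝ} (h1 : 0 < ζ.1) (h2 : 0 < ζ.2) :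
    ∀ᶠ z : ℝ × (ℝ × ℝ) in 𝓝[>] 0 ×ˢ 𝓝 ζ, ((0, 0) : ℝ × ℝ) + z.1 • z.2 ∈ openTri := by
  have hle : 𝓝[>] (0:ℝ) ×ˢ 𝓝 ζ ≤ 𝓝 ((0:ℝ), ζ) := by
    rw [nhds_prod_eq (x := (0:ℝ))]; exact Filter.prod_mono nhdsWithin_le_nhds le_rfl
  have c1 : Continuous fun z : ℝ × (ℝ × ℝ) => z.2.1 := by fun_prop
  have c2 : Continuous fun z : ℝ × (ℝ × ℝ) => z.2.2 := by fun_prop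
  have c3 : Continuous fun z : ℝ × (ℝ × ℝ) => z.1 * z.2.1 + z.1 * z.2.2 := by fun_prop
  have e0 : ∀ᶠ z : ℝ × (ℝ × ℝ) in 𝓝[>] 0 ×ˢ 𝓝 ζ, 0 < z.1 :=
    (tendsto_fst : Tendsto Prod.fst (𝓝[>] (0:ℝ) ×ˢ 𝓝 ζ) (𝓝[>] 0)).eventually self_mem_nhdsWithin
  filter_upwards [e0, hle ((c1.tendsto (0, ζ)).eventually_const_lt h1),
    hle ((c2.tendsto (0, ζ)).eventually_const_lt h2),
    hle ((c3.tendsto (0, ζ)).eventually_lt_const (show _ < (1:ℝ) by simp))] with z e0 e1 e2 e3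
  exact ⟨by simpa using mul_pos e0 e1, by simpa using mul_pos e0 e2, by simpa using e3⟩

lemma eventually_edge {ζ : ℝ × ℝ} (h2 : 0 < ζ.2) :
    ∀ᶠ z : ℝ × (ℝ × ℝ) in 𝓝[>] 0 ×ˢ 𝓝 ζ, ((1 / 2, 0) : ℝ × ℝ) + z.1 • z.2 ∈ openTri := by
  have hle : 𝓝[>] (0:ℝ) ×ˢ 𝓝 ζ ≤ 𝓝 ((0:ℝ), ζ) := by
    rw [nhds_prod_eq (x := (0:ℝ))]; exact Filter.prod_mono nhdsWithin_le_nhds le_rfl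
  have c1 : Continuous fun z : ℝ × (ℝ × ℝ) => 1 / 2 + z.1 * z.2.1 := by fun_prop
  have c2 : Continuous fun z : ℝ × (ℝ × ℝ) => z.2.2 := by fun_prop
  have c3 : Continuous fun z : ℝ × (ℝ × ℝ) => 1 / 2 + z.1 * z.2.1 + z.1 * z.2.2 := by fun_prop
  have e0 : ∀ᶠ z : ℝ × (ℝ × ℝ) in 𝓝[>] 0 ×ˢ 𝓝 ζ, 0 < z.1 :=
    (tendsto_fst : Tendsto Prod.fst (𝓝[>] (0:ℝ) ×ˢ 𝓝 ζ) (𝓝[>] 0)).eventually self_mem_nhdsWithin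
  filter_upwards [e0, hle ((c1.tendsto (0, ζ)).eventually_const_lt (show (0:ℝ) < _ by norm_num)),
    hle ((c2.tendsto (0, ζ)).eventually_const_lt h2),
    hle ((c3.tendsto (0, ζ)).eventually_lt_const (show _ < (1:ℝ) by norm_num))] with z e0 e1 e2 e3
  exact ⟨by simpa using e1, by simpa using mul_pos e0 e2, by simpa using e3⟩

/-- Along an edge, the differentials of the triangles at the edge agree. -/
lemma diffOn_eq_of_subset {s t : Finset τ.V} (hs : s ∈ τ.K.faces) (ht : t ∈ τ.K.faces) (hts : t ⊆ s)
    {x a b : τ.V} (hx : x ∈ τ.hull t) (ha : a ∈ t) (hb : b ∈ t) :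
    τ.diffOn s x (b - a) = τ.diffOn t x (b - a) := by
  have hsub : τ.hull t ⊆ τ.hull s := convexHull_mono (by exact_mod_cast hts)
  have key : ∀ y ∈ τ.hull t, τ.diffOn s x (y - x) = τ.diffOn t x (y - x) := fun y hy =>
    HasFDerivWithinAt.unique_on ((hasFDerivWithinAt hs (hsub hx)).mono hsub)
      (hasFDerivWithinAt ht hx)
      (mem_tangentConeAt_of_segment_subset ((convex_convexHull ℝ _).segment_subset hx hy))
  rw [show b - a = (b - x) - (a - x) by abel, map_sub (τ.diffOn s x) (b - x),
    map_sub (τ.diffOn t x) (b - x), key b (subset_convexHull ℝ _ hb),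
    key a (subset_convexHull ℝ _ ha)]

variable (τ) in
/-- The angle of a triangle at its first vertex. -/
def cornerAngle (a b c : τ.V) : ℝ :=
  InnerProductGeometry.angle (τ.diffOn {a, b, c} a (b - a)) (τ.diffOn {a, b, c} a (c - a))

end SmoothTriangulation

namespace TubularSurface

open SmoothTriangulation

variable {S A A' : Set E4} {N : E4 → E4} {ε : ℝ} (h : TubularSurface S A A' N ε)
  {τ : SmoothTriangulation S}

include h

/-- The angles of the triangles at a vertex add up to `2π`. -/
theorem sum_cornerAngle {a : τ.V} (ha : {a} ∈ τ.K.faces) (I : Finset (τ.V × τ.V))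
    (hI : ∀ t, t ∈ I ↔ τ.PosTri N a t.1 t.2) :
    ∑ t ∈ I, τ.cornerAngle a t.1 t.2 = 2 * Real.pi := by
  have haK : a ∈ τ.K.space := hull_subset ha (subset_convexHull ℝ _ (by simp))
  have haS := τ.bijOn.mapsTo haK
  have hmem : ∀ {b c : τ.V}, a ∈ τ.hull {a, b, c} := subset_convexHull ℝ _ (by simp)
  refine (h.ortho haS).sum_angle I (fun t => τ.diffOn {a, t.1, t.2} a (t.1 - a))
    (fun t => τ.diffOn {a, t.1, t.2} a (t.2 - a)) ?_ ?_ ?_ ?_ ?_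
  · intro t ht
    exact h.tang_diffOn_vertices ((hI t).1 ht).mem hmem (by simp) (by simp)
  · intro t ht
    exact h.tang_diffOn_vertices ((hI t).1 ht).mem hmem (by simp) (by simp)
  · intro t ht
    exact ((hI t).1 ht).pos a hmem
  -- Covering: a limit of difference quotients of points in the standard triangle at its corner has
  -- nonnegative coordinates. Rotating the vertices puts `a` first without changing orientation.
  · intro w hw
    obtain ⟨a', b, c, ⟨rfl, hp⟩, -, u, hu, hux, ζ, rfl, l, v, hl, hl0, hv, hlim⟩ :=
      h.exists_direction haK hw (R := fun a' b c => a' = a ∧ τ.PosTri N a' b c) (by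
        intro a₁ b₁ c₁ h1 hx1
        have := vertex_mem_of_mem_hull ha h1.mem hx1
        simp only [Finset.mem_insert, Finset.mem_singleton] at this
        rcases this with rfl | rfl | rfl
        · exact ⟨_, _, _, ⟨rfl, h1⟩, h1.toIsTri, rfl⟩
        · exact ⟨_, _, _, ⟨rfl, h1.rotate⟩, h1.rotate.toIsTri, by ext; simp; tauto⟩
        · exact ⟨_, _, _, ⟨rfl, h1.rotate.rotate⟩, h1.rotate.rotate.toIsTri, by ext; simp; tauto⟩)
    have hu0 : u = (0, 0) := hp.triPt_injective (by rw [hux, triPt_zero])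
    subst hu0
    refine ⟨(b, c), (hI _).2 hp, ζ.1, ζ.2, ?_, ?_, ?_⟩
    · refine ge_of_tendsto ((continuous_fst.tendsto ζ).comp hlim) ?_
      filter_upwards [hv, hl0 self_mem_nhdsWithin] with r hr1 hr2
      have hr2 : (0:ℝ) < r := hr2
      simpa using mul_nonneg (inv_nonneg.2 hr2.le) hr1.1
    · refine ge_of_tendsto ((continuous_snd.tendsto ζ).comp hlim) ?_
      filter_upwards [hv, hl0 self_mem_nhdsWithin] with r hr1 hr2
      have hr2 : (0:ℝ) < r := hr2
      simpa using mul_nonneg (inv_nonneg.2 hr2.le) hr1.2.1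
    · rw [hp.toIsTri.fderivWithin_patch hu, triPt_zero, map_add, map_smul, map_smul]
  · rintro ⟨b, c⟩ hi ⟨b', c'⟩ hj s t s' t' hs ht hs' ht' he
    have hi := (hI _).1 hi
    have hj := (hI _).1 hj
    by_cases hsub : ({a, b, c} : Finset τ.V) ⊆ {a, b', c'}
    · obtain ⟨rfl, rfl⟩ := hi.eq_of_subset hj hsub
      rfl
    · refine (h.direction_unique hi.toIsTri hj.toIsTri hsub zero_mem_stdTri zero_mem_stdTri
        (by rw [triPt_zero, triPt_zero]) (ζ := (s, t)) (ζ' := (s', t')) (eventually_corner hs ht)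
        (eventually_corner hs' ht') ?_).elim
      rw [hi.toIsTri.fderivWithin_patch zero_mem_stdTri, hj.toIsTri.fderivWithin_patch zero_mem_stdTri,
        triPt_zero, triPt_zero]
      simpa only [map_add, map_smul] using he

/-- Every oriented edge is an edge of exactly one positively oriented triangle. -/
theorem existsUnique_posTri {a b : τ.V} (hab : a ≠ b) (he : {a, b} ∈ τ.K.faces) :
    ∃! c, τ.PosTri N a b c := by
  -- At the midpoint every triangle contains the whole edge, so the tangent plane there is tiled by
  -- half planes bounded by the line of `p`.
  set m := (1 / 2 : ℝ) • a + (1 / 2 : ℝ) • b with hm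
  have hmab : m ∈ τ.hull {a, b} := mem_convexHull_pair'.2 ⟨1 / 2, by norm_num, by rw [hm]; module⟩
  have hmK : m ∈ τ.K.space := hull_subset he hmab
  have hmS := τ.bijOn.mapsTo hmK
  set p := τ.diffOn {a, b} m (b - a) with hp
  have hpc : ∀ {c}, τ.IsTri a b c → τ.diffOn {a, b, c} m (b - a) = p := fun ht =>
    diffOn_eq_of_subset ht.mem he (by intro x; simp; tauto) hmab (by simp) (by simp)
  have hmt : ∀ {c}, τ.IsTri a b c → m ∈ τ.hull {a, b, c} := fun ht => by
    rw [hm, ← triPt_mid a b _]; exact ht.triPt_mem mid_mem_stdTri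
  have hq : ∀ {c}, τ.IsTri a b c → Tang (N (τ.toFun m)) (τ.toFun m) (τ.diffOn {a, b, c} m (c - a)) :=
    fun ht => h.tang_diffOn_vertices ht.mem (hmt ht) (by simp) (by simp)
  have hder : ∀ {c}, τ.IsTri a b c → ∀ ζ : ℝ × ℝ,
      fderivWithin ℝ (τ.toFun ∘ triPt a b c) stdTri (1 / 2, 0) ζ =
        ζ.1 • p + ζ.2 • τ.diffOn {a, b, c} m (c - a) := fun ht ζ => by
    rw [ht.fderivWithin_patch mid_mem_stdTri, triPt_mid, map_add, map_smul, map_smul, hpc ht]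
  have hthird : ∀ a₁ b₁ c₁, τ.PosTri N a₁ b₁ c₁ → m ∈ τ.hull {a₁, b₁, c₁} →
      ∃ a' b' c', (a' = a ∧ b' = b) ∧ τ.IsTri a' b' c' ∧ ({a', b', c'} : Finset τ.V) = {a₁, b₁, c₁} := by
    intro a₁ b₁ c₁ h1 hx1
    have hsub := edge_subset_of_mem_hull hab he h1.mem hx1
    have h1a := hsub (show a ∈ _ by simp)
    have h1b := hsub (show b ∈ _ by simp)
    obtain ⟨c, hc⟩ : ∃ c, ({a₁, b₁, c₁} : Finset τ.V) \ {a, b} = {c} := Finset.card_eq_one.1 (by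
      rw [Finset.card_sdiff_of_subset hsub, Finset.card_pair hab,
        Finset.card_eq_three.2 ⟨_, _, _, h1.ab, h1.ac, h1.bc, rfl⟩])
    have hcm : c ∈ ({a₁, b₁, c₁} : Finset τ.V) \ {a, b} := by rw [hc]; simp
    have hset : ({a, b, c} : Finset τ.V) = {a₁, b₁, c₁} := by
      rw [← Finset.union_sdiff_of_subset hsub, hc]; ext; simp
    simp only [Finset.mem_sdiff, Finset.mem_insert, Finset.mem_singleton, not_or] at hcm
    exact ⟨a, b, c, ⟨rfl, rfl⟩, ⟨by rw [hset]; exact h1.mem, hab, fun e => hcm.2.1 e.symm,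
      fun e => hcm.2.2 e.symm⟩, hset⟩
  obtain ⟨a₁, b₁, c₁, h1, hx1⟩ := h.exists_isTri (N := N) hmK
  obtain ⟨a₀, b₀, c₀, ⟨rfl, rfl⟩, h0, -⟩ := hthird a₁ b₁ c₁ h1 hx1
  have hpos : ∀ {c}, τ.IsTri a₀ b₀ c → 0 < det4 p (τ.diffOn {a₀, b₀, c} m (c - a₀)) (N (τ.toFun m))
      (τ.toFun m) → τ.PosTri N a₀ b₀ c := by
    intro c ht hd
    refine (h.posTri_or ht).resolve_right fun hn => ?_
    have e : ({a₀, c, b₀} : Finset τ.V) = {a₀, b₀, c} := by ext; simp; tauto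
    have := hn.pos m (by rw [e]; exact hmt ht)
    rw [e, hpc ht, det4_swap] at this
    linarith
  refine existsUnique_of_exists_of_unique ?_ ?_
  -- A vector strictly on the positive side of the edge. The triangle that catches it has its third
  -- vertex on that side.
  · obtain ⟨w, hw, hdw⟩ : ∃ w, Tang (N (τ.toFun m)) (τ.toFun m) w ∧
        0 < det4 p w (N (τ.toFun m)) (τ.toFun m) := by
      rcases h.posTri_or h0 with hp0 | hp0
      · have := hp0.pos m (hmt h0)
        rw [hpc h0] at this
        exact ⟨_, hq h0, this⟩
      · have e : ({a₀, c₀, b₀} : Finset τ.V) = {a₀, b₀, c₀} := by ext; simp; tauto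
        have := hp0.pos m (by rw [e]; exact hmt h0)
        rw [e, hpc h0, det4_swap] at this
        exact ⟨_, (hq h0).smul (-1), by rw [det4_smul_right]; linarith⟩
    obtain ⟨a', b', c, ⟨rfl, rfl⟩, ht, u, hu, hux, ζ, rfl, l, v, hl, hl0, hv, hlim⟩ :=
      h.exists_direction hmK hw (R := fun a' b' c => a' = a₀ ∧ b' = b₀) hthird
    have hu0 : u = (1 / 2, 0) := ht.triPt_injective (by rw [hux, triPt_mid])
    subst hu0
    have hζ : 0 ≤ ζ.2 := by
      refine ge_of_tendsto ((continuous_snd.tendsto ζ).comp hlim) ?_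
      filter_upwards [hv, hl0 self_mem_nhdsWithin] with r hr1 hr2
      have hr2 : (0:ℝ) < r := hr2
      simpa using mul_nonneg (inv_nonneg.2 hr2.le) hr1.2.1
    rw [hder ht, det4_add_right, det4_smul_right, det4_smul_right, det4_self, mul_zero, zero_add] at hdw
    exact ⟨c, hpos ht (pos_of_mul_pos_right hdw hζ)⟩
  · intro c c' hc hc'
    have d1 := hc.pos m (hmt hc.toIsTri)
    have d2 := hc'.pos m (hmt hc'.toIsTri)
    rw [hpc hc.toIsTri] at d1
    rw [hpc hc'.toIsTri] at d2
    by_cases hsub : ({a₀, b₀, c} : Finset τ.V) ⊆ {a₀, b₀, c'}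
    · have := hsub (show c ∈ _ by simp)
      simpa [hc.ac.symm, hc.bc.symm] using this
    -- If both triangles are positive, the inward direction of the second is a multiple of `p` plus
    -- a positive multiple of that of the first, so it is interior to both.
    · obtain ⟨r, hcomb⟩ : ∃ r : ℝ, τ.diffOn {a₀, b₀, c'} m (c' - a₀) = r • p +
          (det4 p (τ.diffOn {a₀, b₀, c'} m (c' - a₀)) (N (τ.toFun m)) (τ.toFun m) /
          det4 p (τ.diffOn {a₀, b₀, c} m (c - a₀)) (N (τ.toFun m)) (τ.toFun m)) •
          τ.diffOn {a₀, b₀, c} m (c - a₀) :=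
        ⟨_, (h.ortho hmS).eq_comb (h.tang_diffOn_vertices he hmab (by simp) (by simp))
          (hq hc.toIsTri) (hq hc'.toIsTri) d1.ne'⟩
      refine (h.direction_unique hc.toIsTri hc'.toIsTri hsub mid_mem_stdTri mid_mem_stdTri
        (by rw [triPt_mid, triPt_mid]) (ζ := (r, _)) (ζ' := (0, 1))
        (eventually_edge (div_pos d2 d1)) (eventually_edge one_pos) ?_).elim
      rw [hder hc.toIsTri, hder hc'.toIsTri]
      simp only [zero_smul, one_smul, zero_add]
      exact hcomb.symm

end TubularSurface

/-! ### Summation over the triangulation -/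

namespace SmoothTriangulation

variable {S : Set E4} (τ : SmoothTriangulation S) (N : E4 → E4)

/-- The total geodesic curvature of an oriented edge. -/
def edgeCurv (a b : τ.V) : ℝ :=
  totalGeodCurv (fun s => τ.toFun (a + s • (b - a))) (fun s => N (τ.toFun (a + s • (b - a))))

lemma edgeCurv_swap (a b : τ.V) : τ.edgeCurv N b a = - τ.edgeCurv N a b := by
  have e : ∀ s : ℝ, b + s • (a - b) = a + (1 - s) • (b - a) := fun s => by module
  simp only [edgeCurv, e]
  exact totalGeodCurv_reverse (fun s => τ.toFun (a + s • (b - a)))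
    (fun s => N (τ.toFun (a + s • (b - a))))

/-- The total curvature of a triangle. -/
def triCurv (a b c : τ.V) : ℝ :=
  ∫ x in (0:ℝ)..1, ∫ y in (0:ℝ)..1, curvForm ((τ.toFun ∘ triPt a b c) ∘ duffy)
    ((N ∘ (τ.toFun ∘ triPt a b c)) ∘ duffy) (x, y)

/-- The positively oriented triangles, with a marked first vertex. -/
def posTris : Finset (τ.V × τ.V × τ.V) := (TubularSurface.finite_posTri (τ := τ) (N := N)).toFinset

/-- The faces with `k` vertices. -/
def facesOfCard (k : ℕ) : Finset (Finset τ.V) := {s ∈ τ.finite_faces.toFinset | s.card = k}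

variable {τ N}

lemma mem_posTris {t : τ.V × τ.V × τ.V} : t ∈ τ.posTris N ↔ τ.PosTri N t.1 t.2.1 t.2.2 := by
  simp [posTris]

lemma mem_facesOfCard {k : ℕ} {s : Finset τ.V} :
    s ∈ τ.facesOfCard k ↔ s ∈ τ.K.faces ∧ s.card = k := by
  simp [facesOfCard]

lemma IsTri.card {a b c : τ.V} (h : τ.IsTri a b c) : ({a, b, c} : Finset τ.V).card = 3 :=
  Finset.card_eq_three.2 ⟨a, b, c, h.ab, h.ac, h.bc, rfl⟩

lemma sum_rotate (f : τ.V → τ.V → τ.V → ℝ) :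
    ∑ t ∈ τ.posTris N, f t.2.1 t.2.2 t.1 = ∑ t ∈ τ.posTris N, f t.1 t.2.1 t.2.2 := by
  refine Finset.sum_nbij' (fun t => (t.2.1, t.2.2, t.1)) (fun t => (t.2.2, t.1, t.2.1)) ?_ ?_ ?_ ?_ ?_
  · intro t ht; exact mem_posTris.2 (mem_posTris.1 ht).rotate
  · intro t ht; exact mem_posTris.2 (mem_posTris.1 ht).rotate.rotate
  · intro t _; rfl
  · intro t _; rfl
  · intro t _; rfl

/-- Summation over positive triangles with a marked vertex, in terms of a marking. -/
lemma sum_posTris {f : τ.V → τ.V → τ.V → ℝ} (hf : ∀ a b c, τ.PosTri N a b c → f b c a = f a b c)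
    {o : Finset τ.V → τ.V × τ.V × τ.V}
    (ho : ∀ s ∈ τ.facesOfCard 3, τ.PosTri N (o s).1 (o s).2.1 (o s).2.2 ∧
      {(o s).1, (o s).2.1, (o s).2.2} = s) :
    ∑ t ∈ τ.posTris N, f t.1 t.2.1 t.2.2 =
      3 * ∑ s ∈ τ.facesOfCard 3, f (o s).1 (o s).2.1 (o s).2.2 := by
  classical
  rw [← Finset.sum_fiberwise_of_maps_to (s := τ.posTris N) (t := τ.facesOfCard 3)
    (g := fun t => {t.1, t.2.1, t.2.2}) (fun t ht => mem_facesOfCard.2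
      ⟨(mem_posTris.1 ht).mem, (mem_posTris.1 ht).card⟩), Finset.mul_sum]
  refine Finset.sum_congr rfl fun s hs => ?_
  obtain ⟨hp, hset⟩ := ho s hs
  generalize o s = t at hp hset ⊢
  obtain ⟨a, b, c⟩ := t
  simp only at hp hset ⊢
  have hfib : {t ∈ τ.posTris N | ({t.1, t.2.1, t.2.2} : Finset τ.V) = s} =
      {(a, b, c), (b, c, a), (c, a, b)} := by
    ext ⟨x, y, z⟩
    simp only [Finset.mem_filter, mem_posTris, Finset.mem_insert, Finset.mem_singleton, Prod.mk.injEq]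
    constructor
    · rintro ⟨hq, hs'⟩
      have hx : x ∈ ({a, b, c} : Finset τ.V) := by rw [hset, ← hs']; simp
      simp only [Finset.mem_insert, Finset.mem_singleton] at hx
      rcases hx with rfl | rfl | rfl
      · left
        obtain ⟨rfl, rfl⟩ := hq.eq_of_subset hp (by rw [hs', hset])
        simp
      · right; left
        have e : ({x, c, a} : Finset τ.V) = {a, x, c} := by ext; simp; tauto
        obtain ⟨rfl, rfl⟩ := hq.eq_of_subset hp.rotate (by rw [hs', e, hset])
        simp
      · right; right
        have e : ({x, a, b} : Finset τ.V) = {a, b, x} := by ext; simp; tauto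
        obtain ⟨rfl, rfl⟩ := hq.eq_of_subset hp.rotate.rotate (by rw [hs', e, hset])
        simp
    · rintro (⟨rfl, rfl, rfl⟩ | ⟨rfl, rfl, rfl⟩ | ⟨rfl, rfl, rfl⟩)
      · exact ⟨hp, hset⟩
      · exact ⟨hp.rotate, by rw [← hset]; ext; simp; tauto⟩
      · exact ⟨hp.rotate.rotate, by rw [← hset]; ext; simp; tauto⟩
  rw [hfib, Finset.sum_insert (by simp [hp.ab, hp.ac]), Finset.sum_pair (by simp [hp.bc])]
  simp only
  linarith [hf a b c hp, hf b c a hp.rotate]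

end SmoothTriangulation

namespace TubularSurface

open SmoothTriangulation

variable {S A A' : Set E4} {N : E4 → E4} {ε : ℝ} (h : TubularSurface S A A' N ε)
  {τ : SmoothTriangulation S}

include h

lemma triCurv_eq {a b c : τ.V} (ht : τ.PosTri N a b c) :
    τ.triCurv N a b c = τ.cornerAngle a b c + τ.cornerAngle b c a + τ.cornerAngle c a b - Real.pi -
      (τ.edgeCurv N a b + τ.edgeCurv N b c + τ.edgeCurv N c a) := by
  have hb : ((1, 0) : ℝ × ℝ) ∈ stdTri := by simp [stdTri]
  have hc : ((0, 1) : ℝ × ℝ) ∈ stdTri := by simp [stdTri]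
  have pb : triPt a b c (1, 0) = b := by simp [triPt]
  have pc : triPt a b c (0, 1) = c := by simp [triPt]
  have s1 : ({b, c, a} : Finset τ.V) = {a, b, c} := by ext; simp; tauto
  have s2 : ({c, a, b} : Finset τ.V) = {a, b, c} := by ext; simp; tauto
  have g := (h.trianglePatch ht).gaussBonnet
  simp only [ht.toIsTri.fderivWithin_patch zero_mem_stdTri, ht.toIsTri.fderivWithin_patch hb,
    ht.toIsTri.fderivWithin_patch hc, triPt_zero, pb, pc] at g
  have v1 : ((-1:ℝ), (1:ℝ)).1 • (b - a) + ((-1:ℝ), (1:ℝ)).2 • (c - a) = c - b := by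
    simp only; module
  have v2 : ((-1:ℝ), (0:ℝ)).1 • (b - a) + ((-1:ℝ), (0:ℝ)).2 • (c - a) = a - b := by
    simp only; module
  have v3 : ((0:ℝ), (-1:ℝ)).1 • (b - a) + ((0:ℝ), (-1:ℝ)).2 • (c - a) = a - c := by
    simp only; module
  have v4 : ((1:ℝ), (-1:ℝ)).1 • (b - a) + ((1:ℝ), (-1:ℝ)).2 • (c - a) = b - c := by
    simp only; module
  have v5 : ((1:ℝ), (0:ℝ)).1 • (b - a) + ((1:ℝ), (0:ℝ)).2 • (c - a) = b - a := by
    simp only; module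
  have v6 : ((0:ℝ), (1:ℝ)).1 • (b - a) + ((0:ℝ), (1:ℝ)).2 • (c - a) = c - a := by
    simp only; module
  rw [v1, v2, v3, v4, v5, v6] at g
  have e1 : ∀ s : ℝ, triPt a b c (s, 0) = a + s • (b - a) := fun s => by simp [triPt]
  have e2 : ∀ s : ℝ, triPt a b c (1 - s, s) = b + s • (c - b) := fun s => by
    simp only [triPt]; module
  have e3 : ∀ s : ℝ, triPt a b c (0, 1 - s) = c + s • (a - c) := fun s => by
    simp only [triPt]; module
  simp only [Function.comp_apply, e1, e2, e3] at g
  simp only [cornerAngle, s1, s2]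
  exact g

/-- Passing to the positive triangle across the marked edge reverses that edge and is an involution,
while geodesic curvature is odd under reversal; the sum equals its negative. -/
lemma sum_edgeCurv : ∑ t ∈ τ.posTris N, τ.edgeCurv N t.1 t.2.1 = 0 := by
  have key : ∑ t ∈ τ.posTris N, τ.edgeCurv N t.1 t.2.1 =
      ∑ t ∈ τ.posTris N, τ.edgeCurv N t.2.1 t.1 := by
    have hex : ∀ t : τ.V × τ.V × τ.V, ∃ c, t ∈ τ.posTris N → τ.PosTri N t.2.1 t.1 c := fun t => by
      by_cases ht : t ∈ τ.posTris N
      · have ht' := mem_posTris.1 ht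
        obtain ⟨c, hc, -⟩ := h.existsUnique_posTri ht'.ab.symm
          (τ.K.down_closed ht'.mem (by intro x; simp; tauto) (by simp))
        exact ⟨c, fun _ => hc⟩
      · exact ⟨0, fun h => (ht h).elim⟩
    choose c hc using hex
    have huniq : ∀ {a b c c' : τ.V}, τ.PosTri N a b c → τ.PosTri N a b c' → c = c' := by
      intro a b c c' h1 h2
      exact (h.existsUnique_posTri h1.ab
        (τ.K.down_closed h1.mem (by intro x; simp; tauto) (by simp))).unique h1 h2
    refine Finset.sum_nbij' (fun t => (t.2.1, t.1, c t)) (fun t => (t.2.1, t.1, c t)) ?_ ?_ ?_ ?_ ?_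
    · intro t ht; exact mem_posTris.2 (hc t ht)
    · intro t ht; exact mem_posTris.2 (hc t ht)
    · intro t ht
      exact Prod.ext rfl (Prod.ext rfl (huniq (hc _ (mem_posTris.2 (hc t ht))) (mem_posTris.1 ht)))
    · intro t ht
      exact Prod.ext rfl (Prod.ext rfl (huniq (hc _ (mem_posTris.2 (hc t ht))) (mem_posTris.1 ht)))
    · intro t _; rfl
  have h2 : ∑ t ∈ τ.posTris N, τ.edgeCurv N t.2.1 t.1 =
      - ∑ t ∈ τ.posTris N, τ.edgeCurv N t.1 t.2.1 := by
    rw [← Finset.sum_neg_distrib]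
    exact Finset.sum_congr rfl fun t _ => τ.edgeCurv_swap N _ _
  linarith

/-- Over each edge there are two marked triangles, one for each direction. Since a triangle has
three markings, this is the relation 3F = 2E. -/
lemma card_posTris_edges : (τ.posTris N).card = 2 * (τ.facesOfCard 2).card := by
  classical
  rw [Finset.card_eq_sum_card_fiberwise (t := τ.facesOfCard 2) (f := fun t => {t.1, t.2.1})
    (fun t ht => mem_facesOfCard.2 ⟨τ.K.down_closed (mem_posTris.1 ht).mem (by intro x; simp; tauto)
      (by simp), Finset.card_pair (mem_posTris.1 ht).ab⟩)]
  rw [Finset.sum_const_nat (m := 2), mul_comm]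
  intro s hs
  obtain ⟨hs, hcard⟩ := mem_facesOfCard.1 hs
  obtain ⟨a, b, hab, rfl⟩ := Finset.card_eq_two.1 hcard
  obtain ⟨c, hc, hcu⟩ := h.existsUnique_posTri hab hs
  obtain ⟨d, hd, hdu⟩ := h.existsUnique_posTri hab.symm (by rwa [Finset.pair_comm])
  have : {t ∈ τ.posTris N | ({t.1, t.2.1} : Finset τ.V) = {a, b}} = {(a, b, c), (b, a, d)} := by
    ext ⟨x, y, z⟩
    simp only [Finset.mem_filter, mem_posTris, Finset.mem_insert, Finset.mem_singleton, Prod.mk.injEq]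
    constructor
    · rintro ⟨hq, hs'⟩
      have hx : x ∈ ({a, b} : Finset τ.V) := by rw [← hs']; simp
      have hy : y ∈ ({a, b} : Finset τ.V) := by rw [← hs']; simp
      simp only [Finset.mem_insert, Finset.mem_singleton] at hx hy
      rcases hx with rfl | rfl
      · obtain rfl := hy.resolve_left hq.ab.symm
        exact Or.inl ⟨rfl, rfl, hcu _ hq⟩
      · obtain rfl := hy.resolve_right hq.ab.symm
        exact Or.inr ⟨rfl, rfl, hdu _ hq⟩
    · rintro (⟨rfl, rfl, rfl⟩ | ⟨rfl, rfl, rfl⟩)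
      · exact ⟨hc, rfl⟩
      · exact ⟨hd, Finset.pair_comm _ _⟩
  rw [this, Finset.card_pair (by simp [hab])]

/-- Grouped by the marked vertex, each fibre is the full set of angles at that vertex. -/
lemma sum_corner : ∑ t ∈ τ.posTris N, τ.cornerAngle t.1 t.2.1 t.2.2 =
    2 * Real.pi * (τ.facesOfCard 1).card := by
  classical
  rw [← Finset.sum_fiberwise_of_maps_to (s := τ.posTris N) (t := τ.facesOfCard 1)
    (g := fun t => {t.1}) (fun t ht => mem_facesOfCard.2
      ⟨τ.K.down_closed (mem_posTris.1 ht).mem (by simp) (by simp), by simp⟩)]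
  rw [Finset.sum_congr rfl (g := fun _ => 2 * Real.pi), Finset.sum_const, nsmul_eq_mul, mul_comm]
  intro s hs
  obtain ⟨hs, hcard⟩ := mem_facesOfCard.1 hs
  obtain ⟨a, rfl⟩ := Finset.card_eq_one.1 hcard
  have hfib : {t ∈ τ.posTris N | ({t.1} : Finset τ.V) = {a}} = {t ∈ τ.posTris N | t.1 = a} := by
    simp only [Finset.singleton_inj]
  rw [hfib, ← h.sum_cornerAngle hs ({t ∈ τ.posTris N | t.1 = a}.image Prod.snd) (fun t => by
    simp only [Finset.mem_image, Finset.mem_filter, mem_posTris]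
    constructor
    · rintro ⟨⟨x, y⟩, ⟨hp, rfl⟩, rfl⟩; exact hp
    · intro hp; exact ⟨(a, t), ⟨hp, rfl⟩, rfl⟩), Finset.sum_image]
  · exact Finset.sum_congr rfl fun t ht => by rw [(Finset.mem_filter.1 ht).2]
  · intro t ht t' ht' he
    have ht := (Finset.mem_filter.1 ht).2
    have ht' := (Finset.mem_filter.1 ht').2
    exact Prod.ext (ht.trans ht'.symm) he

/-- A choice of a positive order of the vertices of each triangle. -/
lemma exists_marking : ∃ o : Finset τ.V → τ.V × τ.V × τ.V, ∀ s ∈ τ.facesOfCard 3,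
    τ.PosTri N (o s).1 (o s).2.1 (o s).2.2 ∧ {(o s).1, (o s).2.1, (o s).2.2} = s := by
  have : ∀ s : Finset τ.V, ∃ t : τ.V × τ.V × τ.V, s ∈ τ.facesOfCard 3 →
      τ.PosTri N t.1 t.2.1 t.2.2 ∧ {t.1, t.2.1, t.2.2} = s := fun s => by
    by_cases hs : s ∈ τ.facesOfCard 3
    · obtain ⟨hs', hcard⟩ := mem_facesOfCard.1 hs
      obtain ⟨a, b, c, h1, h2, h3, rfl⟩ := Finset.card_eq_three.1 hcard
      rcases h.posTri_or ⟨hs', h1, h2, h3⟩ with hp | hp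
      · exact ⟨(a, b, c), fun _ => ⟨hp, rfl⟩⟩
      · exact ⟨(a, c, b), fun _ => ⟨hp, by ext; simp; tauto⟩⟩
    · exact ⟨0, fun h => (hs h).elim⟩
  choose o ho using this
  exact ⟨o, ho⟩

lemma eulerChar_eq : τ.eulerChar =
    (τ.facesOfCard 1).card - (τ.facesOfCard 2).card + (τ.facesOfCard 3).card := by
  have : ∀ s ∈ τ.finite_faces.toFinset, (-1 : ℤ) ^ (s.card + 1) =
      (if s.card = 1 then 1 else 0) - (if s.card = 2 then 1 else 0) +
        (if s.card = 3 then 1 else 0) := fun s hs => by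
    have hs' : s ∈ τ.K.faces := by simpa using hs
    have h1 := h.card_le_three hs'
    have h0 := (τ.K.nonempty_of_mem_faces hs').card_pos
    interval_cases s.card <;> simp
  rw [SmoothTriangulation.eulerChar, Finset.sum_congr rfl this, Finset.sum_add_distrib,
    Finset.sum_sub_distrib]
  simp only [Finset.sum_boole, facesOfCard]

/-- The **Gauss–Bonnet theorem**. -/
theorem sum_triCurv {o : Finset τ.V → τ.V × τ.V × τ.V}
    (ho : ∀ s ∈ τ.facesOfCard 3, τ.PosTri N (o s).1 (o s).2.1 (o s).2.2 ∧
      {(o s).1, (o s).2.1, (o s).2.2} = s) :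
    ∑ s ∈ τ.facesOfCard 3, τ.triCurv N (o s).1 (o s).2.1 (o s).2.2 =
      2 * Real.pi * τ.eulerChar := by
  have h1 := sum_posTris (f := fun a b c => τ.triCurv N a b c) (fun a b c ht => by
    rw [h.triCurv_eq ht, h.triCurv_eq ht.rotate]; ring) ho
  have h2 := sum_posTris (N := N) (f := fun a b c => 1) (fun a b c ht => rfl) ho
  have h3 := h.card_posTris_edges (τ := τ)
  have h4 : ∑ t ∈ τ.posTris N, τ.triCurv N t.1 t.2.1 t.2.2 =
      3 * ∑ t ∈ τ.posTris N, τ.cornerAngle t.1 t.2.1 t.2.2 - Real.pi * (τ.posTris N).card -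
        3 * ∑ t ∈ τ.posTris N, τ.edgeCurv N t.1 t.2.1 := by
    rw [Finset.sum_congr rfl fun t ht => h.triCurv_eq (mem_posTris.1 ht)]
    simp only [Finset.sum_sub_distrib, Finset.sum_add_distrib, Finset.sum_const, nsmul_eq_mul]
    have r1 := sum_rotate (τ := τ) (N := N) fun a b c => τ.cornerAngle a b c
    have r2 := sum_rotate (τ := τ) (N := N) fun a b c => τ.cornerAngle b c a
    have r3 := sum_rotate (τ := τ) (N := N) fun a b _ => τ.edgeCurv N a b
    have r4 := sum_rotate (τ := τ) (N := N) fun _ b c => τ.edgeCurv N b c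
    rw [r2, r1, r4, r3]
    ring
  rw [h.sum_corner, h.sum_edgeCurv, h1, h3] at h4
  simp only [Finset.sum_const, nsmul_eq_mul, mul_one] at h2
  rw [h.eulerChar_eq]
  rw [h3] at h2
  push_cast at h2 h4 ⊢
  -- Every triangle is counted three times. The total curvature is 2πV - πF, and 3F = 2E makes this
  -- 2π(V - E + F).
  linear_combination h4 / 3 + (2 / 3) * Real.pi * h2

end TubularSurface

/-! ### The Jacobian integral over the unit ball -/

lemma duffy_mem_openTri {p : ℝ × ℝ} (hp : p ∈ Ioo (0:ℝ) 1 ×ˢ Ioo (0:ℝ) 1) : duffy p ∈ openTri := by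
  obtain ⟨⟨h1, h2⟩, h3, h4⟩ := hp
  refine ⟨mul_pos h1 (by linarith), mul_pos h1 h3, ?_⟩
  simp only [duffy]
  linarith

lemma exists_duffy {u : ℝ × ℝ} (hu : u ∈ openTri) : ∃ p ∈ Ioo (0:ℝ) 1 ×ˢ Ioo (0:ℝ) 1, duffy p = u := by
  obtain ⟨h1, h2, h3⟩ := hu
  have h0 : 0 < u.1 + u.2 := by linarith
  refine ⟨(u.1 + u.2, u.2 / (u.1 + u.2)), ⟨⟨h0, h3⟩, div_pos h2 h0, ?_⟩, ?_⟩
  · rw [div_lt_one h0]; linarith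
  · ext <;> simp only [duffy] <;> field_simp
    ring

lemma injOn_duffy : InjOn duffy (Ioo (0:ℝ) 1 ×ˢ Ioo (0:ℝ) 1) := by
  rintro ⟨x, y⟩ ⟨hx, hy⟩ ⟨x', y'⟩ ⟨hx', hy'⟩ he
  have h1 := congrArg Prod.fst he
  have h2 := congrArg Prod.snd he
  simp only [duffy] at h1 h2
  have hxx : x = x' := by linarith
  subst hxx
  rw [mul_left_cancel₀ (ne_of_gt hx.1) h2]

lemma ContinuousOn.det_pos_of_ne_zero {f : ℝ → ℝ} {δ : ℝ} (hf : ContinuousOn f (Ioo (-δ) δ))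
    (hne : ∀ t ∈ Ioo (-δ) δ, f t ≠ 0) (h0 : 0 < f 0) {t : ℝ} (ht : t ∈ Ioo (-δ) δ) : 0 < f t := by
  by_contra! hle
  have hz : (0:ℝ) ∈ Ioo (-δ) δ := ⟨by linarith [ht.1, ht.2], by linarith [ht.1, ht.2]⟩
  obtain ⟨s, hs, hs0⟩ := isPreconnected_Ioo.intermediate_value ht hz hf ⟨hle, h0.le⟩
  exact hne s hs hs0

namespace TubularSurface

open SmoothTriangulation

variable {S A A' : Set E4} {N : E4 → E4} {ε : ℝ} (h : TubularSurface S A A' N ε)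
  {τ : SmoothTriangulation S}

/-- The parameters of the part of the collar over a triangle. -/
def collarParam (ε : ℝ) : Set ((ℝ × ℝ) × (ℝ × ℝ)) :=
  (Ioo 0 1 ×ˢ Ioo 0 1) ×ˢ (Ioo (-(2 * ε)) (2 * ε) ×ˢ Ioo 0 1)

variable (N ε) in
/-- The part of the collar over a triangle. -/
def collarOver (a b c : τ.V) : Set E4 :=
  shell ((τ.toFun ∘ triPt a b c) ∘ duffy) ((N ∘ (τ.toFun ∘ triPt a b c)) ∘ duffy) id '' collarParam ε

include h

/-- At t = 0 this is the positive area density of the surface. It cannot vanish inside the tube, by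
`parallelDet_ne_zero`, so it stays positive. -/
lemma parallelDet_pos {a b c : τ.V} (ht : τ.PosTri N a b c) {p : ℝ × ℝ}
    (hp : p ∈ Ioo (0:ℝ) 1 ×ˢ Ioo (0:ℝ) 1) {t : ℝ} (htt : t ∈ Ioo (-(2 * ε)) (2 * ε)) :
    0 < parallelDet (((τ.toFun ∘ triPt a b c) ∘ duffy) p)
      (((N ∘ (τ.toFun ∘ triPt a b c)) ∘ duffy) p)
      (fderiv ℝ ((τ.toFun ∘ triPt a b c) ∘ duffy) p)
      (fderiv ℝ ((N ∘ (τ.toFun ∘ triPt a b c)) ∘ duffy) p) t := by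
  have he := h.eps_pos
  have hs := (h.trianglePatch ht).squarePatch
  set G := (τ.toFun ∘ triPt a b c) ∘ duffy with hG
  set n := (N ∘ (τ.toFun ∘ triPt a b c)) ∘ duffy with hn
  have hnhds : unitSq ∈ 𝓝 p := mem_of_superset ((isOpen_Ioo.prod isOpen_Ioo).mem_nhds hp)
    (Set.prod_mono Ioo_subset_Icc_self Ioo_subset_Icc_self)
  have hpq := mem_of_mem_nhds hnhds
  have dG := (hs.derivG p hpq).hasFDerivAt hnhds
  have dn := ((hs.contn.contDiffAt hnhds).differentiableAt (by simp)).hasFDerivAt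
  have hdet : 0 < det4 (fderiv ℝ G p (1, 0)) (fderiv ℝ G p (0, 1)) (n p) (G p) := by
    rw [dG.fderiv]
    simp only [add_apply, ContinuousLinearMap.smulRight_apply, ContinuousLinearMap.coe_fst',
      ContinuousLinearMap.coe_snd', one_smul, zero_smul, add_zero, zero_add]
    rw [det4_smul_right]
    exact mul_pos hp.1.1 (hs.pos p hpq)
  have hinj : ∀ w, fderiv ℝ G p w = 0 → w = 0 := by
    intro w hw
    have e : w = w.1 • (1, 0) + w.2 • (0, 1) := by simp
    rw [e, map_add, map_smul, map_smul] at hw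
    have z1 : ∀ b, det4 0 b (n p) (G p) = 0 := fun b => by simp [det4_eq]
    have z2 : ∀ a, det4 a 0 (n p) (G p) = 0 := fun b => by simp [det4_eq]
    have k1 := z1 (fderiv ℝ G p (0, 1))
    have k2 := z2 (fderiv ℝ G p (1, 0))
    rw [← hw, det4_add_left, det4_smul_left, det4_smul_left, det4_self, mul_zero, add_zero] at k1
    rw [← hw, det4_add_right, det4_smul_right, det4_smul_right, det4_self, mul_zero, zero_add] at k2
    exact Prod.ext ((mul_eq_zero.1 k1).resolve_right hdet.ne') ((mul_eq_zero.1 k2).resolve_right hdet.ne')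
  have hS : ∀ᶠ q in 𝓝 p, G q ∈ S := by
    filter_upwards [hnhds] with q hq using ht.mapsTo_patch (mapsTo_duffy hq)
  refine ContinuousOn.det_pos_of_ne_zero (f := fun t => parallelDet (G p) (n p) (fderiv ℝ G p)
    (fderiv ℝ n p) t) (δ := 2 * ε) ?_ ?_ ?_ htt
  · simp only [parallelDet_eq]
    fun_prop
  · intro s hs'
    exact h.parallelDet_ne_zero (G := G) dG.differentiableAt.hasFDerivAt dn hS hinj
      ((abs_lt.2 hs').trans (by linarith))
  · simpa [parallelDet] using hdet

lemma shell_eq {a b c : τ.V} (ψ : ℝ → ℝ) (z : (ℝ × ℝ) × (ℝ × ℝ)) :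
    shell ((τ.toFun ∘ triPt a b c) ∘ duffy) ((N ∘ (τ.toFun ∘ triPt a b c)) ∘ duffy) ψ z =
      conePt N ((τ.toFun ∘ triPt a b c) (duffy z.1)) (ψ z.2.1) z.2.2 := rfl

lemma mem_collarParam {z : (ℝ × ℝ) × (ℝ × ℝ)} (hz : z ∈ collarParam ε) :
    duffy z.1 ∈ openTri ∧ |z.2.1| < 3 * ε ∧ 0 < z.2.2 ∧ z.2.2 < 1 :=
  ⟨duffy_mem_openTri hz.1, (abs_lt.2 hz.2.1).trans (by linarith [h.eps_pos]), hz.2.2.1, hz.2.2.2⟩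

lemma injOn_shell {a b c : τ.V} (ht : τ.IsTri a b c) :
    InjOn (shell ((τ.toFun ∘ triPt a b c) ∘ duffy) ((N ∘ (τ.toFun ∘ triPt a b c)) ∘ duffy) id)
      (collarParam ε) := by
  intro z hz z' hz' he
  obtain ⟨h1, h2, h3, -⟩ := h.mem_collarParam hz
  obtain ⟨h1', h2', h3', -⟩ := h.mem_collarParam hz'
  obtain ⟨e1, e2, e3⟩ := h.conePt_injective (ht.mapsTo_patch (openTri_subset h1))
    (ht.mapsTo_patch (openTri_subset h1')) h2 h2' h3 h3' he
  exact Prod.ext (injOn_duffy hz.1 hz'.1 (ht.injOn_patch (openTri_subset h1) (openTri_subset h1') e1))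
    (Prod.ext e2 e3)

lemma collarOver_subset {a b c : τ.V} (ht : τ.IsTri a b c) :
    collarOver N ε a b c ⊆ Metric.ball 0 1 \ {0} := by
  rintro _ ⟨z, hz, rfl⟩
  obtain ⟨h1, h2, h3, h4⟩ := h.mem_collarParam hz
  have hn := h.norm_conePt (ht.mapsTo_patch (openTri_subset h1)) (id z.2.1) h3.le
  rw [h.shell_eq]
  refine ⟨by rw [mem_ball_zero_iff, hn]; exact h4, fun h0 => ?_⟩
  rw [mem_singleton_iff] at h0
  rw [h0, norm_zero] at hn
  exact h3.ne hn

lemma coneFoot_mem_of_collarOver {a b c : τ.V} (ht : τ.IsTri a b c) {y : E4}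
    (hy : y ∈ collarOver N ε a b c) :
    coneFoot S N ε y ∈ (τ.toFun ∘ triPt a b c) '' openTri := by
  obtain ⟨z, hz, rfl⟩ := hy
  obtain ⟨h1, h2, h3, -⟩ := h.mem_collarParam hz
  rw [h.shell_eq, id, h.coneFoot_conePt (ht.mapsTo_patch (openTri_subset h1)) h2 h3]
  exact mem_image_of_mem _ h1

lemma measurableSet_collarOver {a b c : τ.V} (ht : τ.IsTri a b c) :
    MeasurableSet (collarOver N ε a b c) := by
  refine MeasurableSet.image_of_continuousOn_injOn ((measurableSet_Ioo.prod measurableSet_Ioo).prod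
    (measurableSet_Ioo.prod measurableSet_Ioo)) ?_ (h.injOn_shell ht)
  have hm : MapsTo (fun z : (ℝ × ℝ) × (ℝ × ℝ) => duffy z.1) (collarParam ε) stdTri := fun z hz =>
    openTri_subset (h.mem_collarParam hz).1
  have hd : ContinuousOn (fun z : (ℝ × ℝ) × (ℝ × ℝ) => duffy z.1) (collarParam ε) :=
    (contDiff_duffy.continuous.comp continuous_fst).continuousOn
  have c1 := ht.contDiffOn_patch.continuousOn.comp hd hm
  have c2 := (h.contDiffOn_normal_patch ht).continuousOn.comp hd hm
  have c3 : Continuous fun z : (ℝ × ℝ) × (ℝ × ℝ) => z.2.2 := by fun_prop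
  have c4 : Continuous fun z : (ℝ × ℝ) × (ℝ × ℝ) => Real.cos z.2.1 := by fun_prop
  have c5 : Continuous fun z : (ℝ × ℝ) × (ℝ × ℝ) => Real.sin z.2.1 := by fun_prop
  exact c3.continuousOn.smul ((c4.continuousOn.smul c1).add (c5.continuousOn.smul c2))

/-- A common point would have its foot in both open triangles, and an open triangle meets no other
closed one. -/
lemma disjoint_collarOver {a b c a' b' c' : τ.V} (ht : τ.IsTri a b c) (ht' : τ.IsTri a' b' c')
    (hne : ({a, b, c} : Finset τ.V) ≠ {a', b', c'}) :
    Disjoint (collarOver N ε a b c) (collarOver N ε a' b' c') := by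
  refine Set.disjoint_left.2 fun y hy hy' => ?_
  obtain ⟨u, hu, hu1⟩ := h.coneFoot_mem_of_collarOver ht hy
  obtain ⟨u', hu', hu1'⟩ := h.coneFoot_mem_of_collarOver ht' hy'
  have heq : triPt a b c u = triPt a' b' c' u' :=
    τ.bijOn.injOn (hull_subset ht.mem (ht.triPt_mem (openTri_subset hu)))
      (hull_subset ht'.mem (ht'.triPt_mem (openTri_subset hu'))) (hu1.trans hu1'.symm)
  exact hne (Finset.eq_of_subset_of_card_le (ht.subset_of_openTri hu ht'.mem
    (heq ▸ ht'.triPt_mem (openTri_subset hu'))) (by rw [ht.card, ht'.card]))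

lemma integral_collarOver {a b c : τ.V} (ht : τ.PosTri N a b c) :
    ∫ y in collarOver N ε a b c, ((fderiv ℝ (twist S A' N ε (smoothProfile ε)) y).det - 1) =
      -(Real.pi / 8) * τ.triCurv N a b c := by
  have he := h.eps_pos
  refine (h.trianglePatch ht).squarePatch.integral_shell (δ := 2 * ε) (by linarith)
    (contDiff_smoothProfile ε) (smoothProfile_of_le he (by linarith))
    (smoothProfile_of_ge he (by linarith)) rfl (fun p hp t htt => h.parallelDet_pos ht hp htt)
    (h.injOn_shell ht.toIsTri) ?_ ?_
  · intro z hz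
    obtain ⟨h1, h2, h3, -⟩ := h.mem_collarParam hz
    rw [h.shell_eq, h.shell_eq]
    exact h.twist_conePt (ht.mapsTo_patch (openTri_subset h1)) h2 h3 _
  · intro z hz
    have := (h.collarOver_subset ht.toIsTri (mem_image_of_mem _ hz)).2
    exact ((h.contDiffOn_twist (isCollarProfile_smooth he) (contDiff_smoothProfile ε)).contDiffAt
      (isOpen_ne.mem_nhds this)).differentiableAt (by simp)

omit h in
lemma edge_of_not_openTri {a b c : τ.V} (ht : τ.IsTri a b c) {u : ℝ × ℝ} (hu : u ∈ stdTri)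
    (huo : u ∉ openTri) : ∃ s ∈ τ.K.faces, s.card ≤ 2 ∧ triPt a b c u ∈ τ.hull s := by
  obtain ⟨h1, h2, h3⟩ := hu
  have hm : ∀ {x y : τ.V}, ({x, y} : Finset τ.V) ⊆ {a, b, c} → {x, y} ∈ τ.K.faces := fun hs =>
    τ.K.down_closed ht.mem hs (by simp)
  rcases h1.eq_or_lt with e1 | h1'
  · refine ⟨{a, c}, hm (by intro x; simp; tauto), Finset.card_le_two,
      mem_convexHull_pair'.2 ⟨u.2, ⟨h2, by linarith⟩, ?_⟩⟩
    simp [triPt, ← e1]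
  rcases h2.eq_or_lt with e2 | h2'
  · refine ⟨{a, b}, hm (by intro x; simp; tauto), Finset.card_le_two,
      mem_convexHull_pair'.2 ⟨u.1, ⟨h1, by linarith⟩, ?_⟩⟩
    simp [triPt, ← e2]
  have e3 : u.1 = 1 - u.2 := by
    by_contra hne
    exact huo ⟨h1', h2', lt_of_le_of_ne h3 fun h => hne (by linarith)⟩
  refine ⟨{b, c}, hm (by intro x; simp; tauto), Finset.card_le_two,
    mem_convexHull_pair'.2 ⟨u.2, ⟨h2, by linarith⟩, ?_⟩⟩
  simp only [triPt, e3]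
  module

/-- Outside the collar the Jacobian of the smoothed map is `1`. -/
lemma det_fderiv_twist_of_not_mem {o : Finset τ.V → τ.V × τ.V × τ.V}
    (ho : ∀ s ∈ τ.facesOfCard 3, τ.PosTri N (o s).1 (o s).2.1 (o s).2.2 ∧
      {(o s).1, (o s).2.1, (o s).2.2} = s) {y : E4} (hy1 : ‖y‖ < 1) (hy0 : y ≠ 0)
    (hye : y ∉ coneOver N (⋃ s ∈ {s ∈ τ.K.faces | s.card ≤ 2}, τ.toFun '' τ.hull s))
    (hyW : y ∉ ⋃ s ∈ τ.facesOfCard 3, collarOver N ε (o s).1 (o s).2.1 (o s).2.2) :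
    (fderiv ℝ (twist S A' N ε (smoothProfile ε)) y).det = 1 := by
  have he := h.eps_pos
  obtain ⟨σ, hσ, hev⟩ := h.eventually_twist_smooth hy0 (by
    rintro q hq t ht ρ hρ rfl
    obtain ⟨x, hx, rfl⟩ := τ.bijOn.surjOn hq
    rw [h.norm_conePt hq t hρ.le] at hy1
    obtain ⟨a, b, c, htri, hxt⟩ := h.exists_isTri (N := N) hx
    have hs : ({a, b, c} : Finset τ.V) ∈ τ.facesOfCard 3 :=
      mem_facesOfCard.2 ⟨htri.mem, htri.toIsTri.card⟩
    obtain ⟨hp, hset⟩ := ho _ hs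
    rw [← hset] at hxt
    obtain ⟨u, hu, rfl⟩ := (mem_convexHull_triple hp.ab hp.ac hp.bc).1 hxt
    by_cases huo : u ∈ openTri
    · obtain ⟨p, hpm, rfl⟩ := exists_duffy huo
      refine hyW (mem_iUnion₂.2 ⟨_, hs, (p, (t, ρ)), ⟨hpm, ?_, hρ, hy1⟩, rfl⟩)
      exact abs_lt.1 (ht.trans_lt (by linarith))
    · obtain ⟨s', hs', hcard, hmem⟩ := edge_of_not_openTri hp.toIsTri hu huo
      exact hye ⟨_, mem_iUnion₂.2 ⟨s', ⟨hs', hcard⟩, mem_image_of_mem _ hmem⟩, t, ρ, rfl⟩)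
  rw [hev.fderiv_eq]
  have : fderiv ℝ (fun z : E4 => σ • z) y = σ • ContinuousLinearMap.id ℝ E4 :=
    ((hasFDerivAt_id y).const_smul σ).fderiv
  rw [this, ContinuousLinearMap.det]
  -- The map is σ times the identity with σ = ±1, and the dimension is four: the antipodal side
  -- contributes determinant 1 as well.
  have h4 : σ ^ 4 = 1 := by rw [show σ ^ 4 = (σ ^ 2) ^ 2 by ring, hσ, one_pow]
  simp [LinearMap.det_smul, h4]

/-- Only the collar pieces over the open triangles contribute, up to a null set. Each gives -π/8
times its total curvature, and Gauss–Bonnet sums this to -(π/8)·2π(2 - 2g). -/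
theorem integral_ball_det {g : ℕ} (hχ : τ.eulerChar = 2 - 2 * (g : ℤ))
    (hint : IntegrableOn (fun y => (fderiv ℝ (twist S A' N ε (smoothProfile ε)) y).det - 1)
      (Metric.ball 0 1)) :
    ∫ y in Metric.ball (0 : E4) 1, ((fderiv ℝ (twist S A' N ε (smoothProfile ε)) y).det - 1) =
      Real.pi ^ 2 / 2 * (g - 1) := by
  obtain ⟨o, ho⟩ := h.exists_marking (τ := τ)
  set W : Finset τ.V → Set E4 := fun s => collarOver N ε (o s).1 (o s).2.1 (o s).2.2 with hW
  have hsub : (⋃ s ∈ τ.facesOfCard 3, W s) ⊆ Metric.ball 0 1 := iUnion₂_subset fun s hs =>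
    (h.collarOver_subset (ho s hs).1.toIsTri).trans sdiff_subset
  rw [setIntegral_eq_of_subset_of_ae_sdiff_eq_zero measurableSet_ball.nullMeasurableSet hsub ?_,
    integral_biUnion_finset _ (fun s hs => h.measurableSet_collarOver (ho s hs).1.toIsTri) ?_
    (fun s hs => hint.mono_set ((h.collarOver_subset (ho s hs).1.toIsTri).trans sdiff_subset)),
    Finset.sum_congr rfl (fun s hs => h.integral_collarOver (ho s hs).1), ← Finset.mul_sum,
    h.sum_triCurv ho, hχ]
  · push_cast; ring
  · intro s hs s' hs' hne
    refine h.disjoint_collarOver (ho s hs).1.toIsTri (ho s' hs').1.toIsTri ?_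
    rw [(ho s hs).2, (ho s' hs').2]
    exact hne
  · have h0 : ∀ᵐ y : E4, y ≠ 0 := by
      simp [ae_iff, measure_singleton]
    have he : ∀ᵐ y : E4, y ∉ coneOver N (⋃ s ∈ {s ∈ τ.K.faces | s.card ≤ 2}, τ.toFun '' τ.hull s) :=
      measure_eq_zero_iff_ae_notMem.1 h.volume_coneOver_edges
    filter_upwards [h0, he] with y hy0 hye hy
    rw [h.det_fderiv_twist_of_not_mem ho (by simpa using hy.1) hy0 hye hy.2, sub_self]

end TubularSurface

/-! ### From the ball to the sphere -/

open Classical in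
/-- Radial projection of `E` to its unit sphere, with value `x₀` at the origin. -/
def radialProj {E : Type*} [NormedAddCommGroup E] [NormedSpace ℝ E]
    (x₀ : Metric.sphere (0 : E) 1) (y : E) : Metric.sphere (0 : E) 1 :=
  if hy : y = 0 then x₀ else ⟨‖y‖⁻¹ • y, by
    simp [norm_smul, inv_mul_cancel₀ (norm_ne_zero_iff.2 hy)]⟩

section RadialProj

variable {E : Type*} [NormedAddCommGroup E] [NormedSpace ℝ E] (x₀ : Metric.sphere (0 : E) 1)

lemma coe_radialProj {y : E} (hy : y ≠ 0) : (radialProj x₀ y : E) = ‖y‖⁻¹ • y := by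
  rw [radialProj, dif_neg hy]

lemma measurable_radialProj [MeasurableSpace E] [BorelSpace E] :
    Measurable (radialProj x₀) := by
  classical
  have h1 : Measurable fun y : E => if y = 0 then (x₀ : E) else ‖y‖⁻¹ • y := by
    refine Measurable.ite (measurableSet_singleton 0) measurable_const ?_
    refine measurable_of_continuousOn_compl_singleton 0 fun y hy => ?_
    have : ‖y‖ ≠ 0 := norm_ne_zero_iff.2 hy
    exact ((continuousAt_id.norm.inv₀ this).smul continuousAt_id).continuousWithinAt
  have h2 : (fun y : E => if y = 0 then (x₀ : E) else ‖y‖⁻¹ • y) =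
      fun y => (radialProj x₀ y : E) := by
    funext y
    by_cases hy : y = 0
    · simp [hy, radialProj]
    · simp [hy, coe_radialProj]
  exact (MeasurableEmbedding.subtype_coe
    Metric.isClosed_sphere.measurableSet).measurable_comp_iff.1 (by rwa [h2] at h1)

-- The surface measure of a set is the dimension times the volume of the truncated cone over it.
-- That cone is the preimage under radial projection within the ball, up to the origin, which is
-- null.
open scoped Pointwise in
lemma toSphere_eq_map [FiniteDimensional ℝ E] [Nontrivial E] [MeasurableSpace E] [BorelSpace E]
    (μ : Measure E) [μ.IsAddHaarMeasure] :
    μ.toSphere = (Module.finrank ℝ E : ENNReal) •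
      (μ.restrict (Metric.ball 0 1)).map (radialProj x₀) := by
  ext s hs
  rw [μ.toSphere_apply' hs, Measure.smul_apply, Measure.map_apply (measurable_radialProj x₀) hs,
    Measure.restrict_apply (measurable_radialProj x₀ hs), smul_eq_mul]
  congr 1
  have : Ioo (0 : ℝ) 1 • ((↑) '' s : Set E) =
      (radialProj x₀ ⁻¹' s ∩ Metric.ball 0 1) \ {0} := by
    ext y
    constructor
    · rintro ⟨t, ht, _, ⟨x, hx, rfl⟩, rfl⟩
      have hx1 : ‖(x : E)‖ = 1 := by simp
      have hn : ‖t • (x : E)‖ = t := by rw [norm_smul, hx1, mul_one, Real.norm_of_nonneg ht.1.le]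
      have h0 : t • (x : E) ≠ 0 := fun h0 => by rw [h0, norm_zero] at hn; exact ht.1.ne hn
      refine ⟨⟨?_, by simpa [hn] using ht.2⟩, h0⟩
      have : radialProj x₀ (t • (x : E)) = x := by
        ext1
        rw [coe_radialProj x₀ h0, hn, smul_smul, inv_mul_cancel₀ ht.1.ne', one_smul]
      simpa only [mem_preimage, this] using hx
    · rintro ⟨⟨h1, h2⟩, h0⟩
      have hn : ‖y‖ ≠ 0 := norm_ne_zero_iff.2 h0
      refine ⟨‖y‖, ⟨norm_pos_iff.2 h0, by simpa using h2⟩, _, mem_image_of_mem _ h1, ?_⟩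
      simp only [coe_radialProj x₀ h0, smul_smul, mul_inv_cancel₀ hn, one_smul]
  rw [this, measure_sdiff_null (measure_singleton _)]

end RadialProj

lemma volume_real_ball_E4 : (volume : Measure E4).real (Metric.ball 0 1) = Real.pi ^ 2 / 2 := by
  rw [Measure.real, InnerProductSpace.volume_ball_of_dim_even (k := 2) (by simp)]
  rw [ENNReal.ofReal_one, one_pow, one_mul, ENNReal.toReal_ofReal (by positivity)]
  norm_num [Nat.factorial]

namespace TubularSurface

variable {S A A' : Set E4} {N : E4 → E4} {ε : ℝ} (h : TubularSurface S A A' N ε)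
include h

lemma twist_smul (ψ : ℝ → ℝ) {t : ℝ} (ht : 0 < t) {y : E4} (hy : y ≠ 0) :
    twist S A' N ε ψ (t • y) = t • twist S A' N ε ψ y := by
  have hn : ‖t • y‖ = t * ‖y‖ := by rw [norm_smul, Real.norm_of_nonneg ht.le]
  rw [← h.smul_twist_normalize ψ (smul_ne_zero ht.ne' hy), ← h.smul_twist_normalize ψ hy, hn,
    smul_smul, smul_smul]
  congr 3
  have := norm_ne_zero_iff.2 hy
  field_simp

/-- The derivative of a map homogeneous of degree one is homogeneous of degree zero, so the Jacobian
on the sphere determines it on every ray. -/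
lemma fderiv_twist_smul (ψ : ℝ → ℝ) {t : ℝ} (ht : 0 < t) {y : E4} (hy : y ≠ 0) :
    fderiv ℝ (twist S A' N ε ψ) (t • y) = fderiv ℝ (twist S A' N ε ψ) y := by
  have h1 : (fun z => twist S A' N ε ψ (t • z)) =ᶠ[𝓝 y] t • twist S A' N ε ψ := by
    filter_upwards [isOpen_ne.mem_nhds hy] with z hz using h.twist_smul ψ ht hz
  have h2 := h1.fderiv_eq (𝕜 := ℝ)
  rw [fderiv_comp_smul, fderiv_const_smul_field] at h2
  exact smul_right_injective _ ht.ne' h2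

lemma sphereJacobian_twistMap {ψ : ℝ → ℝ} (hψ : IsCollarProfile ε ψ)
    (hc : ContinuousOn ψ (Ioo (-(3 * ε)) (3 * ε))) (x : S3) :
    sphereJacobian (h.twistMap hψ hc) x = (fderiv ℝ (twist S A' N ε ψ) x).det := by
  have h0 : (x : E4) ≠ 0 := ne_zero_of_mem_unit_sphere x
  have : radialExt (h.twistMap hψ hc) =ᶠ[𝓝 (x : E4)] twist S A' N ε ψ := by
    filter_upwards [isOpen_ne.mem_nhds h0] with z hz using h.radialExt_twistMap hψ hc hz
  rw [sphereJacobian, this.fderiv_eq]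

lemma continuous_sphereJacobian_twistMap {ψ : ℝ → ℝ} (hψ : IsCollarProfile ε ψ)
    (hs : ContDiff ℝ ∞ ψ) :
    Continuous (sphereJacobian (h.twistMap hψ hs.continuous.continuousOn)) := by
  have h1 := (h.contDiffOn_twist hψ hs).continuousOn_fderiv_of_isOpen isOpen_ne (by simp)
  have h2 : Continuous fun x : S3 => fderiv ℝ (twist S A' N ε ψ) x :=
    h1.comp_continuous continuous_subtype_val fun x => ne_zero_of_mem_unit_sphere x
  rw [funext (h.sphereJacobian_twistMap hψ hs.continuous.continuousOn)]
  exact ContinuousLinearMap.continuous_det.comp h2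

lemma integral_sphereJacobian_smooth {τ : SmoothTriangulation S} {g : ℕ}
    (hχ : τ.eulerChar = 2 - 2 * (g : ℤ)) :
    ∫ x, sphereJacobian (h.twistMap (isCollarProfile_smooth h.eps_pos)
      (contDiff_smoothProfile ε).continuous.continuousOn) x ∂(volume : Measure E4).toSphere =
      g * (volume : Measure E4).toSphere.real univ := by
  set J := sphereJacobian (h.twistMap (isCollarProfile_smooth h.eps_pos)
      (contDiff_smoothProfile ε).continuous.continuousOn) with hJ
  have hJc : Continuous J := h.continuous_sphereJacobian_twistMap _ (contDiff_smoothProfile ε)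
  obtain ⟨p, hp⟩ := h.surf.isConnected.nonempty
  let x₀ : S3 := ⟨p, h.surf.subset_sphere hp⟩
  have hP := measurable_radialProj x₀
  have heq : ∀ᵐ y ∂(volume.restrict (Metric.ball (0 : E4) 1)), J (radialProj x₀ y) =
      (fderiv ℝ (twist S A' N ε (smoothProfile ε)) y).det := by
    refine ae_restrict_of_ae ?_
    filter_upwards [compl_mem_ae_iff.2 (measure_singleton (μ := (volume : Measure E4)) 0)] with y hy
    rw [hJ, h.sphereJacobian_twistMap, coe_radialProj x₀ hy,
      h.fderiv_twist_smul _ (inv_pos.2 (norm_pos_iff.2 hy)) hy]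
  have : IsFiniteMeasure (volume.restrict (Metric.ball (0 : E4) 1)) :=
    isFiniteMeasure_restrict.2 measure_ball_lt_top.ne
  have hfin : IsFiniteMeasure ((volume.restrict (Metric.ball (0 : E4) 1)).map (radialProj x₀)) :=
    Measure.isFiniteMeasure_map _ _
  have hi : Integrable J ((volume.restrict (Metric.ball (0 : E4) 1)).map (radialProj x₀)) := by
    rw [← integrableOn_univ]
    exact hJc.continuousOn.integrableOn_compact isCompact_univ
  have hi' : IntegrableOn (fun y => (fderiv ℝ (twist S A' N ε (smoothProfile ε)) y).det)
      (Metric.ball 0 1) :=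
    ((integrable_map_measure hi.aestronglyMeasurable hP.aemeasurable).1 hi).congr heq
  have hone : IntegrableOn (fun _ : E4 => (1 : ℝ)) (Metric.ball 0 1) :=
    integrableOn_const measure_ball_lt_top.ne
  have hball := h.integral_ball_det hχ (hi'.sub hone)
  rw [integral_sub hi' hone, setIntegral_const, smul_eq_mul, mul_one, volume_real_ball_E4] at hball
  rw [Measure.toSphere_real_apply_univ, volume_real_ball_E4, toSphere_eq_map x₀,
    integral_smul_measure, integral_map hP.aemeasurable hi.aestronglyMeasurable,
    integral_congr_ae heq]
  simp only [finrank_euclideanSpace, Fintype.card_fin, ENNReal.toReal_natCast, smul_eq_mul]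
  -- The ball integral of the determinant is (π²/2)(g - 1) + π²/2 = g·π²/2; the factor 4 is the
  -- dimension, on both sides.
  linear_combination 4 * hball

end TubularSurface

end

/-! ### Conclusion -/

theorem mainTheorem5
    (S : Set E4) (hS : IsClosedSurface S)
    (g : ℕ) (hg : HasGenus S g)
    (A A' : Set E4) (hA : AreComplementComponents S A A')
    (N : E4 → E4) (hN : IsUnitNormalInto S A' N)
    (ε : ℝ) (hε : 0 < ε) (hΛ : IsTubularDiffeo S N (3 * ε))
    (φ : ℝ → ℝ) (hφ : IsCutoff ε φ) :
    MapsTo (extGauss S A A' N ε φ) (S3 ∪ closure (tube S N ε)) S3 ∧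
    ContinuousOn (extGauss S A A' N ε φ) (S3 ∪ closure (tube S N ε)) ∧
    ∃ q : C(S3, S3), (∀ v : S3, (q v : E4) = extGauss S A A' N ε φ v) ∧
      HasDegree q g := by
  have h : TubularSurface S A A' N ε := ⟨hS, hA, hN, hε, hΛ⟩
  obtain ⟨τ, hχ⟩ := hg
  refine ⟨h.mapsTo_extGauss hφ, h.continuousOn_extGauss hφ,
    h.twistMap (isCollarProfile_gauss hε hφ) (continuousOn_gaussProfile hφ),
    fun v => (h.extGauss_eq_twist hφ v.2).symm,
    h.twistMap (isCollarProfile_smooth hε) (contDiff_smoothProfile ε).continuous.continuousOn,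
    h.contMDiff_twistMap _ (contDiff_smoothProfile ε),
    h.twistMap_homotopic _ _ _ _, ?_⟩
  rw [h.integral_sphereJacobian_smooth hχ, Int.cast_natCast]
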